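/- **Conventions.** For a series $f=\sum_{n\ge 1}f_nz^n\in z\mathbb Z_+[[z]]$, the loop shift $\sigma_f$ is the shift map on the space of bi-infinite walks (sequences of edges; product topology over the discrete edge set) through the loop graph of $f$. This is the directed graph that is a union of first return loops to a distinguished vertex, exactly $f_n$ of them of length $n$ for each $n$, every other vertex lying on exactly one of these loops. (For $f=0$ the space is empty.) The entropy $h(T)$ of a Borel system $T$ is the supremum of the measure-theoretic entropies $h(T,\mu)$ over all $T$-invariant Borel probabilities $\mu$. If $h(\sigma_f)=\log\lambda$, then $\sigma_f$ is *strongly positive recurrent* (SPR) if $0<\log\lambda<\infty$ and $\limsup_n f_n^{1/n}<\lambda$. A map $\varphi:S\to T$ between such shifts is a *one-block code* if $(\varphi x)_n=\Phi(x_n)$ for some map $\Phi$ between the edge sets. A nonempty word $W$ occurring in $T$ is a *magic word* for $\varphi$ if (i) every $y\in T$ for which $\{n\in\mathbb Z: y[n,n+|W|-1]=W\}$ is unbounded above and below has a preimage under $\varphi$, and (ii) there is an integer $I$ such that, for every word $C$ (possibly empty) and all $x,x'\in S$ with $(\varphi x)[0,2|W|+|C|-1]=WCW=(\varphi x')[0,2|W|+|C|-1]$,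 one has $x[I,I+|W|+|C|-1]=x'[I,I+|W|+|C|-1]$. A Borel set $N$ is *entropy-negligible* for $T$ if there is $h<h(T)$ with $\mu(N)=0$ for every ergodic invariant Borel probability $\mu$ with $h(T,\mu)>h$. A map $\varphi$ from the domain of $S$ to that of $T$ is an *entropy-conjugacy* if, for some entropy-negligible $X_0$ and $Y_0$, it restricts to a shift-commuting bimeasurable bijection from the complement of $X_0$ onto the complement of $Y_0$. **Lemma (Loops Lemma).** Let $\sigma_f$ be a mixing loop shift, $f=\sum_{n\ge1}f_nz^n$, with $0<h(\sigma_f)=\log\lambda\le\infty$. Let $(r_k)_{k\ge 1}$ be a nondecreasing sequence of positive integers and let $R_n=\#\{k:r_k=n\}$. Set $f^{<1>}=f$ and $$f^{<k+1>}(z)=\bigl(f^{<k>}(z)-z^{r_k}\bigr)\sum_{n\ge0}z^{nr_k},$$ and assume that the coefficient of $z^{r_k}$ in $f^{<k>}$ satisfies $f^{<k>}_{r_k}\ge1$ for all $k\ge 1$. Then $1-f^{<k+1>}=(1-f^{<k>})/(1-z^{r_k})$ and $f^{<k>}\in z\mathbb Z_+[[z]]$ for all $k$; $r_k\to\infty$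 and all $R_n$ are finite; and for every $n$ the sequence $(f^{<k>}_n)_k$ is eventually constant. Let $f^{<\infty>}=\sum_{n\ge1}f^{<\infty>}_nz^n$, where $f_n^{<\infty>}=\lim_kf_n^{<k>}$, and let $f^{(n)}=f^{<k>}$, where $k$ is determined by the condition that $r_j<n$ if and only if $j<k$. Then: 1. There is an injective one-block code $\varphi:\sigma_{f^{<\infty>}}\to\sigma_f$. 2. For every $n\ge1$, $1-f^{(n+1)}(z)=(1-f^{(n)}(z))/(1-z^n)^{R_n}$. 3. $1-f^{<\infty>}(z)=(1-f(z))/\prod_{n=1}^\infty(1-z^n)^{R_n}$. 4. If $\limsup_nR_n^{1/n}<\lambda$, then $h(\sigma_{f^{<\infty>}})=\log\lambda$. 5. If $\limsup_nR_n^{1/n}<\lambda$, then $\sigma_f$ is SPR if and only if $\sigma_{f^{<\infty>}}$ is SPR. 6. If $R_n\le f_n$ for all $n$, and $R_n<f_n$ for $n=r_1$, then the injective one-block code $\varphi$ can be chosen to have a magic word. 7. If, in addition to the hypothesis of 6, $\limsup_nR_n^{1/n}<\lambda$, then the injective one-block code $\varphi$ can be chosen to have a magic word and also to be an entropy-conjugacy.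 -/

import Mathlib

open Filter Topology MeasureTheory PowerSeries
open scoped ENNReal PowerSeries.WithPiTopology

noncomputable section

namespace LoopsLemma

/-! ### Entropy and mixing of measurable and topological systems -/

section Systems

/-- The Shannon entropy of the join `⋁_{i < n} T⁻ⁱ P`, for a finite partition coded by
`P : X → Fin k`. -/
def joinEntropy {X : Type*} [MeasurableSpace X] (T : X → X) (μ : Measure X) {k : ℕ}
    (P : X → Fin k) (n : ℕ) : ℝ :=
  ∑ w : Fin n → Fin k, Real.negMulLog (μ.real {x | ∀ i : Fin n, P (T^[(i : ℕ)] x) = w i})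

/-- The entropy of `T` relative to the finite partition `P` (for invariant `μ` the limsup is a
limit, by subadditivity). -/
def partitionEntropy {X : Type*} [MeasurableSpace X] (T : X → X) (μ : Measure X) {k : ℕ}
    (P : X → Fin k) : EReal :=
  limsup (fun n : ℕ => ((joinEntropy T μ P n / n : ℝ) : EReal)) atTop

/-- The measure-theoretic (Kolmogorov–Sinai) entropy `h(T, μ)`: the supremum over the finite
measurable partitions. -/
def measureEntropy {X : Type*} [MeasurableSpace X] (T : X → X) (μ : Measure X) : EReal :=
  ⨆ (k : ℕ) (P : X → Fin k) (_ : Measurable P), partitionEntropy T μ P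

/-- The entropy `h(T)` of a measurable system: the supremum of the measure-theoretic entropies
over the `T`-invariant probability measures. -/
def entropy {X : Type*} [MeasurableSpace X] (T : X → X) : EReal :=
  ⨆ (μ : Measure X) (_ : IsProbabilityMeasure μ) (_ : MeasurePreserving T μ μ),
    measureEntropy T μ

/-- `N` is null for all ergodic invariant probability measures whose entropy is close enough to
the entropy of the system. -/
def EntropyNegligible {X : Type*} [MeasurableSpace X] (T : X → X) (N : Set X) : Prop :=
  MeasurableSet N ∧ ∃ h : EReal, h < entropy T ∧
    ∀ μ : Measure X, IsProbabilityMeasure μ → Ergodic T μ → h < measureEntropy T μ → μ N = 0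

/-- `φ` restricts to a bimeasurable bijection, intertwining `T` and `S`, between the complements
of entropy-negligible sets. -/
def IsEntropyConjugacy {X Y : Type*} [MeasurableSpace X] [MeasurableSpace Y]
    (T : X → X) (S : Y → Y) (φ : X → Y) : Prop :=
  ∃ (X₀ : Set X) (Y₀ : Set Y), EntropyNegligible T X₀ ∧ EntropyNegligible S Y₀ ∧
    Set.MapsTo T X₀ᶜ X₀ᶜ ∧ (∀ x ∈ X₀ᶜ, S (φ x) = φ (T x)) ∧
    ∃ γ : (X₀ᶜ : Set X) ≃ᵐ (Y₀ᶜ : Set Y), ∀ x, (γ x : Y) = φ x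

/-- Topological mixing. -/
def IsMixing {X : Type*} [TopologicalSpace X] (T : X → X) : Prop :=
  ∀ U V : Set X, IsOpen U → IsOpen V → U.Nonempty → V.Nonempty →
    ∀ᶠ n : ℕ in atTop, (U ∩ T^[n] ⁻¹' V).Nonempty

end Systems

/-! ### Edge shifts of directed graphs -/

/-- A directed graph; loops and multiple edges are allowed. -/
structure DiGraph where
  Vert : Type
  Edge : Type
  src : Edge → Vert
  tgt : Edge → Vert

/-- The doubly infinite walks through the graph, as bisequences of edges. -/
def EdgeShift (G : DiGraph) : Type :=
  {x : ℤ → G.Edge // ∀ i, G.tgt (x i) = G.src (x (i + 1))}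

/-- The topology induced by the product topology, the set of edges being discrete. -/
instance (G : DiGraph) : TopologicalSpace (EdgeShift G) :=
  letI : TopologicalSpace G.Edge := ⊥
  inferInstanceAs (TopologicalSpace {x : ℤ → G.Edge // ∀ i, G.tgt (x i) = G.src (x (i + 1))})

instance (G : DiGraph) : MeasurableSpace (EdgeShift G) := borel _

instance (G : DiGraph) : BorelSpace (EdgeShift G) := ⟨rfl⟩

/-- The shift map. -/
def shift (G : DiGraph) (x : EdgeShift G) : EdgeShift G :=
  ⟨fun i => x.1 (i + 1), fun i => x.2 (i + 1)⟩

/-- `φ` is a one-block code. -/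
def IsOneBlockCode {G H : DiGraph} (φ : EdgeShift G → EdgeShift H) : Prop :=
  ∃ Φ : G.Edge → H.Edge, ∀ x n, (φ x).1 n = Φ (x.1 n)

/-- The word `W` is read in `x` from the coordinate `i` on, i.e. `x[i, i + |W| - 1] = W`. -/
def OccursAt {G : DiGraph} (x : EdgeShift G) (i : ℤ) (W : List G.Edge) : Prop :=
  ∀ j : Fin W.length, x.1 (i + (j : ℕ)) = W.get j

/-- The nonempty word `W` of the target shift is a magic word for `φ`. -/
def IsMagicWord {G H : DiGraph} (φ : EdgeShift G → EdgeShift H) (W : List H.Edge) : Prop :=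
  W ≠ [] ∧ (∃ (y : EdgeShift H) (i : ℤ), OccursAt y i W) ∧
  (∀ y : EdgeShift H, ¬ BddAbove {n : ℤ | OccursAt y n W} → ¬ BddBelow {n : ℤ | OccursAt y n W} →
    ∃ x, φ x = y) ∧
  ∃ I : ℤ, ∀ (C : List H.Edge) (x x' : EdgeShift G),
    OccursAt (φ x) 0 (W ++ C ++ W) → OccursAt (φ x') 0 (W ++ C ++ W) →
    ∀ m : ℕ, m < W.length + C.length → x.1 (I + m) = x'.1 (I + m)

def HasMagicWord {G H : DiGraph} (φ : EdgeShift G → EdgeShift H) : Prop :=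
  ∃ W, IsMagicWord φ W

/-! ### Loop graphs and loop shifts -/

/-- An edge of the loop graph of `f`: the edge number `pos` (from `0`) of the loop number `idx`
among the `f_len` loops of length `len`. -/
structure LoopEdge (f : ℕ⟦X⟧) where
  len : ℕ
  idx : Fin (coeff len f)
  pos : Fin len

/-- The loop graph of `f`. The vertex `none` is the distinguished one; the other vertices are the
initial points of the edges that are not the first edge of their loop. -/
def loopGraph (f : ℕ⟦X⟧) : DiGraph where
  Vert := Option {e : LoopEdge f // (e.pos : ℕ) ≠ 0}
  Edge := LoopEdge f
  src e := if h : (e.pos : ℕ) ≠ 0 then some ⟨e, h⟩ else none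
  tgt e := if h : (e.pos : ℕ) + 1 < e.len then some ⟨⟨e.len, e.idx, ⟨e.pos + 1, h⟩⟩, by simp⟩
    else none

/-- The domain of the loop shift `σ_f`. -/
abbrev LoopShift (f : ℕ⟦X⟧) : Type := EdgeShift (loopGraph f)

/-- The loop shift `σ_f`. -/
abbrev sigma (f : ℕ⟦X⟧) : LoopShift f → LoopShift f := shift (loopGraph f)

/-- The sequence `|a_n|^{1/n}` has this limsup. -/
def growth (a : ℕ → ℕ) : ℝ≥0∞ :=
  limsup (fun n : ℕ => (a n : ℝ≥0∞) ^ (1 / (n : ℝ))) atTop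

/-- `σ_f` is strongly positive recurrent: its entropy `log λ` satisfies `0 < log λ < ∞`, and
`limsup |f_n|^{1/n} < λ`. -/
def IsSPR (f : ℕ⟦X⟧) : Prop :=
  ∃ l : ℝ≥0∞, entropy (sigma f) = ENNReal.log l ∧ 0 < ENNReal.log l ∧ ENNReal.log l < ⊤ ∧
    growth (fun n => coeff n f) < l

/-! ### Deleting loops -/

/-- A series over `ℕ`, read over `ℤ`. -/
def toInt (f : ℕ⟦X⟧) : ℤ⟦X⟧ := PowerSeries.map (Nat.castRingHom ℤ) f

/-- The geometric series `∑_{n ≥ 0} z^{n m}` (for `m ≥ 1`). -/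
def geomSeries (m : ℕ) : ℤ⟦X⟧ := PowerSeries.mk fun i => if m ∣ i then 1 else 0

/-- The series `f^{<k>}`, with `k` and the index of `r` counted from `0`. -/
def deleted (f : ℕ⟦X⟧) (r : ℕ → ℕ) : ℕ → ℤ⟦X⟧
  | 0 => toInt f
  | k + 1 => (deleted f r k - X ^ r k) * geomSeries (r k)

/-- `R_n`, the number of `k` with `r_k = n`. -/
def mult (r : ℕ → ℕ) (n : ℕ) : ℕ := Set.ncard {k | r k = n}

end LoopsLemma

end

/-!
The closed walks of the loop graph of `f` at the distinguished vertex form a free monoid of words,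
with `f_n` free generators of length `n`. Lazard elimination of a free generator `g` passes to the
submonoid of the words that do not start with `g`; it is free on the words `w g ⋯ g`, where `w ≠ g`
is another generator. So elimination of a generator of length `r` replaces `f` by
`(f - z ^ r) ∑ z ^ (n r)`, and the series `f^{<k>}` counts the free generators after the elimination
of `g_0, …, g_{k-1}`, of lengths `r_0, …, r_{k-1}` (`numPrim_stage`); the generators of the
intersection of all the submonoids are counted by the limit `F` (`exists_equiv`). A bijection
between the loops of the loop graph of `F` and these generators defines the one-block code
`loopCode`.

On the side of sequences, a walk `y` in the graph of `f` has base times, its visits to the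
distinguished vertex. Elimination of `g_k` deletes those among the remaining times at which `g_k`
is read up to the next remaining time. The times which are never deleted are the `markers` of `y`;
the words read between two of them are those of the limit submonoid. Hence the markers of an image
point are the base times of its preimage (`markers_loopCode`), the code is injective, and a walk
whose markers are unbounded on both sides is in the image (`mem_range_loopCode`). If `R_n ≤ f_n`,
the eliminated words can be chosen among the loops of the graph, and if moreover `R_n < f_n` for
`n = r_0`, then one loop of that length is never eliminated; its starting times are always markers,
which makes it a magic word (`hasMagicWord_loopCode`).

Entropy can only be lost on the walks outside the image. By Poincaré recurrence, almost all of these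
have no marker at all with respect to an invariant probability measure (`ae_markers_eq_empty`). A
walk without markers reads, from any base time on, a word `g_{k_1} ⋯ g_{k_t}` with
`k_1 ≤ ⋯ ≤ k_t`, and such words can be chosen arbitrarily long (`exists_chain`). They are counted by
the product of the series `(1 - z ^ r_k)⁻¹`, which converges at `s⁻¹` if `1 < s` and
`limsup R_n^{1/n} < s`. So the number of those of length `m` is at most `C s ^ m`. A covering
argument turns this into the bound `log s` for the entropy (`partitionEntropy_le_log`,
`measureEntropy_le_log`), and as `s` may be taken smaller than `λ`, the measures which live outside
the image do not contribute to the entropy; an ergodic measure of large entropy lives on the image,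
which is an invariant set.

Strong positive recurrence transfers because `f` and `F` are obtained from each other by
multiplying `1 - f` and `1 - F` by series whose coefficients grow at a smaller rate than `λ ^ n`
(`growth_lt_iff`).
-/

noncomputable section

namespace LoopsLemma

/-! ### The series `f^{<k>}` and their limit -/

section Series

lemma geomSeries_mul {m : ℕ} (hm : 0 < m) : geomSeries m * (1 - X ^ m) = 1 := by
  ext n
  rw [mul_sub, mul_one, map_sub, coeff_mul_X_pow', coeff_one, geomSeries, coeff_mk]
  rcases le_or_gt m n with h | h
  · have h0 : n ≠ 0 := by omega
    simp only [h, if_true, coeff_mk, Nat.dvd_sub_iff_left h dvd_rfl, sub_self, h0, if_false]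
  · simp only [h.not_ge, if_false, sub_zero]
    by_cases h0 : n = 0
    · simp [h0]
    · rw [if_neg h0, if_neg fun hd => absurd (Nat.le_of_dvd (Nat.pos_of_ne_zero h0) hd) (by omega)]

variable {f : ℕ⟦X⟧} {r : ℕ → ℕ}

lemma deleted_succ_mul (hr0 : ∀ k, 0 < r k) (k : ℕ) :
    deleted f r (k + 1) * (1 - X ^ r k) = deleted f r k - X ^ r k := by
  rw [deleted, mul_assoc, geomSeries_mul (hr0 k), mul_one]

lemma one_sub_deleted_succ_mul (hr0 : ∀ k, 0 < r k) (k : ℕ) :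
    (1 - deleted f r (k + 1)) * (1 - X ^ r k) = 1 - deleted f r k := by
  rw [sub_mul, deleted_succ_mul hr0]; ring

lemma coeff_deleted_succ (hr0 : ∀ k, 0 < r k) (k m : ℕ) :
    coeff m (deleted f r (k + 1)) = coeff m (deleted f r k) - (if m = r k then 1 else 0) +
      (if r k ≤ m then coeff (m - r k) (deleted f r (k + 1)) else 0) := by
  have h := congrArg (coeff m) (deleted_succ_mul (f := f) hr0 k)
  rw [mul_sub, mul_one, map_sub, coeff_mul_X_pow', map_sub, coeff_X_pow] at h
  linarith

lemma coeff_toInt (f : ℕ⟦X⟧) (n : ℕ) : coeff n (toInt f) = ((coeff n f : ℕ) : ℤ) := by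
  simp [toInt]

lemma coeff_zero_deleted (hf : constantCoeff f = 0) (hr0 : ∀ k, 0 < r k) (k : ℕ) :
    coeff 0 (deleted f r k) = 0 := by
  induction k with
  | zero =>
    rw [← coeff_zero_eq_constantCoeff_apply] at hf
    rw [deleted, coeff_toInt, hf, Nat.cast_zero]
  | succ k ih =>
    have := hr0 k
    rw [coeff_deleted_succ hr0, ih, if_neg (by omega), if_neg (by omega)]; simp

lemma coeff_deleted_nonneg (hr0 : ∀ k, 0 < r k)
    (hposit : ∀ k, 1 ≤ coeff (r k) (deleted f r k)) (k n : ℕ) :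
    0 ≤ coeff n (deleted f r k) := by
  induction k generalizing n with
  | zero => rw [deleted, coeff_toInt]; positivity
  | succ k ih =>
    induction n using Nat.strong_induction_on with
    | _ n ihn =>
      have h1 : 0 ≤ coeff n (deleted f r k) - (if n = r k then 1 else 0) := by
        split_ifs with h
        · have := hposit k
          rw [h]; omega
        · simpa using ih n
      have h2 : 0 ≤ (if r k ≤ n then coeff (n - r k) (deleted f r (k + 1)) else 0) := by
        have := hr0 k
        split_ifs with h
        · exact ihn _ (by omega)
        · exact le_rfl
      rw [coeff_deleted_succ hr0]
      omega

lemma coeff_deleted_succ_of_lt (hr0 : ∀ k, 0 < r k) {k n : ℕ} (h : n < r k) :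
    coeff n (deleted f r (k + 1)) = coeff n (deleted f r k) := by
  rw [coeff_deleted_succ hr0, if_neg (by omega), if_neg (by omega)]; simp

lemma coeff_deleted_succ_self (hf : constantCoeff f = 0) (hr0 : ∀ k, 0 < r k) (k : ℕ) :
    coeff (r k) (deleted f r (k + 1)) = coeff (r k) (deleted f r k) - 1 := by
  rw [coeff_deleted_succ hr0, if_pos rfl, if_pos le_rfl, Nat.sub_self,
    coeff_zero_deleted hf hr0, add_zero]

/-- If the lengths were bounded, they would be eventually constant, and the positive coefficient at
this length would decrease by `1` in each step. -/
lemma tendsto_lengths (hf : constantCoeff f = 0) (hr : Monotone r) (hr0 : ∀ k, 0 < r k)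
    (hposit : ∀ k, 1 ≤ coeff (r k) (deleted f r k)) : Tendsto r atTop atTop := by
  refine tendsto_atTop_atTop_of_monotone hr fun b => ?_
  by_contra! hb
  have hbdd : BddAbove (Set.range r) := ⟨b, by rintro _ ⟨k, rfl⟩; exact (hb k).le⟩
  obtain ⟨k0, hk0⟩ := Nat.sSup_mem (Set.range_nonempty r) hbdd
  have hconst : ∀ j, r (k0 + j) = r k0 := fun j =>
    le_antisymm (hk0 ▸ le_csSup hbdd ⟨k0 + j, rfl⟩) (hr (Nat.le_add_right _ _))
  have hdec : ∀ j : ℕ, coeff (r k0) (deleted f r (k0 + j)) = coeff (r k0) (deleted f r k0) - j := by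
    intro j
    induction j with
    | zero => simp
    | succ j ih =>
      have := coeff_deleted_succ_self hf hr0 (k0 + j)
      rw [hconst j, ih] at this
      rw [← add_assoc, this]; push_cast; ring
  have h1 := hposit (k0 + (coeff (r k0) (deleted f r k0)).toNat)
  rw [hconst, hdec] at h1
  omega

lemma finite_lengths_eq (hlim : Tendsto r atTop atTop) (n : ℕ) : {k | r k = n}.Finite := by
  obtain ⟨N, hN⟩ := (hlim.eventually_gt_atTop n).exists_forall_of_atTop
  refine (Set.finite_lt_nat N).subset fun k hk => ?_
  by_contra h
  have := hN k (not_lt.1 h)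
  simp at hk
  omega

lemma coeff_deleted_eq (hr0 : ∀ k, 0 < r k) {n k : ℕ} (h : ∀ j, k ≤ j → n < r j) {j : ℕ}
    (hj : k ≤ j) : coeff n (deleted f r j) = coeff n (deleted f r k) := by
  induction j, hj using Nat.le_induction with
  | base => rfl
  | succ j hj ih => rw [coeff_deleted_succ_of_lt hr0 (h j hj), ih]

lemma exists_limit (hr0 : ∀ k, 0 < r k) (hr : Monotone r) (hlim : Tendsto r atTop atTop)
    (hposit : ∀ k, 1 ≤ coeff (r k) (deleted f r k)) :
    ∃ F : ℕ⟦X⟧, ∀ n k, n < r k → coeff n (deleted f r k) = ((coeff n F : ℕ) : ℤ) := by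
  have hN : ∀ n, ∃ N, n < r N := fun n => (hlim.eventually_gt_atTop n).exists
  choose N hN using hN
  refine ⟨PowerSeries.mk fun n => (coeff n (deleted f r (N n))).toNat, fun n k hk => ?_⟩
  rw [coeff_mk, Int.toNat_of_nonneg (coeff_deleted_nonneg hr0 hposit _ _)]
  rcases le_total k (N n) with h | h
  · exact (coeff_deleted_eq hr0 (fun j hj => hk.trans_le (hr hj)) h).symm
  · exact coeff_deleted_eq hr0 (fun j hj => (hN n).trans_le (hr hj)) h

/-- The number of `k` with `r k < n`. -/
def numLt (r : ℕ → ℕ) (n : ℕ) : ℕ := sInf {k | n ≤ r k}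

lemma lt_iff_lt_numLt (hr : Monotone r) (hlim : Tendsto r atTop atTop) (n j : ℕ) :
    r j < n ↔ j < numLt r n := by
  have hne : {k | n ≤ r k}.Nonempty := (hlim.eventually_ge_atTop n).exists
  constructor
  · intro h
    by_contra! hc
    have := Nat.sInf_mem hne
    have h2 := hr hc
    simp only [Set.mem_ofPred_eq] at this
    exact absurd (this.trans h2) (not_le.2 h)
  · intro h
    by_contra! hc
    exact absurd (Nat.sInf_le (show j ∈ {k | n ≤ r k} from hc)) (not_le.2 h)

lemma numLt_succ (hr : Monotone r) (hlim : Tendsto r atTop atTop) (n : ℕ) :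
    numLt r (n + 1) = numLt r n + mult r n := by
  have h1 := lt_iff_lt_numLt hr hlim n
  have h2 := lt_iff_lt_numLt hr hlim (n + 1)
  have hle : numLt r n ≤ numLt r (n + 1) := by
    by_contra! hc
    have := (h1 _).2 hc
    have := (h2 (numLt r (n + 1))).1 (by omega)
    omega
  have : {k | r k = n} = ↑(Finset.Ico (numLt r n) (numLt r (n + 1))) := by
    ext k
    have := h1 k
    have := h2 k
    simp only [Set.mem_ofPred_eq, Finset.coe_Ico, Set.mem_Ico]
    omega
  rw [mult, this, Set.ncard_coe_finset, Nat.card_Ico]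
  omega

lemma one_sub_deleted_numLt (hr : Monotone r) (hr0 : ∀ k, 0 < r k)
    (hlim : Tendsto r atTop atTop) (n : ℕ) :
    (1 - deleted f r (numLt r (n + 1))) * (1 - X ^ n) ^ mult r n =
      1 - deleted f r (numLt r n) := by
  have hs := numLt_succ hr hlim n
  have key : ∀ j, j ≤ mult r n → (1 - deleted f r (numLt r n + j)) * (1 - X ^ n) ^ j =
      1 - deleted f r (numLt r n) := by
    intro j hj
    induction j with
    | zero => simp
    | succ j ih =>
      have h1 := lt_iff_lt_numLt hr hlim n (numLt r n + j)
      have h2 := lt_iff_lt_numLt hr hlim (n + 1) (numLt r n + j)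
      have h3 : r (numLt r n + j) = n := by omega
      have h4 := one_sub_deleted_succ_mul (f := f) hr0 (numLt r n + j)
      rw [h3] at h4
      rw [pow_succ', ← mul_assoc, ← add_assoc, h4, ih (by omega)]
  rw [hs, key _ le_rfl]

lemma numLt_one (hr : Monotone r) (hr0 : ∀ k, 0 < r k) (hlim : Tendsto r atTop atTop) :
    numLt r 1 = 0 := by
  by_contra h
  have := (lt_iff_lt_numLt hr hlim 1 0).2 (Nat.pos_of_ne_zero h)
  have := hr0 0
  omega

lemma one_sub_deleted_mul_prod (hr : Monotone r) (hr0 : ∀ k, 0 < r k)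
    (hlim : Tendsto r atTop atTop) (N : ℕ) :
    (1 - deleted f r (numLt r (N + 1))) *
      ∏ n ∈ Finset.range N, (1 - X ^ (n + 1) : ℤ⟦X⟧) ^ mult r (n + 1) = 1 - toInt f := by
  induction N with
  | zero => simp [numLt_one hr hr0 hlim, deleted]
  | succ N ih =>
    rw [Finset.prod_range_succ, mul_comm (∏ n ∈ _, _), ← mul_assoc,
      one_sub_deleted_numLt hr hr0 hlim (N + 1), ih]

lemma exists_hasProd (hr : Monotone r) (hr0 : ∀ k, 0 < r k) (hlim : Tendsto r atTop atTop)
    {F : ℕ⟦X⟧} (hF : ∀ n k, n < r k → coeff n (deleted f r k) = ((coeff n F : ℕ) : ℤ)) :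
    ∃ P : ℤ⟦X⟧, HasProd (fun n : ℕ => (1 - X ^ (n + 1) : ℤ⟦X⟧) ^ mult r (n + 1)) P ∧
        constantCoeff P = 1 ∧ (1 - toInt F) * P = 1 - toInt f := by
  have hmul : Multipliable (fun n : ℕ => (1 - X ^ (n + 1) : ℤ⟦X⟧) ^ mult r (n + 1)) := by
    have := WithPiTopology.multipliable_one_add_of_tendsto_order_atTop_nhds_top (R := ℤ)
      (f := fun n : ℕ => (1 - X ^ (n + 1) : ℤ⟦X⟧) ^ mult r (n + 1) - 1) ?_
    · simpa using this
    · rw [ENat.tendsto_nhds_top_iff_natCast_lt]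
      intro N
      filter_upwards [eventually_ge_atTop N] with n hn
      have hdvd : (X : ℤ⟦X⟧) ^ (n + 1) ∣ (1 - X ^ (n + 1) : ℤ⟦X⟧) ^ mult r (n + 1) - 1 := by
        have := sub_dvd_pow_sub_pow (1 - X ^ (n + 1) : ℤ⟦X⟧) 1 (mult r (n + 1))
        rw [one_pow] at this
        refine dvd_trans ?_ this
        rw [sub_sub_cancel_left]
        exact (dvd_neg).2 dvd_rfl
      refine lt_of_lt_of_le ?_ (PowerSeries.le_order _ (n + 1) fun i hi =>
        (X_pow_dvd_iff.1 hdvd) i (by exact_mod_cast hi))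
      exact_mod_cast Nat.lt_succ_of_le hn
  obtain ⟨P, hP⟩ := hmul
  have hPt := hP.tendsto_prod_nat
  refine ⟨P, hP, ?_, ?_⟩
  · have h1 := ((WithPiTopology.continuous_constantCoeff ℤ).tendsto P).comp hPt
    refine tendsto_nhds_unique h1 ?_
    refine tendsto_const_nhds.congr fun N => ?_
    simp [map_prod]
  · have hd : Tendsto (fun N => 1 - deleted f r (numLt r (N + 1))) atTop (𝓝 (1 - toInt F)) := by
      refine tendsto_const_nhds.sub ?_
      rw [WithPiTopology.tendsto_iff_coeff_tendsto]
      intro n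
      refine tendsto_const_nhds.congr' ?_
      filter_upwards [eventually_ge_atTop n] with N hN
      have h1 := lt_iff_lt_numLt hr hlim (N + 1) (numLt r (N + 1))
      rw [coeff_toInt, hF n _ (by omega)]
    have h2 := hd.mul hPt
    refine tendsto_nhds_unique h2 ?_
    exact tendsto_const_nhds.congr fun N => (one_sub_deleted_mul_prod hr hr0 hlim N).symm

end Series

/-! ### Exponential growth of coefficients -/

section Growth

lemma exists_le_pow_of_growth_lt {a : ℕ → ℕ} {s : ℝ} (hs : 0 < s)
    (h : growth a < ENNReal.ofReal s) : ∃ K : ℝ, 0 ≤ K ∧ ∀ n, (a n : ℝ) ≤ K * s ^ n := by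
  have h1 := eventually_lt_of_limsup_lt h
  obtain ⟨N, hN⟩ := (h1.and (eventually_gt_atTop 0)).exists_forall_of_atTop
  have h2 : ∀ n, N ≤ n → (a n : ℝ) ≤ s ^ n := by
    intro n hn
    obtain ⟨h3, h4⟩ := hN n hn
    have h5 : (a n : ℝ≥0∞) ≤ ENNReal.ofReal s ^ n := by
      have := ENNReal.rpow_le_rpow h3.le (Nat.cast_nonneg (α := ℝ) n)
      rwa [← ENNReal.rpow_mul, one_div, inv_mul_cancel₀ (by positivity), ENNReal.rpow_one,
        ENNReal.rpow_natCast] at this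
    rw [← ENNReal.ofReal_pow hs.le, ← ENNReal.ofReal_natCast] at h5
    exact (ENNReal.ofReal_le_ofReal_iff (by positivity)).1 h5
  have hpos : ∀ n, 0 ≤ (a n : ℝ) / s ^ n := fun n => by positivity
  have hS : 0 ≤ ∑ n ∈ Finset.range N, (a n : ℝ) / s ^ n := Finset.sum_nonneg fun n _ => hpos n
  refine ⟨1 + ∑ n ∈ Finset.range N, (a n : ℝ) / s ^ n, by positivity, fun n => ?_⟩
  rcases le_or_gt N n with hn | hn
  · exact (h2 n hn).trans (le_mul_of_one_le_left (by positivity) (by linarith))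
  · rw [← div_le_iff₀ (by positivity)]
    have := Finset.single_le_sum (f := fun n => (a n : ℝ) / s ^ n) (fun n _ => hpos n)
      (Finset.mem_range.2 hn)
    linarith

lemma growth_le_of_le_pow {a : ℕ → ℕ} {s K : ℝ} (hs : 0 ≤ s) (h : ∀ n, (a n : ℝ) ≤ K * s ^ n) :
    growth a ≤ ENNReal.ofReal s := by
  set L := max K 1 with hL
  have hL1 : 1 ≤ L := le_max_right _ _
  have hb : ∀ᶠ n : ℕ in atTop, (a n : ℝ≥0∞) ^ (1 / (n : ℝ)) ≤
      ENNReal.ofReal (L ^ (1 / (n : ℝ)) * s) := by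
    filter_upwards [eventually_gt_atTop 0] with n hn
    have h1 : (a n : ℝ≥0∞) ≤ ENNReal.ofReal (L * s ^ n) := by
      rw [← ENNReal.ofReal_natCast]
      exact ENNReal.ofReal_le_ofReal ((h n).trans (by gcongr; exact le_max_left _ _))
    refine (ENNReal.rpow_le_rpow h1 (by positivity)).trans ?_
    rw [ENNReal.ofReal_rpow_of_nonneg (by positivity) (by positivity),
      Real.mul_rpow (by positivity) (by positivity), ← Real.rpow_natCast s n, ← Real.rpow_mul hs,
      mul_one_div_cancel (by positivity), Real.rpow_one]
  have ht : Tendsto (fun n : ℕ => ENNReal.ofReal (L ^ (1 / (n : ℝ)) * s)) atTop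
      (𝓝 (ENNReal.ofReal s)) := by
    refine ENNReal.tendsto_ofReal ?_
    have h2 : Tendsto (fun n : ℕ => L ^ (1 / (n : ℝ))) atTop (𝓝 (L ^ (0 : ℝ))) :=
      tendsto_const_nhds.rpow tendsto_one_div_atTop_nhds_zero_nat (Or.inl (by positivity))
    simpa using h2.mul_const s
  exact (limsup_le_limsup hb).trans ht.limsup_eq.le

lemma exists_real_between {x y : ℝ≥0∞} (h : x < y) (hy : 1 < y) :
    ∃ s : ℝ, 1 < s ∧ x < ENNReal.ofReal s ∧ ENNReal.ofReal s < y := by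
  obtain ⟨t, ht1, ht2⟩ := ENNReal.lt_iff_exists_nnreal_btwn.1 (max_lt h hy)
  refine ⟨t, ?_, ?_, ?_⟩
  · exact_mod_cast (le_max_right _ _).trans_lt ht1
  · simpa using (le_max_left _ _).trans_lt ht1
  · simpa using ht2

variable {r : ℕ → ℕ}

/-- The value at `s⁻¹` of `∏_{j < k} (1 - z ^ r_j)⁻¹`. -/
def prodVal (r : ℕ → ℕ) (s : ℝ) (k : ℕ) : ℝ := ∏ j ∈ Finset.range k, (1 - (s⁻¹) ^ r j)⁻¹

lemma prodVal_succ (r : ℕ → ℕ) (s : ℝ) (k : ℕ) :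
    prodVal r s (k + 1) = prodVal r s k * (1 - (s⁻¹) ^ r k)⁻¹ := Finset.prod_range_succ _ _

lemma inv_pow_le {s : ℝ} (hs : 1 < s) {n : ℕ} (hn : 0 < n) : (s⁻¹) ^ n ≤ s⁻¹ :=
  pow_le_of_le_one (by positivity) (inv_le_one_of_one_le₀ hs.le) hn.ne'

lemma one_sub_inv_pow_pos {s : ℝ} (hs : 1 < s) {n : ℕ} (hn : 0 < n) : 0 < 1 - (s⁻¹) ^ n := by
  have := inv_pow_le hs hn
  have := inv_lt_one_of_one_lt₀ hs
  linarith

lemma inv_pow_mul_pow {s : ℝ} (hs : 0 < s) {n m : ℕ} (h : n ≤ m) :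
    (s⁻¹) ^ n * s ^ m = s ^ (m - n) := by
  rw [pow_sub₀ _ hs.ne' h, inv_pow, mul_comm]

lemma prodVal_nonneg {s : ℝ} (hs : 1 < s) (hr0 : ∀ k, 0 < r k) (k : ℕ) : 0 ≤ prodVal r s k :=
  Finset.prod_nonneg fun j _ => (inv_pos.2 (one_sub_inv_pow_pos hs (hr0 j))).le

/-- The products `∏_{j < k} (1 - z ^ r_j)⁻¹` are bounded at `s⁻¹`, for `s` larger than `1` and
than the growth rate of the multiplicities. -/
lemma exists_prodVal_le {s : ℝ} (hs : 1 < s) (hr0 : ∀ k, 0 < r k)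
    (hfin : ∀ n, {k | r k = n}.Finite) (hg : growth (mult r) < ENNReal.ofReal s) :
    ∃ C : ℝ, 1 ≤ C ∧ ∀ k, prodVal r s k ≤ C := by
  obtain ⟨t, ht1, htg, hts⟩ := exists_real_between hg (by simpa using hs)
  obtain ⟨K, hK0, hK⟩ := exists_le_pow_of_growth_lt (by linarith) htg
  have hts' : t < s := (ENNReal.ofReal_lt_ofReal_iff (by linarith)).1 hts
  have hsum : Summable fun n => (mult r n : ℝ) * (s⁻¹) ^ n := by
    refine Summable.of_nonneg_of_le (fun n => by positivity) (fun n => ?_)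
      ((summable_geometric_of_lt_one (r := t / s) (by positivity)
        ((div_lt_one (by linarith)).2 hts')).mul_left K)
    rw [div_eq_mul_inv, mul_pow, ← mul_assoc]
    gcongr
    exact hK n
  have hS : ∀ k, ∑ j ∈ Finset.range k, (s⁻¹) ^ r j ≤ ∑' n, (mult r n : ℝ) * (s⁻¹) ^ n := by
    intro k
    rw [Finset.sum_comp (fun n => (s⁻¹) ^ n) r]
    refine le_trans (Finset.sum_le_sum fun n _ => ?_) (hsum.sum_le_tsum _ fun n _ => by positivity)
    rw [nsmul_eq_mul]
    gcongr
    rw [mult, ← Set.ncard_coe_finset]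
    exact Set.ncard_le_ncard (fun j hj => by simp at hj; exact hj.2) (hfin n)
  set c : ℝ := (1 - s⁻¹)⁻¹ with hc
  have hs1 : 0 < 1 - s⁻¹ := by simpa using one_sub_inv_pow_pos hs one_pos
  refine ⟨Real.exp (c * ∑' n, (mult r n : ℝ) * (s⁻¹) ^ n), ?_, fun k => ?_⟩
  · rw [Real.one_le_exp_iff]
    exact mul_nonneg (inv_pos.2 hs1).le (tsum_nonneg fun n => by positivity)
  -- As `x ≤ s⁻¹`, the factor `(1 - x)⁻¹` is at most `1 + c x`, so the product is bounded through
  -- the sum of the `x`, which is the series of the `R_n s⁻ⁿ`.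
  have hfac : ∀ j, (1 - (s⁻¹) ^ r j)⁻¹ ≤ Real.exp (c * (s⁻¹) ^ r j) := by
    intro j
    set x := (s⁻¹) ^ r j with hx
    have hx0 : 0 ≤ x := by positivity
    have hx1 : x ≤ s⁻¹ := inv_pow_le hs (hr0 j)
    have h1 : 0 < 1 - x := by linarith
    refine le_trans ?_ (Real.add_one_le_exp _)
    have h2 : (1 - x)⁻¹ ≤ c := inv_anti₀ hs1 (by linarith)
    calc (1 - x)⁻¹ = (1 - x)⁻¹ * x + 1 := by field_simp; ring
      _ ≤ c * x + 1 := by gcongr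
  calc prodVal r s k ≤ ∏ j ∈ Finset.range k, Real.exp (c * (s⁻¹) ^ r j) :=
        Finset.prod_le_prod (fun j _ => (inv_pos.2 (one_sub_inv_pow_pos hs (hr0 j))).le)
          fun j _ => hfac j
    _ = Real.exp (c * ∑ j ∈ Finset.range k, (s⁻¹) ^ r j) := by
        rw [← Real.exp_sum, Finset.mul_sum]
    _ ≤ _ := by
        gcongr
        exact hS k

/-- A bound for a sequence satisfying the recursion of a multiplication by `(1 - z ^ n)⁻¹`. -/
lemma le_of_geom_recursion {a b : ℕ → ℝ} {s K : ℝ} (hs : 1 < s) {n : ℕ} (hn : 0 < n)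
    (hK : 0 ≤ K) (ha : ∀ m, a m ≤ K * s ^ m)
    (hb : ∀ m, b m ≤ a m + if n ≤ m then b (m - n) else 0) (m : ℕ) :
    b m ≤ K * (1 - (s⁻¹) ^ n)⁻¹ * s ^ m := by
  have h1 := one_sub_inv_pow_pos hs hn
  induction m using Nat.strong_induction_on with
  | _ m ih =>
    have hkey : K * s ^ m + K * (1 - (s⁻¹) ^ n)⁻¹ * ((s⁻¹) ^ n * s ^ m) =
        K * (1 - (s⁻¹) ^ n)⁻¹ * s ^ m := by
      have h2 := h1.ne'
      generalize (s⁻¹) ^ n = x at h2 ⊢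
      field_simp
      ring
    refine (hb m).trans ?_
    rw [← hkey]
    refine add_le_add (ha m) ?_
    split_ifs with h
    · refine (ih (m - n) (by omega)).trans (le_of_eq ?_)
      rw [inv_pow_mul_pow (by linarith) h]
    · positivity

lemma abs_coeff_prod_geomSeries_le {s : ℝ} (hs : 1 < s) (hr0 : ∀ k, 0 < r k) (k m : ℕ) :
    |((coeff m (∏ j ∈ Finset.range k, geomSeries (r j)) : ℤ) : ℝ)| ≤ prodVal r s k * s ^ m := by
  induction k generalizing m with
  | zero =>
    simp only [Finset.range_zero, Finset.prod_empty, coeff_one, prodVal, one_mul]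
    have : 1 ≤ s ^ m := one_le_pow₀ hs.le
    split_ifs <;> simp <;> linarith
  | succ k ih =>
    rw [prodVal_succ]
    refine le_of_geom_recursion (b := fun m => |((coeff m
      (∏ j ∈ Finset.range (k + 1), geomSeries (r j)) : ℤ) : ℝ)|) hs (hr0 k)
      (prodVal_nonneg hs hr0 k) ih (fun m => ?_) m
    have h : (∏ j ∈ Finset.range (k + 1), geomSeries (r j)) =
        (∏ j ∈ Finset.range k, geomSeries (r j)) +
          (∏ j ∈ Finset.range (k + 1), geomSeries (r j)) * X ^ r k := by
      rw [Finset.prod_range_succ]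
      linear_combination (∏ j ∈ Finset.range k, geomSeries (r j)) * geomSeries_mul (hr0 k)
    have h2 := congrArg (coeff m) h
    rw [map_add, coeff_mul_X_pow'] at h2
    rw [h2, Int.cast_add]
    refine (abs_add_le _ _).trans (add_le_add le_rfl ?_)
    split_ifs <;> simp

lemma abs_coeff_prod_one_sub_le {s : ℝ} (hs : 1 < s) (hr0 : ∀ k, 0 < r k) (k m : ℕ) :
    |((coeff m (∏ j ∈ Finset.range k, (1 - X ^ r j : ℤ⟦X⟧)) : ℤ) : ℝ)| ≤
      prodVal r s k * s ^ m := by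
  induction k generalizing m with
  | zero =>
    simp only [Finset.range_zero, Finset.prod_empty, coeff_one, prodVal, one_mul]
    have : 1 ≤ s ^ m := one_le_pow₀ hs.le
    split_ifs <;> simp <;> linarith
  | succ k ih =>
    rw [prodVal_succ]
    have h1 := one_sub_inv_pow_pos hs (hr0 k)
    have hK := prodVal_nonneg hs hr0 k
    have hs0 : 0 < s := by linarith
    have h2 : 1 + (s⁻¹) ^ r k ≤ (1 - (s⁻¹) ^ r k)⁻¹ := by
      generalize (s⁻¹) ^ r k = x at h1 ⊢
      rw [inv_eq_one_div, le_div_iff₀ h1]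
      nlinarith [sq_nonneg x]
    rw [Finset.prod_range_succ, mul_sub, mul_one, map_sub, coeff_mul_X_pow', Int.cast_sub]
    calc _ ≤ prodVal r s k * s ^ m + prodVal r s k * (s⁻¹) ^ r k * s ^ m := by
          refine (abs_sub _ _).trans (add_le_add (ih m) ?_)
          split_ifs with h
          · refine (ih _).trans (le_of_eq ?_)
            rw [mul_assoc, inv_pow_mul_pow hs0 h]
          · simp only [Int.cast_zero, abs_zero]; positivity
      _ = prodVal r s k * (1 + (s⁻¹) ^ r k) * s ^ m := by ring
      _ ≤ _ := by gcongr

lemma abs_coeff_mul_le {a b : ℤ⟦X⟧} {s K K' : ℝ} (n : ℕ)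
    (ha : ∀ i ≤ n, |((coeff i a : ℤ) : ℝ)| ≤ K * s ^ i)
    (hb : ∀ i, |((coeff i b : ℤ) : ℝ)| ≤ K' * s ^ i) :
    |((coeff n (a * b) : ℤ) : ℝ)| ≤ (n + 1) * (K * K') * s ^ n := by
  rw [coeff_mul, Int.cast_sum]
  refine (Finset.abs_sum_le_sum_abs _ _).trans ?_
  have h : ∀ p ∈ Finset.HasAntidiagonal.antidiagonal n, |((coeff p.1 a * coeff p.2 b : ℤ) : ℝ)| ≤
      K * K' * s ^ n := by
    intro p hp
    rw [Finset.HasAntidiagonal.mem_antidiagonal] at hp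
    rw [Int.cast_mul, abs_mul, ← hp, pow_add]
    calc _ ≤ (K * s ^ p.1) * (K' * s ^ p.2) :=
          mul_le_mul (ha _ (by omega)) (hb _) (abs_nonneg _)
            ((abs_nonneg _).trans (ha p.1 (by omega)))
      _ = _ := by ring
  refine (Finset.sum_le_card_nsmul _ _ _ h).trans ?_
  rw [Finset.Nat.card_antidiagonal, nsmul_eq_mul]
  push_cast
  exact le_of_eq (by ring)

/-- A polynomial factor is absorbed by a larger exponential rate. -/
lemma growth_le_of_le_mul_pow {a : ℕ → ℕ} {s t K : ℝ} (hs : 0 < s) (hst : s < t) (hK : 0 ≤ K)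
    (h : ∀ n, (a n : ℝ) ≤ (n + 1) * K * s ^ n) : growth a ≤ ENNReal.ofReal t := by
  set δ := t / s - 1 with hδ
  have hδ0 : 0 < δ := by
    have := (one_lt_div hs).2 hst
    linarith
  refine growth_le_of_le_pow (K := (1 + δ⁻¹) * K) (by linarith) fun n => (h n).trans ?_
  have ht : t = s * (1 + δ) := by rw [hδ]; field_simp; ring
  have hb : 1 + (n : ℝ) * δ ≤ (1 + δ) ^ n := one_add_mul_le_pow (by linarith) n
  have h2 : ((n : ℝ) + 1) ≤ (1 + δ⁻¹) * (1 + δ) ^ n := by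
    calc ((n : ℝ) + 1) ≤ (1 + δ⁻¹) * (1 + n * δ) := by
          have : (1 + δ⁻¹) * (1 + n * δ) = n + 1 + n * δ + δ⁻¹ := by field_simp; ring
          rw [this]
          have : 0 ≤ n * δ + δ⁻¹ := by positivity
          linarith
      _ ≤ _ := by gcongr
  rw [ht, mul_pow]
  calc ((n : ℝ) + 1) * K * s ^ n ≤ ((1 + δ⁻¹) * (1 + δ) ^ n) * K * s ^ n := by gcongr
    _ = _ := by ring

variable {f : ℕ⟦X⟧}

lemma one_sub_deleted_eq_mul_prod_geomSeries (k : ℕ) (hr0 : ∀ k, 0 < r k) :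
    1 - deleted f r k = (1 - toInt f) * ∏ j ∈ Finset.range k, geomSeries (r j) := by
  induction k with
  | zero => simp [deleted]
  | succ k ih =>
    rw [Finset.prod_range_succ, ← mul_assoc, ← ih, deleted]
    linear_combination - geomSeries_mul (hr0 k)

lemma one_sub_deleted_mul_prod_one_sub (k : ℕ) (hr0 : ∀ k, 0 < r k) :
    (1 - deleted f r k) * ∏ j ∈ Finset.range k, (1 - X ^ r j : ℤ⟦X⟧) = 1 - toInt f := by
  induction k with
  | zero => simp [deleted]
  | succ k ih =>
    rw [Finset.prod_range_succ, mul_comm (∏ j ∈ _, _), ← mul_assoc,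
      one_sub_deleted_succ_mul hr0, ih]

lemma abs_coeff_one_sub_le {a : ℤ⟦X⟧} {s K : ℝ} (hs : 1 < s) {n : ℕ}
    (ha : |((coeff n a : ℤ) : ℝ)| ≤ K * s ^ n) :
    |((coeff n (1 - a) : ℤ) : ℝ)| ≤ (K + 1) * s ^ n := by
  have h1 : 1 ≤ s ^ n := one_le_pow₀ hs.le
  rw [map_sub, Int.cast_sub, coeff_one]
  refine (abs_sub _ _).trans ?_
  have : |(((if n = 0 then 1 else 0 : ℤ)) : ℝ)| ≤ s ^ n := by
    split_ifs <;> simp <;> linarith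
  linarith

/-- Deleting loops preserves the condition that the growth rate is less than `l`. -/
lemma growth_lt_iff {F : ℕ⟦X⟧} {l : ℝ≥0∞} (hl : 1 < l) (hr0 : ∀ k, 0 < r k)
    (hlim : Tendsto r atTop atTop) (hfin : ∀ n, {k | r k = n}.Finite)
    (hF : ∀ n k, n < r k → coeff n (deleted f r k) = ((coeff n F : ℕ) : ℤ))
    (hg : growth (mult r) < l) :
    growth (fun n => coeff n f) < l ↔ growth (fun n => coeff n F) < l := by
  have hpass : ∀ (a b : ℕ⟦X⟧) (Q : ℕ → ℤ⟦X⟧) (d e : ℕ → ℤ⟦X⟧),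
      (∀ k, 1 - d k = (1 - e k) * Q k) →
      (∀ n k, n < r k → coeff n (d k) = ((coeff n a : ℕ) : ℤ)) →
      (∀ n k, n < r k → coeff n (e k) = ((coeff n b : ℕ) : ℤ)) →
      (∀ s, 1 < s → ∀ k m, |((coeff m (Q k) : ℤ) : ℝ)| ≤ prodVal r s k * s ^ m) →
      growth (fun n => coeff n b) < l → growth (fun n => coeff n a) < l := by
    intro a b Q d e hde hda heb hQ hb
    obtain ⟨t, ht1, hgt, htl⟩ := exists_real_between (max_lt hg hb) hl
    obtain ⟨s, hs1, hgs, hst⟩ := exists_real_between hgt (by simpa using ht1)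
    have hst' : s < t := (ENNReal.ofReal_lt_ofReal_iff (by linarith)).1 hst
    obtain ⟨C, hC1, hC⟩ := exists_prodVal_le hs1 hr0 hfin ((le_max_left _ _).trans_lt hgs)
    obtain ⟨K, hK0, hK⟩ := exists_le_pow_of_growth_lt (by linarith)
      ((le_max_right _ _).trans_lt hgs)
    have hs0 : 0 < s := by linarith
    refine lt_of_le_of_lt (growth_le_of_le_mul_pow (s := s) (t := t) (K := (K + 1) * C + 1) hs0 hst'
      (by positivity) fun n => ?_) htl
    obtain ⟨k, hk⟩ := (hlim.eventually_gt_atTop n).exists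
    have h1 := abs_coeff_mul_le (a := 1 - e k) (b := Q k) (K := K + 1) (K' := C) n
      (fun i hi => abs_coeff_one_sub_le hs1 (by
        rw [heb i k (by omega)]
        simpa using hK i))
      (fun i => (hQ s hs1 k i).trans (by gcongr; exact hC k))
    rw [← hde] at h1
    have h2 : ((coeff n a : ℕ) : ℝ) = ((coeff n (1 - (1 - d k)) : ℤ) : ℝ) := by
      rw [sub_sub_cancel, hda n k hk]; simp
    have h3 := abs_coeff_one_sub_le (n := n) hs1 h1
    rw [← h2] at h3
    refine (le_abs_self _).trans (h3.trans ?_)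
    gcongr
    have : (0 : ℝ) ≤ n := by positivity
    nlinarith
  have hf : ∀ n k, n < r k → coeff n (toInt f) = ((coeff n f : ℕ) : ℤ) :=
    fun n _ _ => coeff_toInt f n
  constructor
  · exact hpass F f (fun k => ∏ j ∈ Finset.range k, geomSeries (r j)) (deleted f r)
      (fun _ => toInt f) (fun k => one_sub_deleted_eq_mul_prod_geomSeries k hr0) hF hf
      (fun s hs k m => abs_coeff_prod_geomSeries_le hs hr0 k m)
  · exact hpass f F (fun k => ∏ j ∈ Finset.range k, (1 - X ^ r j)) (fun _ => toInt f)
      (deleted f r) (fun k => (one_sub_deleted_mul_prod_one_sub k hr0).symm) hf hF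
      (fun s hs k m => abs_coeff_prod_one_sub_le hs hr0 k m)

end Growth

/-! ### Elimination in free submonoids of words -/

section Words

variable {α : Type*}

/-- A submonoid of the free monoid of words which contains `u` as soon as it contains `v` and
`u ++ v`. Such a submonoid is free. -/
structure IsUnitary (M : Set (List α)) : Prop where
  nil_mem : [] ∈ M
  append_mem : ∀ {u v}, u ∈ M → v ∈ M → u ++ v ∈ M
  of_append : ∀ {u v}, v ∈ M → u ++ v ∈ M → u ∈ M

/-- The free generators of a unitary submonoid: its nonempty words without a proper nonempty
suffix in the submonoid. -/
def Prim (M : Set (List α)) : Set (List α) :=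
  {w | w ∈ M ∧ w ≠ [] ∧ ∀ u v, w = u ++ v → u ≠ [] → v ≠ [] → v ∉ M}

/-- The words of `M` which do not start with the generator `g` (Lazard elimination: the free
generators of this submonoid are the words `w g ⋯ g` with `w ≠ g` a generator of `M`). -/
def elim (M : Set (List α)) (g : List α) : Set (List α) :=
  {w | w ∈ M ∧ ∀ v ∈ M, w ≠ g ++ v}

lemma elim_subset (M : Set (List α)) (g : List α) : elim M g ⊆ M := fun _ h => h.1

/-- In a unitary submonoid, a word with a generator `g` as a prefix, split at a point of the
submonoid, is split after `g` or is split at its beginning. -/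
lemma IsUnitary.split_cases {M : Set (List α)} (hM : IsUnitary M) {g : List α} (hg : g ∈ Prim M)
    {u v t : List α} (hv : v ∈ M) (ht : t ∈ M) (h : u ++ v = g ++ t) :
    u = [] ∨ ∃ c ∈ M, u = g ++ c ∧ t = c ++ v := by
  rcases List.append_eq_append_iff.1 h with ⟨a, ha, hva⟩ | ⟨c, hc, htc⟩
  · have haM : a ∈ M := hM.of_append ht (hva ▸ hv)
    by_cases hu : u = []
    · exact Or.inl hu
    · by_cases ha0 : a = []
      · subst ha0
        exact Or.inr ⟨[], hM.nil_mem, by simpa using ha.symm, by simpa using hva.symm⟩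
      · exact absurd haM (hg.2.2 u a ha hu ha0)
  · exact Or.inr ⟨c, hM.of_append hv (htc ▸ ht), hc, htc⟩

lemma IsUnitary.elim {M : Set (List α)} (hM : IsUnitary M) {g : List α} (hg : g ∈ Prim M) :
    IsUnitary (elim M g) where
  nil_mem := ⟨hM.nil_mem, fun v _ h => hg.2.1 (by simpa using (List.append_eq_nil_iff.1 h.symm).1)⟩
  append_mem := by
    rintro u v hu hv
    refine ⟨hM.append_mem hu.1 hv.1, fun t ht h => ?_⟩
    rcases hM.split_cases hg hv.1 ht h with rfl | ⟨c, hc, huc, -⟩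
    · exact hv.2 t ht (by simpa using h)
    · exact hu.2 c hc huc
  of_append := by
    rintro u v hv huv
    refine ⟨hM.of_append hv.1 huv.1, fun c hc h => huv.2 (c ++ v) (hM.append_mem hc hv.1) ?_⟩
    rw [h, List.append_assoc]

lemma notMem_elim_self {M : Set (List α)} (hM : IsUnitary M) (g : List α) :
    g ∉ LoopsLemma.elim M g :=
  fun h => h.2 [] hM.nil_mem (by simp)

/-- A nonempty word of `elim M g` may be followed by `g`. -/
lemma append_mem_elim {M : Set (List α)} (hM : IsUnitary M) {g : List α} (hg : g ∈ Prim M)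
    {u : List α} (hu : u ∈ elim M g) (hu0 : u ≠ []) : u ++ g ∈ elim M g := by
  refine ⟨hM.append_mem hu.1 hg.1, fun t ht h => ?_⟩
  rcases hM.split_cases hg hg.1 ht h with rfl | ⟨c, hc, huc, -⟩
  · exact hu0 rfl
  · exact hu.2 c hc huc

lemma of_append_mem_elim {M : Set (List α)} (hM : IsUnitary M) {g : List α} (hg : g ∈ Prim M)
    {u : List α} (hu : u ++ g ∈ elim M g) : u ∈ elim M g := by
  refine ⟨hM.of_append hg.1 hu.1, fun c hc h => hu.2 (c ++ g) (hM.append_mem hc hg.1) ?_⟩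
  rw [h, List.append_assoc]

lemma exists_prim_suffix {M : Set (List α)} {w : List α} (hw : w ∈ M) (hw0 : w ≠ []) :
    ∃ u v, w = u ++ v ∧ v ∈ Prim M := by
  by_cases h : w ∈ Prim M
  · exact ⟨[], w, rfl, h⟩
  · have : ∃ u v, w = u ++ v ∧ u ≠ [] ∧ v ≠ [] ∧ v ∈ M := by
      by_contra! hc
      exact h ⟨hw, hw0, fun u v h1 h2 h3 => hc u v h1 h2 h3⟩
    obtain ⟨u, v, rfl, hu, hv, hvM⟩ := this
    have : v.length < (u ++ v).length := by
      have := List.length_pos_iff.2 hu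
      simp; omega
    obtain ⟨u', v', rfl, hv'⟩ := exists_prim_suffix hvM hv
    exact ⟨u ++ u', v', by simp, hv'⟩
termination_by w.length

/-- The generators of `elim M g`: the generators of `M` other than `g`, and the generators of
`elim M g` followed by `g`. -/
lemma prim_elim {M : Set (List α)} (hM : IsUnitary M) {g : List α} (hg : g ∈ Prim M) :
    Prim (elim M g) = (Prim M \ {g}) ∪ (fun u => u ++ g) '' Prim (elim M g) := by
  ext w
  constructor
  · intro hw
    by_cases hwM : w ∈ Prim M
    · refine Or.inl ⟨hwM, ?_⟩
      rintro rfl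
      exact notMem_elim_self hM _ hw.1
    · right
      obtain ⟨u, v, rfl, hv⟩ := exists_prim_suffix hw.1.1 hw.2.1
      have hu : u ≠ [] := by
        rintro rfl
        exact hwM (by simpa using hv)
      have hvE : v ∉ elim M g := hw.2.2 u v rfl hu hv.2.1
      have hvg : v = g := by
        have : ∃ t ∈ M, v = g ++ t := by
          by_contra! hc
          exact hvE ⟨hv.1, hc⟩
        obtain ⟨t, ht, rfl⟩ := this
        by_cases ht0 : t = []
        · simp [ht0]
        · exact absurd ht (hv.2.2 g t rfl hg.2.1 ht0)
      subst hvg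
      have huE : u ∈ elim M v := of_append_mem_elim hM hg hw.1
      refine ⟨u, ⟨huE, hu, fun a b hab ha hb hbE => ?_⟩, rfl⟩
      exact hw.2.2 a (b ++ v) (by simp [hab]) ha (by simp [hb]) (append_mem_elim hM hg hbE hb)
  · rintro (⟨hw, hwg⟩ | ⟨u, hu, rfl⟩)
    · refine ⟨⟨hw.1, fun t ht h => ?_⟩, hw.2.1, fun u v h hu hv hvE => hw.2.2 u v h hu hv hvE.1⟩
      by_cases ht0 : t = []
      · exact hwg (by simpa [ht0] using h)
      · exact hw.2.2 g t h hg.2.1 ht0 ht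
    · refine ⟨append_mem_elim hM hg hu.1 hu.2.1, by simp [hg.2.1], fun a b hab ha hb hbE => ?_⟩
      rcases List.append_eq_append_iff.1 hab with ⟨c, hc, hgb⟩ | ⟨c, hc, hbc⟩
      · by_cases hc0 : c = []
        · subst hc0
          exact notMem_elim_self hM g (by simpa using hgb ▸ hbE)
        · exact hg.2.2 c b hgb hc0 hb hbE.1
      · by_cases hc0 : c = []
        · subst hc0
          exact notMem_elim_self hM g (by simpa [hbc] using hbE)
        · exact hu.2.2 a c hc ha hc0 (of_append_mem_elim hM hg (hbc ▸ hbE))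

/-- The number of generators of length `m`. -/
def numPrim (M : Set (List α)) (m : ℕ) : ℕ := {w | w ∈ Prim M ∧ w.length = m}.ncard

lemma prim_elim_length {M : Set (List α)} (hM : IsUnitary M) {g : List α} (hg : g ∈ Prim M)
    (m : ℕ) : {w | w ∈ Prim (elim M g) ∧ w.length = m} =
      ({w | w ∈ Prim M ∧ w.length = m} \ {g}) ∪
        (if g.length ≤ m then (fun u => u ++ g) '' {w | w ∈ Prim (elim M g) ∧
          w.length = m - g.length} else ∅) := by
  ext w
  have h := Set.ext_iff.1 (prim_elim hM hg) w
  split_ifs with hm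
  · simp only [Set.mem_ofPred_eq, Set.mem_union, Set.mem_sdiff, Set.mem_singleton_iff,
      Set.mem_image] at h ⊢
    constructor
    · rintro ⟨hw, rfl⟩
      rcases h.1 hw with hw | ⟨u, hu, rfl⟩
      · exact Or.inl ⟨⟨hw.1, rfl⟩, hw.2⟩
      · exact Or.inr ⟨u, ⟨hu, by simp⟩, rfl⟩
    · rintro (⟨⟨hw, rfl⟩, hwg⟩ | ⟨u, ⟨hu, hul⟩, rfl⟩)
      · exact ⟨h.2 (Or.inl ⟨hw, hwg⟩), rfl⟩
      · exact ⟨h.2 (Or.inr ⟨u, hu, rfl⟩), by simp; omega⟩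
  · simp only [Set.mem_ofPred_eq, Set.mem_union, Set.mem_sdiff, Set.mem_singleton_iff,
      Set.mem_image, Set.mem_empty_iff_false, or_false] at h ⊢
    constructor
    · rintro ⟨hw, rfl⟩
      rcases h.1 hw with hw | ⟨u, hu, rfl⟩
      · exact ⟨⟨hw.1, rfl⟩, hw.2⟩
      · simp at hm
    · rintro ⟨⟨hw, rfl⟩, hwg⟩
      exact ⟨h.2 (Or.inl ⟨hw, hwg⟩), rfl⟩

lemma finite_prim_elim {M : Set (List α)} (hM : IsUnitary M) {g : List α} (hg : g ∈ Prim M)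
    (hfin : ∀ m, {w | w ∈ Prim M ∧ w.length = m}.Finite) (m : ℕ) :
    {w | w ∈ Prim (elim M g) ∧ w.length = m}.Finite := by
  induction m using Nat.strong_induction_on with
  | _ m ih =>
    rw [prim_elim_length hM hg]
    refine Set.Finite.union ((hfin m).subset Set.sdiff_subset) ?_
    split_ifs with h
    · have := List.length_pos_iff.2 hg.2.1
      exact (ih _ (by omega)).image _
    · exact Set.finite_empty

/-- The counting form of `prim_elim`. -/
lemma numPrim_elim {M : Set (List α)} (hM : IsUnitary M) {g : List α} (hg : g ∈ Prim M)
    (hfin : ∀ m, {w | w ∈ Prim M ∧ w.length = m}.Finite) (m : ℕ) :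
    numPrim (elim M g) m + (if m = g.length then 1 else 0) =
      numPrim M m + (if g.length ≤ m then numPrim (elim M g) (m - g.length) else 0) := by
  have hE := finite_prim_elim hM hg hfin
  have hE' : (if g.length ≤ m then (fun u => u ++ g) '' {w | w ∈ Prim (elim M g) ∧
          w.length = m - g.length} else ∅).Finite := by
    split_ifs with h
    · exact (hE _).image _
    · exact Set.finite_empty
  rw [numPrim, prim_elim_length hM hg,
    Set.ncard_union_eq ?_ ((hfin m).subset Set.sdiff_subset) hE']
  · have h1 : ({w | w ∈ Prim M ∧ w.length = m} \ {g}).ncard + (if m = g.length then 1 else 0)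
        = numPrim M m := by
      split_ifs with h
      · exact Set.ncard_sdiff_singleton_add_one (by exact ⟨hg, h.symm⟩) (hfin m)
      · rw [Set.sdiff_singleton_eq_self, numPrim, add_zero]
        exact fun hgm => h hgm.2.symm
    have h2 : (if g.length ≤ m then (fun u => u ++ g) '' {w | w ∈ Prim (elim M g) ∧
          w.length = m - g.length} else ∅).ncard =
        (if g.length ≤ m then numPrim (elim M g) (m - g.length) else 0) := by
      split_ifs with h
      · rw [Set.ncard_image_of_injective _ (List.append_left_injective g), numPrim]
      · simp
    omega
  · rw [Set.disjoint_left]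
    rintro w ⟨⟨hw, -⟩, -⟩ hw'
    split_ifs at hw' with h
    · obtain ⟨u, ⟨hu, -⟩, rfl⟩ := hw'
      exact hw.2.2 u g rfl hu.2.1 hg.2.1 hg.1
    · exact hw'

/-- The submonoids obtained from `M` by the successive eliminations of `g 0`, `g 1`, … -/
def stage (M : Set (List α)) (g : ℕ → List α) : ℕ → Set (List α)
  | 0 => M
  | k + 1 => elim (stage M g k) (g k)

/-- The words that survive all the eliminations. -/
def stageInf (M : Set (List α)) (g : ℕ → List α) : Set (List α) := ⋂ k, stage M g k

lemma stage_antitone (M : Set (List α)) (g : ℕ → List α) : Antitone (stage M g) :=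
  antitone_nat_of_succ_le fun _ => elim_subset _ _

lemma isUnitary_stage {M : Set (List α)} (hM : IsUnitary M) {g : ℕ → List α}
    (hg : ∀ k, g k ∈ Prim (stage M g k)) (k : ℕ) : IsUnitary (stage M g k) := by
  induction k with
  | zero => exact hM
  | succ k ih => exact ih.elim (hg k)

lemma isUnitary_stageInf {M : Set (List α)} (hM : IsUnitary M) {g : ℕ → List α}
    (hg : ∀ k, g k ∈ Prim (stage M g k)) : IsUnitary (stageInf M g) where
  nil_mem := Set.mem_iInter.2 fun k => (isUnitary_stage hM hg k).nil_mem
  append_mem hu hv := Set.mem_iInter.2 fun k =>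
    (isUnitary_stage hM hg k).append_mem (Set.mem_iInter.1 hu k) (Set.mem_iInter.1 hv k)
  of_append hu hv := Set.mem_iInter.2 fun k =>
    (isUnitary_stage hM hg k).of_append (Set.mem_iInter.1 hu k) (Set.mem_iInter.1 hv k)

/-- Words shorter than the words still to be eliminated are not affected any more. -/
lemma mem_stageInf_iff_of_lt {M : Set (List α)} {g : ℕ → List α} {k : ℕ} {w : List α}
    (h : ∀ j, k ≤ j → w.length < (g j).length) : w ∈ stageInf M g ↔ w ∈ stage M g k := by
  refine ⟨fun hw => Set.mem_iInter.1 hw k, fun hw => Set.mem_iInter.2 fun j => ?_⟩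
  rcases le_total j k with hj | hj
  · exact stage_antitone M g hj hw
  · induction j, hj using Nat.le_induction with
    | base => exact hw
    | succ j hj ih =>
      refine ⟨ih, fun v _ hv => ?_⟩
      have := h j hj
      simp [hv] at this

lemma prim_stageInf_length {M : Set (List α)} {g : ℕ → List α} {k m : ℕ}
    (h : ∀ j, k ≤ j → m < (g j).length) :
    {w | w ∈ Prim (stageInf M g) ∧ w.length = m} = {w | w ∈ Prim (stage M g k) ∧ w.length = m} := by
  have key : ∀ w : List α, w.length ≤ m → (w ∈ stageInf M g ↔ w ∈ stage M g k) :=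
    fun w hw => mem_stageInf_iff_of_lt fun j hj => lt_of_le_of_lt hw (h j hj)
  ext w
  simp only [Set.mem_ofPred_eq, Prim]
  constructor
  · rintro ⟨⟨h1, h2, h3⟩, hl⟩
    refine ⟨⟨(key w hl.le).1 h1, h2, fun u v huv hu hv hv' =>
      h3 u v huv hu hv ((key v ?_).2 hv')⟩, hl⟩
    rw [← hl, huv]; simp
  · rintro ⟨⟨h1, h2, h3⟩, hl⟩
    refine ⟨⟨(key w hl.le).2 h1, h2, fun u v huv hu hv hv' =>
      h3 u v huv hu hv ((key v ?_).1 hv')⟩, hl⟩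
    rw [← hl, huv]; simp

/-- The words `g k₁ ++ ⋯ ++ g kₜ` with `k₁ ≤ ⋯ ≤ kₜ < K`. -/
inductive IsChainWord (g : ℕ → List α) : ℕ → List α → Prop
  | nil : IsChainWord g 0 []
  | mono {k w} : IsChainWord g k w → IsChainWord g (k + 1) w
  | append {k w} : IsChainWord g (k + 1) w → IsChainWord g (k + 1) (w ++ g k)

lemma isChainWord_of_le {g : ℕ → List α} {K k : ℕ} (hk : K ≤ k) {w : List α}
    (hw : IsChainWord g K w) : IsChainWord g k w := by
  induction k, hk using Nat.le_induction with
  | base => exact hw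
  | succ k hk ih => exact ih.mono

end Words

/-! ### Markers in bi-infinite sequences -/

section Markers

variable {α : Type*}

/-- The word of length `n` read in `y` from the coordinate `i` on. -/
def word (y : ℤ → α) (i : ℤ) (n : ℕ) : List α := (List.range n).map fun t => y (i + (t : ℕ))

@[simp] lemma length_word (y : ℤ → α) (i : ℤ) (n : ℕ) : (word y i n).length = n := by simp [word]

lemma getElem_word (y : ℤ → α) (i : ℤ) (n t : ℕ) (h : t < (word y i n).length) :
    (word y i n)[t] = y (i + t) := by simp [word]

lemma word_add (y : ℤ → α) (i : ℤ) (m n : ℕ) :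
    word y i (m + n) = word y i m ++ word y (i + m) n := by
  simp [word, List.range_add, add_assoc, Function.comp_def]

lemma word_eq_iff {y : ℤ → α} {i : ℤ} {w : List α} :
    word y i w.length = w ↔ ∀ t (h : t < w.length), y (i + t) = w[t] := by
  constructor
  · intro h t ht
    rw [← getElem_word y i w.length t (by simpa using ht)]
    simp [h]
  · intro h
    refine List.ext_getElem (by simp) fun t h1 h2 => ?_
    rw [getElem_word, h]

lemma word_congr {y y' : ℤ → α} {i i' : ℤ} {n : ℕ}
    (h : ∀ t < n, y (i + (t : ℕ)) = y' (i' + (t : ℕ))) :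
    word y i n = word y' i' n :=
  List.ext_getElem (by simp) fun t h1 h2 => by
    rw [getElem_word, getElem_word]
    exact h t (by simpa using h1)

/-- If `word y i (m + n)` is `u ++ v` with `|u| = m`, then `u` and `v` are read one after the
other. -/
lemma word_eq_append {y : ℤ → α} {i : ℤ} {n : ℕ} {u v : List α} (h : word y i n = u ++ v) :
    n = u.length + v.length ∧ u = word y i u.length ∧ v = word y (i + u.length) v.length := by
  have hn : n = u.length + v.length := by simpa using congrArg List.length h
  subst hn
  rw [word_add] at h
  have := List.append_inj h (by simp)
  exact ⟨rfl, this.1.symm, this.2.symm⟩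

/-- The markers that remain in `y` after the first eliminations: the stage `k` markers at which
the word up to the next marker is `g k` are deleted in the step from `k` to `k + 1`. -/
def mark (B : Set ℤ) (g : ℕ → List α) (y : ℤ → α) : ℕ → Set ℤ
  | 0 => B
  | k + 1 => {i | i ∈ mark B g y k ∧
      ¬ (word y i (g k).length = g k ∧ i + (g k).length ∈ mark B g y k)}

/-- The markers that are never deleted. -/
def markInf (B : Set ℤ) (g : ℕ → List α) (y : ℤ → α) : Set ℤ := ⋂ k, mark B g y k

lemma mark_antitone (B : Set ℤ) (g : ℕ → List α) (y : ℤ → α) : Antitone (mark B g y) :=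
  antitone_nat_of_succ_le fun _ _ h => h.1

variable {M : Set (List α)} {g : ℕ → List α} {B : Set ℤ} {y : ℤ → α}

/-- Whether a coordinate left of a marker is a marker is decided by the word in between. -/
lemma mem_mark_iff (hM : IsUnitary M) (hg : ∀ k, g k ∈ Prim (stage M g k))
    (hB : ∀ (i : ℤ) (n : ℕ), i + n ∈ B → (i ∈ B ↔ word y i n ∈ M)) (k : ℕ) (i : ℤ) (n : ℕ)
    (h : i + n ∈ mark B g y k) : i ∈ mark B g y k ↔ word y i n ∈ stage M g k := by
  induction k generalizing i n with
  | zero => exact hB i n h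
  | succ k ih =>
    have h0 := h.1
    have hU := isUnitary_stage hM hg k
    constructor
    · rintro ⟨hi, hi'⟩
      refine ⟨(ih i n h0).1 hi, fun v hv hw => hi' ?_⟩
      obtain ⟨hn, h1, h2⟩ := word_eq_append hw
      refine ⟨h1.symm, (ih _ v.length ?_).2 (h2 ▸ hv)⟩
      rw [add_assoc, ← Nat.cast_add, ← hn]
      exact h0
    · rintro ⟨hi, hi'⟩
      refine ⟨(ih i n h0).2 hi, ?_⟩
      rintro ⟨hw, hm⟩
      -- The occurrence of `g k` at `i` either ends before `i + n`, so that the word starts with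
      -- `g k`, or it goes beyond `i + n`; then it would be cut there into words of `stage M g k`.
      rcases le_total (g k).length n with hle | hle
      · obtain ⟨c, rfl⟩ := Nat.exists_eq_add_of_le hle
        refine hi' (word y (i + (g k).length) c) ?_ ?_
        · refine (ih _ c ?_).1 hm
          rwa [add_assoc, ← Nat.cast_add]
        · rw [word_add, hw]
      · obtain ⟨c, hc⟩ := Nat.exists_eq_add_of_le hle
        have hv : word y (i + n) c ∈ stage M g k := by
          refine (ih _ c ?_).1 h0
          rwa [add_assoc, ← Nat.cast_add, ← hc]
        have hsplit : word y i (g k).length = word y i n ++ word y (i + n) c := by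
          rw [hc, word_add]
        rcases Nat.eq_zero_or_pos n with rfl | hn
        · simp only [Nat.cast_zero, add_zero] at h
          exact h.2 ⟨hw, hm⟩
        rcases Nat.eq_zero_or_pos c with rfl | hc0
        · refine hi' [] hU.nil_mem ?_
          rw [List.append_nil, ← hw, hc, add_zero]
        · exact (hg k).2.2 _ _ (hw.symm.trans hsplit)
            (List.length_pos_iff.1 (by simpa)) (List.length_pos_iff.1 (by simpa)) hv

lemma mem_markInf_iff (hM : IsUnitary M) (hg : ∀ k, g k ∈ Prim (stage M g k))
    (hB : ∀ (i : ℤ) (n : ℕ), i + n ∈ B → (i ∈ B ↔ word y i n ∈ M)) (i : ℤ) (n : ℕ)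
    (h : i + n ∈ markInf B g y) : i ∈ markInf B g y ↔ word y i n ∈ stageInf M g := by
  simp only [markInf, stageInf, Set.mem_iInter] at h ⊢
  exact forall_congr' fun k => mem_mark_iff hM hg hB k i n (h k)

/-- If `y` is cut into words of `stageInf M g` along a set `D` unbounded to the right, then no
point of `D` is ever deleted. -/
lemma subset_markInf {D : Set ℤ} (hg : ∀ k, g k ∈ Prim (stage M g k)) (hDB : D ⊆ B)
    (hM : IsUnitary M)
    (hB : ∀ (i : ℤ) (n : ℕ), i + n ∈ B → (i ∈ B ↔ word y i n ∈ M))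
    (hD : ∀ i : ℤ, ∃ n : ℕ, i + n ∈ D)
    (hDw : ∀ (i : ℤ) (n : ℕ), i ∈ D → i + n ∈ D → word y i n ∈ stageInf M g) :
    D ⊆ markInf B g y := by
  intro i hi
  refine Set.mem_iInter.2 fun k => ?_
  induction k generalizing i with
  | zero => exact hDB hi
  | succ k ih =>
    refine ⟨ih hi, ?_⟩
    rintro ⟨hw, hm⟩
    obtain ⟨c, hc⟩ := hD (i + (g k).length)
    have h1 := Set.mem_iInter.1
      (hDw i ((g k).length + c) hi (by rwa [Nat.cast_add, ← add_assoc])) (k + 1)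
    refine h1.2 (word y (i + (g k).length) c) ?_ ?_
    · exact (mem_mark_iff hM hg hB k _ c (ih hc)).1 hm
    · rw [word_add, hw]

/-- A sequence in which all markers get deleted is, to the right of any marker, a concatenation
`g k₁ ++ g k₂ ++ ⋯` with `k₁ ≤ k₂ ≤ ⋯`. -/
lemma exists_chain (hg0 : ∀ k, g k ≠ []) (hy : markInf B g y = ∅) {i : ℤ} (hi : i ∈ B) (t : ℕ) :
    ∃ n K, t ≤ n ∧ IsChainWord g K (word y i n) := by
  -- A marker of the stage `K` is deleted at some later stage `k`, and then `g k` is read from it up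
  -- to the next marker of that stage.
  have hdel : ∀ K j, j ∈ mark B g y K → ∃ k, K ≤ k ∧
      word y j (g k).length = g k ∧ j + (g k).length ∈ mark B g y k := by
    intro K j hj
    by_contra! hc
    have : j ∈ markInf B g y := by
      refine Set.mem_iInter.2 fun k => ?_
      rcases le_total k K with hk | hk
      · exact mark_antitone B g y hk hj
      · induction k, hk using Nat.le_induction with
        | base => exact hj
        | succ k hk ih => exact ⟨ih, fun h => hc k hk h.1 h.2⟩
    simp [hy] at this
  -- For `K = 0` the word is empty, and `K - 1` is `0`, the stage at which all of `B` is present.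
  have hstep : ∃ n K, t ≤ n ∧ i + (n : ℕ) ∈ mark B g y (K - 1) ∧
      IsChainWord g K (word y i n) := by
    induction t with
    | zero => exact ⟨0, 0, le_rfl, by simpa [mark] using hi, IsChainWord.nil⟩
    | succ t ih =>
      obtain ⟨n, K, htn, hm, hc⟩ := ih
      obtain ⟨k, hk, hw, hm'⟩ := hdel _ _ hm
      refine ⟨n + (g k).length, k + 1, ?_, ?_, ?_⟩
      · have := List.length_pos_iff.2 (hg0 k)
        omega
      · simpa [add_assoc] using hm'
      · rw [word_add, hw]
        exact (isChainWord_of_le (by omega) hc).append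
  obtain ⟨n, K, h1, -, h3⟩ := hstep
  exact ⟨n, K, h1, h3⟩

end Markers

/-! ### Walks in loop graphs -/

section Walks

variable {f : ℕ⟦X⟧}

/-- The edges of a bi-infinite walk. -/
def edges (x : LoopShift f) : ℤ → LoopEdge f := x.1

lemma LoopEdge.ext' {a b : LoopEdge f} (h : a.len = b.len)
    (hi : (a.idx : ℕ) = b.idx) (hp : (a.pos : ℕ) = b.pos) : a = b := by
  obtain ⟨n, i, p⟩ := a
  obtain ⟨n', i', p'⟩ := b
  subst h
  obtain rfl : i = i' := Fin.ext hi
  obtain rfl : p = p' := Fin.ext hp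
  rfl

/-- `e'` may follow `e` in a walk. -/
def Step (e e' : LoopEdge f) : Prop := (loopGraph f).tgt e = (loopGraph f).src e'

lemma step_iff {e e' : LoopEdge f} : Step e e' ↔
    (∃ h : (e.pos : ℕ) + 1 < e.len, e' = ⟨e.len, e.idx, ⟨e.pos + 1, h⟩⟩) ∨
      ((e.pos : ℕ) + 1 = e.len ∧ (e'.pos : ℕ) = 0) := by
  have hlt := e.pos.2
  unfold Step loopGraph
  simp only
  by_cases h : (e.pos : ℕ) + 1 < e.len
  · rw [dif_pos h]
    by_cases h' : (e'.pos : ℕ) ≠ 0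
    · rw [dif_pos h', Option.some_inj, Subtype.mk.injEq]
      constructor
      · exact fun he => Or.inl ⟨h, he.symm⟩
      · rintro (⟨_, he⟩ | ⟨he, -⟩)
        · exact he.symm
        · omega
    · rw [dif_neg h']
      simp only [reduceCtorEq, false_iff, not_or, not_exists]
      refine ⟨fun _ he => h' ?_, by omega⟩
      rw [he]; simp
  · rw [dif_neg h]
    by_cases h' : (e'.pos : ℕ) ≠ 0
    · rw [dif_pos h']
      simp only [reduceCtorEq, false_iff, not_or, not_exists]
      exact ⟨fun h2 => absurd h2 h, by omega⟩
    · rw [dif_neg h']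
      simp only [true_iff]
      right
      omega

lemma step_edges (x : LoopShift f) (i : ℤ) : Step (edges x i) (edges x (i + 1)) := x.2 i

/-- The times at which a walk starts a loop. -/
def baseTimes (x : LoopShift f) : Set ℤ := {i | ((edges x i).pos : ℕ) = 0}

lemma eq_of_eq_next {n : ℕ} {i : Fin (coeff n f)} {p : Fin n} {a : LoopEdge f} {q : ℕ}
    {h : (a.pos : ℕ) + 1 < a.len} (ha : (⟨n, i, p⟩ : LoopEdge f) = ⟨a.len, a.idx, ⟨a.pos + 1, h⟩⟩)
    (hp : (p : ℕ) = q + 1) : ∃ hq, a = ⟨n, i, ⟨q, hq⟩⟩ := by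
  obtain ⟨n', i', p'⟩ := a
  injection ha with h1 h2 h3
  subst h1
  obtain rfl := eq_of_heq h2
  have h4 : (p : ℕ) = p' + 1 := by rw [eq_of_heq h3]
  exact ⟨by omega, LoopEdge.ext' rfl rfl (by simp only; omega)⟩

lemma edges_sub_pos (x : LoopShift f) (i : ℤ) (p n : ℕ) (hp : ((edges x i).pos : ℕ) = p + n) :
    ∃ h, edges x (i - n) = ⟨(edges x i).len, (edges x i).idx, ⟨p, h⟩⟩ := by
  induction n generalizing p with
  | zero =>
    refine ⟨by have := (edges x i).pos.2; omega, ?_⟩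
    rw [Nat.cast_zero, sub_zero]
    exact LoopEdge.ext' rfl rfl (by simpa using hp)
  | succ n ih =>
    obtain ⟨h, he⟩ := ih (p + 1) (by omega)
    have hs := step_edges x (i - (n + 1 : ℕ))
    have : i - ((n + 1 : ℕ) : ℤ) + 1 = i - n := by push_cast; ring
    rw [this, he, step_iff] at hs
    rcases hs with ⟨h1, h2⟩ | ⟨-, h2⟩
    · exact eq_of_eq_next h2 rfl
    · simp at h2

/-- The block structure of a walk: from a base time on, a whole loop is read. -/
lemma edges_add (x : LoopShift f) {i : ℤ} (hi : i ∈ baseTimes x) (t : ℕ)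
    (ht : t < (edges x i).len) :
    edges x (i + t) = ⟨(edges x i).len, (edges x i).idx, ⟨t, ht⟩⟩ := by
  induction t with
  | zero =>
    rw [Nat.cast_zero, add_zero]
    exact LoopEdge.ext' rfl rfl hi
  | succ t ih =>
    have hs := step_edges x (i + t)
    rw [ih (by omega), step_iff] at hs
    rcases hs with ⟨h1, h2⟩ | ⟨h2, -⟩
    · rw [Nat.cast_succ, ← add_assoc, h2]
    · simp only at h2
      omega

lemma add_len_mem_baseTimes (x : LoopShift f) {i : ℤ} (hi : i ∈ baseTimes x) :
    i + (edges x i).len ∈ baseTimes x := by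
  have hpos := (edges x i).pos.2
  have hs := step_edges x (i + ((edges x i).len - 1 : ℕ))
  rw [edges_add x hi _ (by omega), step_iff] at hs
  rcases hs with ⟨h1, -⟩ | ⟨-, h2⟩
  · simp only at h1
    omega
  · have : i + (((edges x i).len - 1 : ℕ) : ℤ) + 1 = i + (edges x i).len := by omega
    rwa [this] at h2

lemma add_notMem_baseTimes (x : LoopShift f) {i : ℤ} (hi : i ∈ baseTimes x) {t : ℕ} (ht0 : 0 < t)
    (ht : t < (edges x i).len) : i + t ∉ baseTimes x := by
  intro h
  change ((edges x (i + t)).pos : ℕ) = 0 at h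
  rw [edges_add x hi t ht] at h
  simp only at h
  omega

lemma sub_pos_mem_baseTimes (x : LoopShift f) (i : ℤ) :
    i - (edges x i).pos ∈ baseTimes x ∧
      (edges x (i - (edges x i).pos)).len = (edges x i).len := by
  obtain ⟨h, he⟩ := edges_sub_pos x i 0 (edges x i).pos (by simp)
  rw [baseTimes, Set.mem_ofPred_eq, he]
  simp

lemma exists_baseTimes_ge (x : LoopShift f) (i : ℤ) :
    i + ((edges x i).len - (edges x i).pos : ℕ) ∈ baseTimes x := by
  obtain ⟨h1, h2⟩ := sub_pos_mem_baseTimes x i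
  have h3 := add_len_mem_baseTimes x h1
  rw [h2] at h3
  have := (edges x i).pos.2
  convert h3 using 1
  omega

/-- The closed walks based at the distinguished vertex. -/
def closedWalks (f : ℕ⟦X⟧) : Set (List (LoopEdge f)) :=
  {w | w.IsChain Step ∧ (∀ e ∈ w.head?, (e.pos : ℕ) = 0) ∧
    ∀ e ∈ w.getLast?, (e.pos : ℕ) + 1 = e.len}

lemma step_of_last_of_first {e e' : LoopEdge f} (h : (e.pos : ℕ) + 1 = e.len)
    (h' : (e'.pos : ℕ) = 0) : Step e e' := step_iff.2 (Or.inr ⟨h, h'⟩)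

lemma last_iff_of_step {e e' : LoopEdge f} (h : Step e e') :
    (e.pos : ℕ) + 1 = e.len ↔ (e'.pos : ℕ) = 0 := by
  rcases step_iff.1 h with ⟨h1, rfl⟩ | ⟨h1, h2⟩
  · simp; omega
  · simp [h1, h2]

lemma isUnitary_closedWalks (f : ℕ⟦X⟧) : IsUnitary (closedWalks f) where
  nil_mem := by simp [closedWalks]
  append_mem := by
    rintro u v ⟨hu1, hu2, hu3⟩ ⟨hv1, hv2, hv3⟩
    refine ⟨List.isChain_append.2 ⟨hu1, hv1, fun e he e' he' =>
      step_of_last_of_first (hu3 e he) (hv2 e' he')⟩, ?_, ?_⟩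
    · intro e he
      by_cases hu : u = []
      · subst hu; exact hv2 e (by simpa using he)
      · rw [List.head?_append_of_ne_nil _ hu] at he
        exact hu2 e he
    · intro e he
      by_cases hv : v = []
      · subst hv; exact hu3 e (by simpa using he)
      · rw [List.getLast?_append_of_ne_nil _ hv] at he
        exact hv3 e he
  of_append := by
    rintro u v ⟨hv1, hv2, hv3⟩ ⟨h1, h2, h3⟩
    obtain ⟨hc1, -, hc3⟩ := List.isChain_append.1 h1
    refine ⟨hc1, ?_, ?_⟩
    · intro e he
      have hu : u ≠ [] := by rintro rfl; simp at he
      exact h2 e (by rwa [List.head?_append_of_ne_nil _ hu])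
    · intro e he
      by_cases hv : v = []
      · subst hv; exact h3 e (by simpa using he)
      · exact (last_iff_of_step (hc3 e he (v.head hv) (List.head?_eq_some_head hv))).2
          (hv2 _ (List.head?_eq_some_head hv))

/-- The loop number `i` of length `n`. -/
def loopPath (f : ℕ⟦X⟧) (n : ℕ) (i : Fin (coeff n f)) : List (LoopEdge f) :=
  List.ofFn fun p : Fin n => ⟨n, i, p⟩

@[simp] lemma length_loopPath (n : ℕ) (i : Fin (coeff n f)) : (loopPath f n i).length = n := by
  simp [loopPath]

lemma getElem_loopPath (n : ℕ) (i : Fin (coeff n f)) (p : ℕ) (hp : p < (loopPath f n i).length) :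
    (loopPath f n i)[p] = ⟨n, i, ⟨p, by simpa using hp⟩⟩ := by
  simp [loopPath]

lemma pos_of_idx (hf : constantCoeff f = 0) {n : ℕ} (i : Fin (coeff n f)) : 0 < n := by
  by_contra h
  obtain rfl : n = 0 := by omega
  have := i.isLt
  have h0 : coeff 0 f = 0 := by rw [coeff_zero_eq_constantCoeff_apply, hf]
  omega

lemma loopPath_mem_prim (hf : constantCoeff f = 0) (n : ℕ) (i : Fin (coeff n f)) :
    loopPath f n i ∈ Prim (closedWalks f) := by
  have hn := pos_of_idx hf i
  refine ⟨⟨?_, ?_, ?_⟩, ?_, ?_⟩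
  · rw [List.isChain_iff_getElem]
    intro t ht
    rw [getElem_loopPath, getElem_loopPath, step_iff]
    exact Or.inl ⟨by simpa using ht, rfl⟩
  · intro e he
    rw [List.head?_eq_getElem?, List.getElem?_eq_getElem (by simpa), Option.mem_some_iff,
      getElem_loopPath] at he
    rw [← he]
  · intro e he
    rw [List.getLast?_eq_getElem?, List.getElem?_eq_getElem (by simp; omega), Option.mem_some_iff,
      getElem_loopPath] at he
    rw [← he]
    simp; omega
  · rw [← List.length_pos_iff]; simpa
  · rintro u v huv hu hv ⟨-, hv2, -⟩
    have h1 := hv2 _ (List.head?_eq_some_head hv)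
    have hlen : u.length < (loopPath f n i).length := by
      rw [huv, List.length_append]
      have := List.length_pos_iff.2 hv
      omega
    have h2 : v.head hv = (loopPath f n i)[u.length] := by
      simp [huv, List.head_eq_getElem]
    rw [h2, getElem_loopPath] at h1
    exact hu (List.length_eq_zero_iff.1 h1)

/-- The free generators of the monoid of closed walks are the loops. -/
lemma mem_prim_closedWalks {w : List (LoopEdge f)} (hw : w ∈ Prim (closedWalks f)) :
    ∃ n i, w = loopPath f n i := by
  obtain ⟨⟨h1, h2, h3⟩, h4, h5⟩ := hw
  have hlen : 0 < w.length := List.length_pos_iff.2 h4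
  set e := w[0] with he
  have he0 : (e.pos : ℕ) = 0 := h2 e (by rw [List.head?_eq_getElem?]; simp [he, hlen])
  rw [List.isChain_iff_getElem] at h1
  have key : ∀ t (ht : t < w.length) (ht' : t < e.len), w[t] = ⟨e.len, e.idx, ⟨t, ht'⟩⟩ := by
    intro t ht ht'
    induction t with
    | zero => exact LoopEdge.ext' rfl rfl he0
    | succ t ih =>
      have hs := h1 t ht
      rw [ih (by omega) (by omega), step_iff] at hs
      rcases hs with ⟨h6, h7⟩ | ⟨h6, -⟩
      · exact h7
      · simp only at h6
        omega
  -- The word cannot end inside of its first loop, and if it were longer than this loop, what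
  -- follows would be a proper suffix in the submonoid.
  have hle : e.len ≤ w.length := by
    by_contra! hc
    have h6 := h3 w[w.length - 1] (by
      rw [List.getLast?_eq_getElem?, List.getElem?_eq_getElem (by omega)]; rfl)
    rw [key _ _ (by omega)] at h6
    simp only at h6
    omega
  have hpos := e.pos.2
  have heq : w.length = e.len := by
    by_contra hne
    have hlt : e.len < w.length := by omega
    refine h5 (w.take e.len) (w.drop e.len) (by simp) ?_ ?_ ⟨?_, ?_, ?_⟩
    · rw [← List.length_pos_iff]; simp; omega
    · rw [← List.length_pos_iff]; simp; omega
    · rw [List.isChain_iff_getElem]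
      intro t ht
      simp only [List.length_drop, List.getElem_drop] at ht ⊢
      exact h1 (e.len + t) (by omega)
    · intro a ha
      rw [List.head?_eq_getElem?, List.getElem?_eq_getElem (by simp; omega), Option.mem_some_iff,
        List.getElem_drop] at ha
      rw [← ha]
      have hs := h1 (e.len - 1) (by omega)
      rw [key _ _ (by omega)] at hs
      have := (last_iff_of_step hs).1 (by simp; omega)
      have h7 : ∀ (a b : ℕ) (ha : a < w.length) (hb : b < w.length), a = b → w[a] = w[b] := by
        intro a b ha hb hab
        subst hab
        rfl
      rwa [h7 _ (e.len + 0) (by omega) (by omega) (by omega)] at this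
    · intro a ha
      rw [List.getLast?_drop, if_neg (by omega)] at ha
      exact h3 a ha
  refine ⟨e.len, e.idx, List.ext_getElem (by simpa) fun t ht ht' => ?_⟩
  rw [key t ht (by omega), getElem_loopPath]

lemma prim_closedWalks_length (hf : constantCoeff f = 0) (m : ℕ) :
    {w | w ∈ Prim (closedWalks f) ∧ w.length = m} = Set.range (loopPath f m) := by
  ext w
  constructor
  · rintro ⟨hw, hl⟩
    obtain ⟨n, i, rfl⟩ := mem_prim_closedWalks hw
    rw [length_loopPath] at hl
    subst hl
    exact ⟨i, rfl⟩
  · rintro ⟨i, rfl⟩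
    exact ⟨loopPath_mem_prim hf m i, length_loopPath m i⟩

lemma loopPath_injective (hf : constantCoeff f = 0) (m : ℕ) :
    Function.Injective (loopPath f m) := by
  intro i j h
  have hm := pos_of_idx hf i
  have h1 : (loopPath f m i)[0]'(by simpa) = (loopPath f m j)[0]'(by simpa) := by simp [h]
  rw [getElem_loopPath, getElem_loopPath] at h1
  simpa using h1

lemma numPrim_closedWalks (hf : constantCoeff f = 0) (m : ℕ) :
    numPrim (closedWalks f) m = coeff m f := by
  rw [numPrim, prim_closedWalks_length hf, ← Set.image_univ,
    Set.ncard_image_of_injective _ (loopPath_injective hf m), Set.ncard_univ, Nat.card_fin]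

lemma finite_prim_closedWalks (hf : constantCoeff f = 0) (m : ℕ) :
    {w | w ∈ Prim (closedWalks f) ∧ w.length = m}.Finite := by
  rw [prim_closedWalks_length hf]
  exact Set.finite_range _

/-- The generators at the stage `k` are counted by the series `f^{<k>}`. -/
lemma numPrim_stage (hf : constantCoeff f = 0) {r : ℕ → ℕ} (hr0 : ∀ k, 0 < r k)
    {g : ℕ → List (LoopEdge f)} {K : ℕ}
    (hg : ∀ k < K, g k ∈ Prim (stage (closedWalks f) g k)) (hgr : ∀ k < K, (g k).length = r k) :
    IsUnitary (stage (closedWalks f) g K) ∧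
    (∀ m, {w | w ∈ Prim (stage (closedWalks f) g K) ∧ w.length = m}.Finite) ∧
    ∀ m, ((numPrim (stage (closedWalks f) g K) m : ℕ) : ℤ) = coeff m (deleted f r K) := by
  induction K with
  | zero =>
    refine ⟨isUnitary_closedWalks f, finite_prim_closedWalks hf, fun m => ?_⟩
    rw [stage, numPrim_closedWalks hf, deleted, coeff_toInt]
  | succ k ih =>
    obtain ⟨hU, hfin, hnum⟩ := ih (fun j hj => hg j (by omega)) (fun j hj => hgr j (by omega))
    have hgk := hg k (by omega)
    refine ⟨hU.elim hgk, finite_prim_elim hU hgk hfin, fun m => ?_⟩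
    induction m using Nat.strong_induction_on with
    | _ m ihm =>
      have h1 := numPrim_elim hU hgk hfin m
      rw [hgr k (by omega)] at h1
      rw [coeff_deleted_succ hr0, ← hnum m]
      have h2 : (if r k ≤ m then coeff (m - r k) (deleted f r (k + 1)) else 0) =
          (((if r k ≤ m then numPrim (elim (stage (closedWalks f) g k) (g k)) (m - r k) else 0) :
            ℕ) : ℤ) := by
        have := hr0 k
        split_ifs with h
        · exact (ihm _ (by omega)).symm
        · rfl
      rw [h2]
      change ((numPrim (elim (stage (closedWalks f) g k) (g k)) m : ℕ) : ℤ) = _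
      split_ifs at h1 ⊢ <;> push_cast <;> omega

lemma mem_baseTimes_iff (y : LoopShift f) (i : ℤ) (n : ℕ) (h : i + n ∈ baseTimes y) :
    i ∈ baseTimes y ↔ word (edges y) i n ∈ closedWalks f := by
  rcases Nat.eq_zero_or_pos n with rfl | hn
  · simp only [Nat.cast_zero, add_zero] at h
    exact ⟨fun _ => (isUnitary_closedWalks f).nil_mem, fun _ => h⟩
  · constructor
    · intro hi
      refine ⟨?_, ?_, ?_⟩
      · rw [List.isChain_iff_getElem]
        intro t ht
        rw [getElem_word, getElem_word, Nat.cast_succ, ← add_assoc]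
        exact step_edges y _
      · intro e he
        rw [List.head?_eq_getElem?, List.getElem?_eq_getElem (by simpa), Option.mem_some_iff,
          getElem_word] at he
        rw [← he, Nat.cast_zero, add_zero]
        exact hi
      · intro e he
        rw [List.getLast?_eq_getElem?, List.getElem?_eq_getElem (by simp; omega),
          Option.mem_some_iff, getElem_word] at he
        rw [← he, length_word]
        refine (last_iff_of_step (step_edges y _)).2 ?_
        have : i + ((n - 1 : ℕ) : ℤ) + 1 = i + n := by omega
        rw [this]
        exact h
    · rintro ⟨-, h2, -⟩
      refine h2 _ ?_
      rw [List.head?_eq_getElem?, List.getElem?_eq_getElem (by simpa), getElem_word]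
      simp

end Walks

/-! ### One-block codes between loop shifts -/

section Code

variable {f F : ℕ⟦X⟧} {M : Set (List (LoopEdge f))}
  (e : ∀ m, Fin (coeff m F) ≃ {w // w ∈ Prim M ∧ w.length = m})

/-- The generator of `M` which is assigned to the loop of the edge `a`. -/
def codeWord (a : LoopEdge F) : List (LoopEdge f) := (e a.len a.idx).1

lemma codeWord_mem (a : LoopEdge F) : codeWord e a ∈ Prim M := (e a.len a.idx).2.1

lemma length_codeWord (a : LoopEdge F) : (codeWord e a).length = a.len := (e a.len a.idx).2.2

/-- The block map: a loop of length `m` is mapped to the corresponding generator of length `m`. -/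
def code (a : LoopEdge F) : LoopEdge f :=
  (codeWord e a)[(a.pos : ℕ)]'(by rw [length_codeWord]; exact a.pos.2)

lemma eq_of_codeWord_eq {a b : LoopEdge F} (h : codeWord e a = codeWord e b)
    (hp : (a.pos : ℕ) = b.pos) : a = b := by
  have hl : a.len = b.len := by rw [← length_codeWord e a, h, length_codeWord]
  obtain ⟨n, i, p⟩ := a
  obtain ⟨n', i', p'⟩ := b
  simp only at hl
  subst hl
  obtain rfl : i = i' := (e n).injective (Subtype.ext h)
  exact LoopEdge.ext' rfl rfl hp

/-- The edge number `p` of the loop assigned to the generator `w`. -/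
def mkEdge (w : List (LoopEdge f)) (hw : w ∈ Prim M) (p : ℕ) (hp : p < w.length) : LoopEdge F :=
  ⟨w.length, (e w.length).symm ⟨w, hw, rfl⟩, ⟨p, hp⟩⟩

lemma codeWord_mkEdge (w : List (LoopEdge f)) (hw : w ∈ Prim M) (p : ℕ) (hp : p < w.length) :
    codeWord e (mkEdge e w hw p hp) = w :=
  congrArg Subtype.val ((e w.length).apply_symm_apply ⟨w, hw, rfl⟩)

lemma code_mkEdge (w : List (LoopEdge f)) (hw : w ∈ Prim M) (p : ℕ) (hp : p < w.length) :
    code e (mkEdge e w hw p hp) = w[p] := by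
  exact List.getElem_of_eq (codeWord_mkEdge e w hw p hp) _

lemma pos_code_eq_zero (hM : M ⊆ closedWalks f) {a : LoopEdge F} (h : (a.pos : ℕ) = 0) :
    ((code e a).pos : ℕ) = 0 := by
  refine (hM (codeWord_mem e a).1).2.1 _ ?_
  rw [List.head?_eq_getElem?, Option.mem_def, code]
  simp only [h]
  exact List.getElem?_eq_getElem _

lemma step_code (hM : M ⊆ closedWalks f) {a b : LoopEdge F} (h : Step a b) :
    Step (code e a) (code e b) := by
  obtain ⟨ha1, ha2, ha3⟩ := hM (codeWord_mem e a).1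
  have hla := length_codeWord e a
  rcases step_iff.1 h with ⟨h1, rfl⟩ | ⟨h1, h2⟩
  · exact (List.isChain_iff_getElem.1 ha1) a.pos (by omega)
  · refine step_of_last_of_first (ha3 _ ?_) (pos_code_eq_zero e hM h2)
    rw [List.getLast?_eq_getElem?, Option.mem_def, code]
    simp only [hla, ← h1, Nat.add_sub_cancel]
    exact List.getElem?_eq_getElem _

/-- The one-block code given by `code`. -/
def codeMap (hM : M ⊆ closedWalks f) (x : LoopShift F) : LoopShift f :=
  ⟨fun i => code e (edges x i), fun i => step_code e hM (step_edges x i)⟩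

lemma isOneBlockCode_codeMap (hM : M ⊆ closedWalks f) : IsOneBlockCode (codeMap e hM) :=
  ⟨code e, fun _ _ => rfl⟩

lemma edges_codeMap (hM : M ⊆ closedWalks f) (x : LoopShift F) (i : ℤ) :
    edges (codeMap e hM x) i = code e (edges x i) := rfl

lemma codeWord_edges_add (x : LoopShift F) {i : ℤ} (hi : i ∈ baseTimes x) (t : ℕ)
    (ht : t < (edges x i).len) : codeWord e (edges x (i + t)) = codeWord e (edges x i) := by
  rw [edges_add x hi t ht]
  rfl

/-- At a base time of `x`, the image of `x` reads the generator assigned to the loop of `x`. -/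
lemma word_codeMap (hM : M ⊆ closedWalks f) (x : LoopShift F) {i : ℤ} (hi : i ∈ baseTimes x) :
    word (edges (codeMap e hM x)) i (edges x i).len = codeWord e (edges x i) := by
  refine List.ext_getElem (by simp [length_codeWord]) fun t h1 h2 => ?_
  rw [length_word] at h1
  rw [getElem_word, edges_codeMap, edges_add x hi t h1]
  rfl

lemma len_le_of_baseTimes {x : LoopShift F} {a : ℤ} (ha : a ∈ baseTimes x) {n : ℕ}
    (hn : 0 < n) (h : a + n ∈ baseTimes x) : (edges x a).len ≤ n := by
  by_contra! hc
  exact add_notMem_baseTimes x ha hn hc h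

lemma len_pos (a : LoopEdge F) : 0 < a.len := by
  have := a.pos.2
  omega

/-- Between two base times of `x`, the image of `x` reads a word of `M`. -/
lemma word_codeMap_mem (hU : IsUnitary M) (hM : M ⊆ closedWalks f) (x : LoopShift F) (n : ℕ)
    {a : ℤ} (ha : a ∈ baseTimes x) (h : a + n ∈ baseTimes x) :
    word (edges (codeMap e hM x)) a n ∈ M := by
  induction n using Nat.strong_induction_on generalizing a with
  | _ n ih =>
    rcases Nat.eq_zero_or_pos n with rfl | hn
    · exact hU.nil_mem
    · obtain ⟨c, hc⟩ := Nat.exists_eq_add_of_le (len_le_of_baseTimes ha hn h)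
      have hpos := len_pos (edges x a)
      rw [hc, word_add, word_codeMap e hM x ha]
      refine hU.append_mem (codeWord_mem e _).1 (ih c (by omega) (add_len_mem_baseTimes x ha) ?_)
      rwa [add_assoc, ← Nat.cast_add, ← hc]

/-- A walk is determined between two of its base times by its image. -/
lemma eq_of_codeMap_eq (hU : IsUnitary M) (hM : M ⊆ closedWalks f) (x x' : LoopShift F) (n : ℕ)
    {a : ℤ} (ha : a ∈ baseTimes x) (h : a + n ∈ baseTimes x) (ha' : a ∈ baseTimes x')
    (h' : a + n ∈ baseTimes x')
    (hw : word (edges (codeMap e hM x)) a n = word (edges (codeMap e hM x')) a n)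
    (m : ℕ) (hm : m < n) : edges x (a + m) = edges x' (a + m) := by
  induction n using Nat.strong_induction_on generalizing a m with
  | _ n ih =>
    have hn : 0 < n := by omega
    have hpos := len_pos (edges x a)
    obtain ⟨c, hc⟩ := Nat.exists_eq_add_of_le (len_le_of_baseTimes ha hn h)
    obtain ⟨c', hc'⟩ := Nat.exists_eq_add_of_le (len_le_of_baseTimes ha' hn h')
    have h1 : a + (edges x a).len + c ∈ baseTimes x := by rwa [add_assoc, ← Nat.cast_add, ← hc]
    have h1' : a + (edges x' a).len + c' ∈ baseTimes x' := by
      rwa [add_assoc, ← Nat.cast_add, ← hc']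
    have hv := word_codeMap_mem e hU hM x c (add_len_mem_baseTimes x ha) h1
    have hv' := word_codeMap_mem e hU hM x' c' (add_len_mem_baseTimes x' ha') h1'
    have hs := hw
    nth_rewrite 1 [hc] at hs
    rw [hc', word_add, word_add, word_codeMap e hM x ha, word_codeMap e hM x' ha'] at hs
    have hcw : codeWord e (edges x a) = codeWord e (edges x' a) := by
      rcases hU.split_cases (codeWord_mem e _) hv hv' hs with h2 | ⟨d, hd, h2, -⟩
      · exact absurd h2 (codeWord_mem e _).2.1
      · by_cases hd0 : d = []
        · simpa [hd0] using h2
        · exact absurd hd ((codeWord_mem e (edges x a)).2.2 _ d h2 (codeWord_mem e _).2.1 hd0)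
    have hlen : (edges x a).len = (edges x' a).len := by
      rw [← length_codeWord e, hcw, length_codeWord]
    rcases lt_or_ge m (edges x a).len with hlt | hge
    · refine eq_of_codeWord_eq e ?_ ?_
      · rw [codeWord_edges_add e x ha m hlt, codeWord_edges_add e x' ha' m (by omega), hcw]
      · rw [edges_add x ha m hlt, edges_add x' ha' m (by omega)]
    · obtain ⟨d, rfl⟩ := Nat.exists_eq_add_of_le hge
      have hcc : c' = c := by omega
      have := ih c (by omega) (add_len_mem_baseTimes x ha) h1
        (hlen ▸ add_len_mem_baseTimes x' ha') (by rwa [hcc, ← hlen] at h1') ?_ d (by omega)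
      · simpa [add_assoc] using this
      · have := (List.append_inj hs (by rw [hcw])).2
        rwa [hcc, ← hlen] at this

end Code

section Limit

variable {f F : ℕ⟦X⟧} {g : ℕ → List (LoopEdge f)}
  (e : ∀ m, Fin (coeff m F) ≃ {w // w ∈ Prim (stageInf (closedWalks f) g) ∧ w.length = m})

lemma stageInf_subset (M : Set (List (LoopEdge f))) (g : ℕ → List (LoopEdge f)) :
    stageInf M g ⊆ M := Set.iInter_subset (stage M g) 0

/-- The markers of `y` that are never deleted. -/
def markers (g : ℕ → List (LoopEdge f)) (y : LoopShift f) : Set ℤ :=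
  markInf (baseTimes y) g (edges y)

/-- The injective one-block code of the Loops Lemma. -/
def loopCode : LoopShift F → LoopShift f := codeMap e (stageInf_subset _ _)

lemma mem_markers_iff (hg : ∀ k, g k ∈ Prim (stage (closedWalks f) g k)) (y : LoopShift f)
    (i : ℤ) (n : ℕ) (h : i + n ∈ markers g y) :
    i ∈ markers g y ↔ word (edges y) i n ∈ stageInf (closedWalks f) g :=
  mem_markInf_iff (isUnitary_closedWalks f) hg (mem_baseTimes_iff y) i n h

/-- The markers that are never deleted in the image of `x` are the base times of `x`. -/
lemma markers_loopCode (hg : ∀ k, g k ∈ Prim (stage (closedWalks f) g k)) (x : LoopShift F) :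
    markers g (loopCode e x) = baseTimes x := by
  have hU := isUnitary_stageInf (isUnitary_closedWalks f) hg
  have hsub : baseTimes x ⊆ markers g (loopCode e x) := by
    refine subset_markInf hg ?_ (isUnitary_closedWalks f) (mem_baseTimes_iff _)
      (fun i => ⟨_, exists_baseTimes_ge x i⟩)
      (fun i n hi hn => word_codeMap_mem e hU (stageInf_subset _ _) x n hi hn)
    intro i hi
    exact pos_code_eq_zero e (stageInf_subset _ _) hi
  refine Set.Subset.antisymm (fun i hi => ?_) hsub
  obtain ⟨h1, h2⟩ := sub_pos_mem_baseTimes x i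
  set a := i - (edges x i).pos with ha
  set p : ℕ := ((edges x i).pos : ℕ) with hp
  have hlt : p < (edges x i).len := (edges x i).pos.2
  have h3 := word_codeMap e (stageInf_subset _ _) x h1
  rw [h2] at h3
  obtain ⟨c, hc⟩ := Nat.exists_eq_add_of_lt hlt
  rw [hc, add_assoc, word_add] at h3
  by_contra hne
  have hp0 : p ≠ 0 := hne
  refine (codeWord_mem e (edges x a)).2.2 _ _ h3.symm ?_ ?_ ?_
  · rw [← List.length_pos_iff, length_word]; omega
  · rw [← List.length_pos_iff, length_word]; omega
  · have hap : a + (p : ℤ) = i := by omega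
    rw [hap]
    refine (mem_markers_iff hg (loopCode e x) i (c + 1) ?_).1 hi
    have := hsub (add_len_mem_baseTimes x h1)
    rw [h2, hc] at this
    convert this using 1
    push_cast; omega

lemma loopCode_injective (hg : ∀ k, g k ∈ Prim (stage (closedWalks f) g k)) :
    Function.Injective (loopCode e) := by
  intro x x' h
  have hU := isUnitary_stageInf (isUnitary_closedWalks f) hg
  have hb : baseTimes x = baseTimes x' := by
    rw [← markers_loopCode e hg, h, markers_loopCode e hg]
  refine Subtype.ext (funext fun i => ?_)
  obtain ⟨h1, h2⟩ := sub_pos_mem_baseTimes x i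
  have h3 := add_len_mem_baseTimes x h1
  have := eq_of_codeMap_eq e hU (stageInf_subset _ _) x x' _ h1 h3 (hb ▸ h1) (hb ▸ h3)
    (by change word (edges (loopCode e x)) _ _ = word (edges (loopCode e x')) _ _; rw [h])
    (edges x i).pos (by rw [h2]; exact (edges x i).pos.2)
  change edges x i = edges x' i
  simpa using this

/-- A walk with undeleted markers arbitrarily far to the left and to the right is in the image of
the code. -/
lemma mem_range_loopCode (hg : ∀ k, g k ∈ Prim (stage (closedWalks f) g k)) (y : LoopShift f)
    (hr : ∀ i, ∃ j ∈ markers g y, i < j) (hl : ∀ i, ∃ j ∈ markers g y, j ≤ i) :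
    y ∈ Set.range (loopCode e) := by
  have hU := isUnitary_stageInf (isUnitary_closedWalks f) hg
  have hA : ∀ i : ℤ, ∃ a, (a ∈ markers g y ∧ a ≤ i) ∧ ∀ z, z ∈ markers g y ∧ z ≤ i → z ≤ a :=
    fun i => Int.exists_greatest_of_bdd ⟨i, fun z hz => hz.2⟩ (hl i)
  have hB : ∀ i : ℤ, ∃ b, (b ∈ markers g y ∧ i < b) ∧ ∀ z, z ∈ markers g y ∧ i < z → b ≤ z :=
    fun i => Int.exists_least_of_bdd ⟨i, fun z hz => hz.2.le⟩ (hr i)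
  -- `A i` is the last marker up to `i`, and `B i` the first marker after `i`.
  choose A hA1 hA2 using hA
  choose B hB1 hB2 using hB
  set n : ℤ → ℕ := fun i => (B i - A i).toNat with hn
  have hAn : ∀ i, A i + (n i : ℕ) = B i := fun i => by
    have := (hA1 i).2; have := (hB1 i).2
    simp only [hn]; omega
  -- A proper suffix in the submonoid would give a marker strictly between `A i` and `B i`.
  have hprim : ∀ i, word (edges y) (A i) (n i) ∈ Prim (stageInf (closedWalks f) g) := by
    intro i
    have h1 := (hA1 i).2
    have h2 := (hB1 i).2
    have h3 := hAn i
    refine ⟨(mem_markers_iff hg y (A i) (n i) (h3 ▸ (hB1 i).1)).1 (hA1 i).1, ?_, ?_⟩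
    · rw [← List.length_pos_iff, length_word]; omega
    · intro u v huv hu hv hvM
      obtain ⟨h4, h5, h6⟩ := word_eq_append huv
      have hu' := List.length_pos_iff.2 hu
      have hv' := List.length_pos_iff.2 hv
      have h7 : A i + u.length + v.length = B i := by rw [← h3, h4]; push_cast; ring
      have h8 : A i + u.length ∈ markers g y :=
        (mem_markers_iff hg y _ v.length (h7 ▸ (hB1 i).1)).2 (h6 ▸ hvM)
      rcases le_or_gt (A i + u.length) i with h9 | h9
      · have := hA2 i _ ⟨h8, h9⟩
        omega
      · have := hB2 i _ ⟨h8, h9⟩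
        omega
  have hpos : ∀ i, (i - A i).toNat < (word (edges y) (A i) (n i)).length := by
    intro i
    have h1 := (hA1 i).2
    have h2 := (hB1 i).2
    have h3 := hAn i
    rw [length_word]
    omega
  obtain ⟨z, hz⟩ : ∃ z : ℤ → LoopEdge F, ∀ i, codeWord e (z i) = word (edges y) (A i) (n i) ∧
      (z i).len = n i ∧ ((z i).pos : ℕ) = (i - A i).toNat ∧ code e (z i) = edges y i := by
    refine ⟨fun i => mkEdge e _ (hprim i) (i - A i).toNat (hpos i), fun i =>
      ⟨codeWord_mkEdge e _ _ _ _, length_word _ _ _, rfl, ?_⟩⟩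
    have h1 := (hA1 i).2
    rw [code_mkEdge, getElem_word]
    congr 1
    omega
  have hstep : ∀ i, Step (z i) (z (i + 1)) := by
    intro i
    rw [step_iff]
    have h1 := (hA1 i).2
    have h2 := (hB1 i).2
    have h3 := hAn i
    rcases lt_or_ge (i + 1) (B i) with h4 | h4
    · left
      have hA' : A (i + 1) = A i := by
        refine le_antisymm (hA2 i _ ⟨(hA1 _).1, ?_⟩) (hA2 _ _ ⟨(hA1 i).1, by omega⟩)
        by_contra! hc
        have := hB2 i _ ⟨(hA1 (i + 1)).1, hc⟩
        have := (hA1 (i + 1)).2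
        omega
      have hB' : B (i + 1) = B i :=
        le_antisymm (hB2 _ _ ⟨(hB1 i).1, h4⟩) (hB2 i _ ⟨(hB1 _).1, by have := (hB1 (i+1)).2; omega⟩)
      have hn' : n (i + 1) = n i := by simp only [hn, hA', hB']
      obtain ⟨h5, h6, h7, -⟩ := hz i
      obtain ⟨h5', h6', h7', -⟩ := hz (i + 1)
      refine ⟨by omega, eq_of_codeWord_eq e ?_ ?_⟩
      · rw [h5', hA', hn', ← h5]
        rfl
      · rw [h7', hA']
        simp only
        omega
    · right
      have hA' : A (i + 1) = i + 1 := by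
        refine le_antisymm (hA1 _).2 (hA2 _ _ ⟨?_, le_rfl⟩)
        have : i + 1 = B i := by omega
        exact this ▸ (hB1 i).1
      obtain ⟨-, h6, h7, -⟩ := hz i
      obtain ⟨-, -, h7', -⟩ := hz (i + 1)
      rw [hA'] at h7'
      omega
  exact ⟨⟨z, hstep⟩, Subtype.ext (funext fun i => (hz i).2.2.2)⟩

end Limit

/-! ### The choice of the deleted loops, and magic words -/

section Choice

variable {f : ℕ⟦X⟧} {r : ℕ → ℕ}

open Classical in
/-- A generator of `M` of length `n`, if there is one. -/
def pick {α : Type*} (M : Set (List α)) (n : ℕ) : List α :=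
  if h : ∃ w ∈ Prim M, w.length = n then h.choose else []

/-- The submonoids obtained by successive eliminations of generators of the lengths `r k`. -/
def pickStage {α : Type*} (M : Set (List α)) (r : ℕ → ℕ) : ℕ → Set (List α)
  | 0 => M
  | k + 1 => elim (pickStage M r k) (pick (pickStage M r k) (r k))

lemma stage_pick {α : Type*} (M : Set (List α)) (r : ℕ → ℕ) (k : ℕ) :
    stage M (fun k => pick (pickStage M r k) (r k)) k = pickStage M r k := by
  induction k with
  | zero => rfl
  | succ k ih => rw [stage, ih, pickStage]

lemma exists_elims (hf : constantCoeff f = 0) (hr0 : ∀ k, 0 < r k)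
    (hposit : ∀ k, 1 ≤ coeff (r k) (deleted f r k)) :
    ∃ g : ℕ → List (LoopEdge f), ∀ k, g k ∈ Prim (stage (closedWalks f) g k) ∧
      (g k).length = r k := by
  refine ⟨fun k => pick (pickStage (closedWalks f) r k) (r k), fun k => ?_⟩
  induction k using Nat.strong_induction_on with
  | _ k ih =>
    obtain ⟨-, hfin, hnum⟩ := numPrim_stage hf hr0 (fun j hj => (ih j hj).1)
      (fun j hj => (ih j hj).2)
    have h1 := hposit k
    rw [← hnum, numPrim] at h1
    have h2 : ∃ w ∈ Prim (pickStage (closedWalks f) r k), w.length = r k := by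
      rw [← stage_pick]
      exact Set.nonempty_of_ncard_ne_zero (s := {w | w ∈ Prim (stage (closedWalks f)
        (fun k => pick (pickStage (closedWalks f) r k) (r k)) k) ∧ w.length = r k}) (by omega)
    rw [stage_pick]
    simp only [pick, dif_pos h2]
    exact h2.choose_spec

/-- The series `F` counts the generators of the limit submonoid. -/
lemma exists_equiv (hf : constantCoeff f = 0) (hr0 : ∀ k, 0 < r k) (hr : Monotone r)
    (hlim : Tendsto r atTop atTop) {F : ℕ⟦X⟧}
    (hF : ∀ n k, n < r k → coeff n (deleted f r k) = ((coeff n F : ℕ) : ℤ))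
    {g : ℕ → List (LoopEdge f)} (hg : ∀ k, g k ∈ Prim (stage (closedWalks f) g k))
    (hgr : ∀ k, (g k).length = r k) (m : ℕ) :
    Nonempty (Fin (coeff m F) ≃
      {w // w ∈ Prim (stageInf (closedWalks f) g) ∧ w.length = m}) := by
  obtain ⟨k, hk⟩ := (hlim.eventually_gt_atTop m).exists
  obtain ⟨-, hfin, hnum⟩ := numPrim_stage (K := k) hf hr0 (fun j _ => hg j) (fun j _ => hgr j)
  have h1 := hnum m
  rw [hF m k hk, numPrim, ← prim_stageInf_length (fun j hj => by
    rw [hgr]; exact hk.trans_le (hr hj))] at h1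
  have hf' := hfin m
  rw [← prim_stageInf_length (fun j hj => by rw [hgr]; exact hk.trans_le (hr hj))] at hf'
  have : Finite {w // w ∈ Prim (stageInf (closedWalks f) g) ∧ w.length = m} := hf'
  refine ⟨(Finite.equivFinOfCardEq ?_).symm⟩
  exact_mod_cast h1

lemma mem_prim_stage_of_ne {α : Type*} {M : Set (List α)} {g : ℕ → List α} {w : List α}
    (hw : w ∈ Prim M) {k : ℕ} (hg : ∀ j < k, g j ≠ []) (hne : ∀ j < k, w ≠ g j) :
    w ∈ Prim (stage M g k) := by
  induction k with
  | zero => exact hw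
  | succ k ih =>
    obtain ⟨h1, h2, h3⟩ := ih (fun j hj => hg j (by omega)) (fun j hj => hne j (by omega))
    refine ⟨⟨h1, fun v hv hwv => ?_⟩, h2, fun u v huv hu hv hvM => h3 u v huv hu hv hvM.1⟩
    by_cases hv0 : v = []
    · exact hne k (by omega) (by simpa [hv0] using hwv)
    · exact h3 _ v hwv (hg k (by omega)) hv0 hv

/-- If no more than `f_n` loops of length `n` are deleted, then the deleted loops can be chosen
among the loops of the loop graph of `f`. -/
lemma exists_elims_loopPath (hf : constantCoeff f = 0) (hfin : ∀ n, {k | r k = n}.Finite)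
    (hle : ∀ n, mult r n ≤ coeff n f) (hlt : mult r (r 0) < coeff (r 0) f) :
    ∃ (g : ℕ → List (LoopEdge f)) (i : Fin (coeff (r 0) f)),
      (∀ k, g k ∈ Prim (stage (closedWalks f) g k) ∧ (g k).length = r k) ∧
      (∀ k, g k ∈ Prim (closedWalks f)) ∧ ∀ k, g k ≠ loopPath f (r 0) i := by
  -- The step `k` eliminates the loop of length `r k` whose index is the number of the earlier steps
  -- with the same length. These indices are less than `mult r (r k)`, which is free for `k = 0`.
  set idx : ℕ → ℕ := fun k => {j | j < k ∧ r j = r k}.ncard with hidx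
  have hsub : ∀ k, {j | j < k ∧ r j = r k} ⊂ {j | r j = r k} := fun k =>
    ⟨fun j hj => hj.2, fun h => absurd (h (show k ∈ {j | r j = r k} from rfl)).1 (lt_irrefl k)⟩
  have hidx_lt : ∀ k, idx k < mult r (r k) := fun k => Set.ncard_lt_ncard (hsub k) (hfin _)
  have hidx_mono : ∀ j k, j < k → r j = r k → idx j < idx k := by
    intro j k hjk hr
    refine Set.ncard_lt_ncard ⟨fun i hi => ⟨hi.1.trans hjk, hi.2.trans hr⟩, fun h => ?_⟩
      ((hfin _).subset (hsub k).subset)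
    exact absurd (h (show j ∈ {i | i < k ∧ r i = r k} from ⟨hjk, hr⟩)).1 (lt_irrefl j)
  have hpath : ∀ n m (i : Fin (coeff n f)) (i' : Fin (coeff m f)),
      loopPath f n i = loopPath f m i' → n = m ∧ (i : ℕ) = i' := by
    intro n m i i' h
    have hnm : n = m := by simpa using congrArg List.length h
    subst hnm
    exact ⟨rfl, by rw [loopPath_injective hf n h]⟩
  set g : ℕ → List (LoopEdge f) :=
    fun k => loopPath f (r k) ⟨idx k, (hidx_lt k).trans_le (hle _)⟩ with hg
  have hgp : ∀ k, g k ∈ Prim (closedWalks f) := fun k => loopPath_mem_prim hf _ _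
  refine ⟨g, ⟨mult r (r 0), hlt⟩, fun k => ⟨?_, length_loopPath _ _⟩, hgp, fun k h => ?_⟩
  · refine mem_prim_stage_of_ne (hgp k) (fun j _ => (hgp j).2.1) fun j hj h => ?_
    obtain ⟨h1, h2⟩ := hpath _ _ _ _ h
    have := hidx_mono j k hj h1.symm
    simp only at h2
    omega
  · obtain ⟨h1, h2⟩ := hpath _ _ _ _ h
    have := hidx_lt k
    rw [h1] at this
    simp only at h2
    omega

end Choice

section Magic

variable {f F : ℕ⟦X⟧} {g : ℕ → List (LoopEdge f)}
  (e : ∀ m, Fin (coeff m F) ≃ {w // w ∈ Prim (stageInf (closedWalks f) g) ∧ w.length = m})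

lemma occursAt_iff {y : LoopShift f} {i : ℤ} {W : List (LoopEdge f)} :
    OccursAt y i W ↔ word (edges y) i W.length = W := by
  rw [word_eq_iff]
  exact ⟨fun h t ht => h ⟨t, ht⟩, fun h t => h t t.2⟩

/-- A walk which repeats a single loop. -/
lemma exists_occursAt_loopPath {n : ℕ} (i : Fin (coeff n f)) (hn : 0 < n) :
    ∃ (y : LoopShift f) (j : ℤ), OccursAt y j (loopPath f n i) := by
  have hn' : (0 : ℤ) < n := by exact_mod_cast hn
  have h0 : ∀ t : ℤ, 0 ≤ t % n := fun t => Int.emod_nonneg _ hn'.ne'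
  have h1 : ∀ t : ℤ, t % n < n := fun t => Int.emod_lt_of_pos _ hn'
  have hlt : ∀ t : ℤ, (t % n).toNat < n := fun t => by
    have := h0 t; have := h1 t; omega
  have hstep : ∀ t : ℤ, Step (f := f) ⟨n, i, ⟨(t % n).toNat, hlt t⟩⟩
      ⟨n, i, ⟨((t + 1) % n).toNat, hlt (t + 1)⟩⟩ := by
    intro t
    have ha := h0 t
    have hb := h1 t
    rw [step_iff]
    by_cases h : t % n + 1 < n
    · refine Or.inl ⟨by simp only; omega, LoopEdge.ext' rfl rfl ?_⟩
      have : (t + 1) % n = t % n + 1 := by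
        rw [← Int.emod_add_emod, Int.emod_eq_of_lt (by omega) h]
      simp only [this]
      omega
    · refine Or.inr ⟨by simp only; omega, ?_⟩
      have h2 : t % n + 1 = n := by omega
      have : (t + 1) % n = 0 := by
        rw [← Int.emod_add_emod, h2, Int.emod_self]
      simp only [this, Int.toNat_zero]
  refine ⟨⟨fun t => ⟨n, i, ⟨(t % n).toNat, hlt t⟩⟩, hstep⟩, 0, occursAt_iff.2
    (word_eq_iff.2 fun t ht => ?_)⟩
  rw [length_loopPath] at ht
  rw [getElem_loopPath, zero_add]
  refine LoopEdge.ext' rfl rfl ?_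
  change ((t : ℤ) % n).toNat = t
  rw [Int.emod_eq_of_lt (by positivity) (by exact_mod_cast ht)]
  simp

/-- The occurrences of a loop which is not among the deleted ones are never deleted. -/
lemma mem_markers_of_occursAt (hgp : ∀ k, g k ∈ Prim (closedWalks f)) {n : ℕ}
    {i : Fin (coeff n f)} (hn : 0 < n) (hne : ∀ k, g k ≠ loopPath f n i) {y : LoopShift f} {j : ℤ}
    (h : OccursAt y j (loopPath f n i)) : j ∈ markers g y := by
  rw [occursAt_iff, word_eq_iff] at h
  have h0 : edges y j = ⟨n, i, ⟨0, hn⟩⟩ := by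
    have := h 0 (by simpa)
    rwa [Nat.cast_zero, add_zero, getElem_loopPath] at this
  refine Set.mem_iInter.2 fun k => ?_
  induction k with
  | zero =>
    change ((edges y j).pos : ℕ) = 0
    rw [h0]
  | succ k ih =>
    refine ⟨ih, ?_⟩
    rintro ⟨hw, -⟩
    obtain ⟨m, i', hgk⟩ := mem_prim_closedWalks (hgp k)
    have hm : 0 < m := by
      rw [← length_loopPath m i', ← hgk]
      exact List.length_pos_iff.2 (hgp k).2.1
    rw [hgk, word_eq_iff] at hw
    have h1 := hw 0 (by simpa)
    rw [Nat.cast_zero, add_zero, getElem_loopPath, h0] at h1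
    injection h1 with h2 h3
    subst h2
    obtain rfl := eq_of_heq h3
    exact hne k hgk

/-- A loop which is never deleted is a magic word. -/
lemma hasMagicWord_loopCode (hg : ∀ k, g k ∈ Prim (stage (closedWalks f) g k))
    (hgp : ∀ k, g k ∈ Prim (closedWalks f)) {n : ℕ} {i : Fin (coeff n f)} (hn : 0 < n)
    (hne : ∀ k, g k ≠ loopPath f n i) : HasMagicWord (loopCode e) := by
  have hU := isUnitary_stageInf (isUnitary_closedWalks f) hg
  set W := loopPath f n i with hW
  have hWl : W.length = n := length_loopPath n i
  have hmark : ∀ {y : LoopShift f} {j : ℤ}, OccursAt y j W → j ∈ markers g y :=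
    fun h => mem_markers_of_occursAt hgp hn hne h
  refine ⟨W, List.length_pos_iff.1 (hWl ▸ hn), exists_occursAt_loopPath i hn, ?_, 0, ?_⟩
  · intro y ha hb
    refine mem_range_loopCode e hg y (fun j => ?_) (fun j => ?_)
    · by_contra! hc
      exact ha ⟨j, fun t ht => by_contra fun h => hc t (hmark ht) |>.not_gt (not_le.1 h)⟩
    · by_contra! hc
      exact hb ⟨j, fun t ht => (hc t (hmark ht)).le⟩
  · intro (C : List (LoopEdge f)) x x' hx hx' m hm
    have hocc : ∀ {y : LoopShift f}, OccursAt y 0 (W ++ C ++ W) →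
        (0 : ℤ) ∈ markers g y ∧ (0 : ℤ) + (W.length + C.length : ℕ) ∈ markers g y ∧
          word (edges y) 0 (W.length + C.length) = W ++ C := by
      intro y h
      rw [occursAt_iff] at h
      obtain ⟨-, h1, h2⟩ := word_eq_append h
      obtain ⟨-, h3, h4⟩ := word_eq_append h1.symm
      rw [List.length_append] at h1 h2
      exact ⟨hmark (occursAt_iff.2 h3.symm), hmark (occursAt_iff.2 h2.symm), h1.symm⟩
    obtain ⟨h1, h2, h3⟩ := hocc hx
    obtain ⟨h1', h2', h3'⟩ := hocc hx'
    rw [markers_loopCode e hg] at h1 h2 h1' h2'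
    exact eq_of_codeMap_eq e hU (stageInf_subset _ _) x x' _ h1 h2 h1' h2' (h3.trans h3'.symm) m hm

end Magic

/-! ### An upper bound for the entropy of a partition -/

section Gibbs

/-- Gibbs' inequality. -/
lemma sum_negMulLog_le {ι : Type*} [Fintype ι] {p q : ι → ℝ} (hp : ∀ i, 0 ≤ p i)
    (hp1 : ∑ i, p i = 1) (hq : ∀ i, 0 ≤ q i) (hq1 : ∑ i, q i ≤ 1)
    (hpq : ∀ i, 0 < p i → 0 < q i) :
    ∑ i, Real.negMulLog (p i) ≤ ∑ i, p i * -Real.log (q i) := by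
  have h : ∀ i, Real.negMulLog (p i) ≤ p i * -Real.log (q i) + (q i - p i) := by
    intro i
    rcases (hp i).eq_or_lt with h0 | h0
    · rw [← h0]; simp [hq i]
    · have hqi := hpq i h0
      have h1 := Real.log_le_sub_one_of_pos (div_pos hqi h0)
      rw [Real.log_div hqi.ne' h0.ne'] at h1
      have h2 := mul_le_mul_of_nonneg_left h1 h0.le
      have h3 : p i * (q i / p i - 1) = q i - p i := by field_simp
      rw [h3] at h2
      rw [Real.negMulLog]
      linarith
  refine (Finset.sum_le_sum fun i _ => h i).trans ?_
  rw [Finset.sum_add_distrib, Finset.sum_sub_distrib]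
  linarith

end Gibbs

section ListSum

variable {k : ℕ}

/-- The sum of `g` over the words of length `n`. -/
def listSum : ℕ → (List (Fin k) → ℝ) → ℝ
  | 0, g => g []
  | n + 1, g => ∑ a, listSum n fun w => g (a :: w)

lemma listSum_eq (n : ℕ) (g : List (Fin k) → ℝ) :
    listSum n g = ∑ w : Fin n → Fin k, g (List.ofFn w) := by
  induction n generalizing g with
  | zero => simp [listSum]
  | succ n ih =>
    simp only [listSum, ih]
    rw [← (Fin.consEquiv fun _ => Fin k).sum_comp, Fintype.sum_prod_type]
    refine Finset.sum_congr rfl fun a _ => Finset.sum_congr rfl fun w _ => ?_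
    rw [List.ofFn_succ]
    simp [Fin.consEquiv]

lemma listSum_mono {n : ℕ} {g h : List (Fin k) → ℝ} (hgh : ∀ w, w.length = n → g w ≤ h w) :
    listSum n g ≤ listSum n h := by
  rw [listSum_eq, listSum_eq]
  exact Finset.sum_le_sum fun w _ => hgh _ (by simp)

lemma listSum_congr {n : ℕ} {g h : List (Fin k) → ℝ} (hgh : ∀ w, w.length = n → g w = h w) :
    listSum n g = listSum n h :=
  le_antisymm (listSum_mono fun w hw => (hgh w hw).le) (listSum_mono fun w hw => (hgh w hw).ge)

lemma listSum_nonneg {n : ℕ} {g : List (Fin k) → ℝ} (hg : ∀ w, 0 ≤ g w) : 0 ≤ listSum n g := by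
  rw [listSum_eq]
  exact Finset.sum_nonneg fun w _ => hg _

lemma listSum_const_mul (n : ℕ) (c : ℝ) (g : List (Fin k) → ℝ) :
    listSum n (fun w => c * g w) = c * listSum n g := by
  rw [listSum_eq, listSum_eq, Finset.mul_sum]

lemma listSum_add (n : ℕ) (g h : List (Fin k) → ℝ) :
    listSum n (fun w => g w + h w) = listSum n g + listSum n h := by
  simp only [listSum_eq, Finset.sum_add_distrib]

lemma listSum_sum {ι : Type*} (s : Finset ι) (n : ℕ) (g : ι → List (Fin k) → ℝ) :
    listSum n (fun w => ∑ i ∈ s, g i w) = ∑ i ∈ s, listSum n (g i) := by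
  simp only [listSum_eq]
  exact Finset.sum_comm

lemma listSum_take_drop (m n : ℕ) (p q : List (Fin k) → ℝ) :
    listSum (m + n) (fun w => p (w.take m) * q (w.drop m)) = listSum m p * listSum n q := by
  induction m generalizing p with
  | zero => simp [listSum, listSum_const_mul]
  | succ m ih =>
    rw [Nat.succ_add]
    simp only [listSum, List.take_succ_cons, List.drop_succ_cons]
    rw [Finset.sum_mul]
    exact Finset.sum_congr rfl fun a _ => ih fun w => p (a :: w)

/-- The total weight of the ways of cutting a word into blocks, where the weight of a cutting is
the product of the weights `b v` of its blocks `v`. -/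
def weight (b : List (Fin k) → ℝ) (w : List (Fin k)) : ℝ :=
  if w = [] then 1
  else ∑ m : Fin w.length, b (w.take (m + 1)) * weight b (w.drop (m + 1))
termination_by w.length
decreasing_by
  have := m.2
  simp only [List.length_drop]
  omega

lemma weight_nil (b : List (Fin k) → ℝ) : weight b [] = 1 := by
  rw [weight, if_pos rfl]

lemma weight_of_ne_nil (b : List (Fin k) → ℝ) {w : List (Fin k)} (hw : w ≠ []) :
    weight b w = ∑ m ∈ Finset.range w.length, b (w.take (m + 1)) * weight b (w.drop (m + 1)) := by
  rw [weight, if_neg hw, Finset.sum_range]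

lemma weight_nonneg {b : List (Fin k) → ℝ} (hb : ∀ v, 0 ≤ b v) (w : List (Fin k)) :
    0 ≤ weight b w := by
  by_cases hw : w = []
  · rw [hw, weight_nil]; exact zero_le_one
  · rw [weight_of_ne_nil b hw]
    refine Finset.sum_nonneg fun m hm => mul_nonneg (hb _) ?_
    have := Finset.mem_range.1 hm
    exact weight_nonneg hb _
termination_by w.length
decreasing_by
  simp only [List.length_drop]
  omega

lemma mul_weight_le {b : List (Fin k) → ℝ} (hb : ∀ v, 0 ≤ b v) {v : List (Fin k)} (hv : v ≠ [])
    (w : List (Fin k)) : b v * weight b w ≤ weight b (v ++ w) := by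
  have hl := List.length_pos_iff.2 hv
  rw [weight_of_ne_nil b (w := v ++ w) (by simp [hv])]
  have h := Finset.single_le_sum (s := Finset.range (v ++ w).length)
    (f := fun m => b ((v ++ w).take (m + 1)) * weight b ((v ++ w).drop (m + 1)))
    (fun m _ => mul_nonneg (hb _) (weight_nonneg hb _)) (a := v.length - 1)
    (by rw [Finset.mem_range, List.length_append]; omega)
  have h1 : v.length - 1 + 1 = v.length := by omega
  simpa only [h1, List.take_left, List.drop_left] using h

/-- If the blocks have total weight at most `1`, then so have the words of each length. -/
lemma listSum_weight_le {b : List (Fin k) → ℝ} (hb : ∀ v, 0 ≤ b v)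
    (hb1 : ∀ n, ∑ m ∈ Finset.range n, listSum (m + 1) b ≤ 1) (n : ℕ) :
    listSum n (weight b) ≤ 1 := by
  induction n using Nat.strong_induction_on with
  | _ n ih =>
    rcases Nat.eq_zero_or_pos n with rfl | hn
    · simp [listSum, weight_nil]
    · have h1 : listSum n (weight b) = ∑ m ∈ Finset.range n,
          listSum (m + 1) b * listSum (n - (m + 1)) (weight b) := by
        rw [listSum_congr (h := fun w => ∑ m ∈ Finset.range n,
          b (w.take (m + 1)) * weight b (w.drop (m + 1)))
          (fun w hw => by rw [weight_of_ne_nil b (by rintro rfl; simp at hw; omega), hw]),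
          listSum_sum]
        refine Finset.sum_congr rfl fun m hm => ?_
        have := Finset.mem_range.1 hm
        rw [← listSum_take_drop]
        congr 1
        omega
      rw [h1]
      refine (Finset.sum_le_sum fun m hm => ?_).trans (hb1 n)
      have := Finset.mem_range.1 hm
      exact mul_le_of_le_one_right (listSum_nonneg hb) (ih _ (by omega))

/-- The transition probabilities of the channel that replaces, with probability `η`, a letter by a
random one. -/
def flip (η : ℝ) (a b : Fin k) : ℝ := if a = b then 1 - η else η / k

/-- The probability that the channel transforms the first word into the second one. -/
def noise (η : ℝ) : List (Fin k) → List (Fin k) → ℝ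
  | [], [] => 1
  | a :: v, b :: w => flip η a b * noise η v w
  | _, _ => 0

lemma flip_nonneg {η : ℝ} (h0 : 0 ≤ η) (h1 : η ≤ 1) (a b : Fin k) : 0 ≤ flip η a b := by
  unfold flip
  split_ifs
  · linarith
  · positivity

lemma sum_flip_le {η : ℝ} (h0 : 0 ≤ η) (a : Fin k) : ∑ b, flip η a b ≤ 1 := by
  have hk : (0 : ℝ) < k := by
    have := a.pos
    exact_mod_cast this
  calc ∑ b, flip η a b ≤ ∑ b, ((if a = b then 1 - η else 0) + η / k) := by
        refine Finset.sum_le_sum fun b _ => ?_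
        unfold flip
        have : 0 ≤ η / k := by positivity
        split_ifs <;> linarith
    _ = 1 := by
        rw [Finset.sum_add_distrib, Finset.sum_ite_eq, if_pos (Finset.mem_univ _)]
        simp only [Finset.sum_const, Finset.card_univ, Fintype.card_fin, nsmul_eq_mul]
        field_simp
        ring

lemma noise_nonneg {η : ℝ} (h0 : 0 ≤ η) (h1 : η ≤ 1) (v w : List (Fin k)) : 0 ≤ noise η v w := by
  induction v generalizing w with
  | nil => cases w <;> simp [noise]
  | cons a v ih =>
    cases w with
    | nil => simp [noise]
    | cons b w => exact mul_nonneg (flip_nonneg h0 h1 a b) (ih w)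

lemma listSum_noise_le {η : ℝ} (h0 : 0 ≤ η) (h1 : η ≤ 1) (v : List (Fin k)) :
    listSum v.length (noise η v) ≤ 1 := by
  induction v with
  | nil => simp [listSum, noise]
  | cons a v ih =>
    simp only [List.length_cons, listSum, noise, listSum_const_mul]
    rw [← Finset.sum_mul]
    exact mul_le_one₀ (sum_flip_le h0 a) (listSum_nonneg (noise_nonneg h0 h1 v)) ih

end ListSum

section Names

variable {Ω : Type*} {k : ℕ}

/-- The word of length `n` read from the orbit of `x` by the partition `P`. -/
def name (T : Ω → Ω) (P : Ω → Fin k) (n : ℕ) (x : Ω) : List (Fin k) :=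
  (List.range n).map fun i => P (T^[i] x)

variable (T : Ω → Ω) (P P' : Ω → Fin k)

@[simp] lemma length_name (n : ℕ) (x : Ω) : (name T P n x).length = n := by simp [name]

lemma name_add (m n : ℕ) (x : Ω) :
    name T P (m + n) x = name T P m x ++ name T P n (T^[m] x) := by
  simp only [name, List.range_add, List.map_append, List.map_map]
  congr 1
  refine List.map_congr_left fun i _ => ?_
  simp only [Function.comp_apply]
  rw [← Function.iterate_add_apply, add_comm m i]

lemma name_one (x : Ω) : name T P 1 x = [P x] := by simp [name]

lemma name_succ (n : ℕ) (x : Ω) : name T P (n + 1) x = P x :: name T P n (T x) := by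
  rw [add_comm, name_add, name_one]; rfl

lemma name_eq_ofFn (n : ℕ) (x : Ω) : name T P n x = List.ofFn fun i : Fin n => P (T^[i] x) := by
  refine List.ext_getElem (by simp) fun t h1 h2 => ?_
  simp [name]

/-- The cost, at the point `x`, of passing from the partition `P'` to the partition `P`. -/
def flipCost (η : ℝ) (x : Ω) : ℝ :=
  -Real.log (1 - η) + {x | P x ≠ P' x}.indicator (fun _ => Real.log (k / η)) x

lemma exp_neg_flipCost_le {η : ℝ} (h0 : 0 < η) (h1 : η ≤ 1 / 2) (x : Ω) :
    Real.exp (-flipCost P P' η x) ≤ flip η (P' x) (P x) := by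
  have hk : (0 : ℝ) < k := by
    have := (P x).pos
    exact_mod_cast this
  have hV : 0 ≤ -Real.log (1 - η) := by
    have := Real.log_nonpos (x := 1 - η) (by linarith) (by linarith)
    linarith
  unfold flipCost flip
  by_cases h : P x = P' x
  · rw [Set.indicator_of_notMem (by simpa using h), if_pos h.symm, add_zero, neg_neg,
      Real.exp_log (by linarith)]
  · rw [Set.indicator_of_mem (by exact h), if_neg (Ne.symm h)]
    calc _ ≤ Real.exp (-Real.log (k / η)) := Real.exp_le_exp.2 (by linarith)
      _ = η / k := by rw [← Real.log_inv, inv_div, Real.exp_log (by positivity)]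

lemma exp_neg_sum_flipCost_le {η : ℝ} (h0 : 0 < η) (h1 : η ≤ 1 / 2) (n : ℕ) (x : Ω) :
    Real.exp (-∑ i ∈ Finset.range n, flipCost P P' η (T^[i] x)) ≤
      noise η (name T P' n x) (name T P n x) := by
  induction n generalizing x with
  | zero => simp [name, noise]
  | succ n ih =>
    rw [name_succ, name_succ, noise, Finset.sum_range_succ', neg_add_rev, Real.exp_add]
    exact mul_le_mul (exp_neg_flipCost_le P P' h0 h1 x) (ih (T x)) (Real.exp_nonneg _)
      (flip_nonneg h0.le (by linarith) _ _)

/-- The block weights: single letters are permitted at a high cost, and so are, at the cost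
`log t` per letter, the words of `C` of lengths in `[M, N]` disturbed by noise. -/
def blockWeight (η t : ℝ) (M N : ℕ) (C : ℕ → Finset (List (Fin k))) (v : List (Fin k)) : ℝ :=
  (if v.length = 1 then 1 / (2 * k : ℝ) else 0) +
    if M ≤ v.length ∧ v.length ≤ N then (t⁻¹) ^ v.length * ∑ u ∈ C v.length, noise η u v else 0

lemma blockWeight_nonneg {η t : ℝ} (h0 : 0 ≤ η) (h1 : η ≤ 1) (ht : 0 ≤ t) (M N : ℕ)
    (C : ℕ → Finset (List (Fin k))) (v : List (Fin k)) : 0 ≤ blockWeight η t M N C v := by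
  unfold blockWeight
  refine add_nonneg (by positivity) ?_
  split_ifs
  · exact mul_nonneg (by positivity) (Finset.sum_nonneg fun u _ => noise_nonneg h0 h1 _ _)
  · exact le_rfl

lemma listSum_blockWeight_le {η s t K : ℝ} (h0 : 0 ≤ η) (h1 : η ≤ 1) (hs : 0 < s) (ht : 0 < t)
    (hk : 0 < k) (M N : ℕ) {C : ℕ → Finset (List (Fin k))} (hC : ∀ m, ∀ u ∈ C m, u.length = m)
    (hCK : ∀ m, ((C m).card : ℝ) ≤ K * s ^ m) (m : ℕ) :
    listSum m (blockWeight η t M N C) ≤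
      (if m = 1 then 1 / 2 else 0) + if M ≤ m then K * (s / t) ^ m else 0 := by
  rw [listSum_congr (h := fun v => (if m = 1 then 1 / (2 * k : ℝ) else 0) * 1 +
    (if M ≤ m ∧ m ≤ N then (t⁻¹) ^ m else 0) * ∑ u ∈ C m, noise η u v)
    (fun v hv => by rw [blockWeight, hv]; split_ifs <;> simp), listSum_add, listSum_const_mul,
    listSum_const_mul, listSum_sum]
  have hk' : (0 : ℝ) < k := by exact_mod_cast hk
  refine add_le_add ?_ ?_
  · split_ifs with h
    · subst h
      simp only [listSum_eq]
      simp
      field_simp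
      exact le_rfl
    · simp
  · have hK : 0 ≤ K := by
      have := hCK 0
      simp only [pow_zero, mul_one] at this
      exact (Nat.cast_nonneg _).trans this
    by_cases h : M ≤ m ∧ m ≤ N
    · rw [if_pos h, if_pos h.1]
      have : ∑ u ∈ C m, listSum m (noise η u) ≤ (C m).card := by
        refine (Finset.sum_le_card_nsmul _ _ 1 fun u hu => ?_).trans (by simp)
        have := listSum_noise_le h0 h1 u
        rwa [hC m u hu] at this
      calc _ ≤ (t⁻¹) ^ m * (K * s ^ m) := by gcongr; exact this.trans (hCK m)
        _ = _ := by rw [div_pow, inv_pow]; ring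
    · rw [if_neg h, zero_mul]
      split_ifs <;> positivity

/-- The cost per letter: the point `x` is read in a block if there is a block of a length in
`[M, N]` at `x`, and as a single letter otherwise. -/
def cost (η t : ℝ) (M N : ℕ) (G : ℕ → Set Ω) (x : Ω) : ℝ :=
  Real.log t + flipCost P P' η x +
    {x | ∀ m, M ≤ m → m ≤ N → x ∉ G m}.indicator (fun _ => Real.log (2 * k)) x

/-- The greedy parsing of the `P`-word of `x`, which takes a block of a length in `[M, N]` wherever
one starts and fits, and a single letter otherwise, contributes at least `exp (-cost)` to the
weight. The additional cost of `min n N` letters is for the end of the word, where a block may not fit. -/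
lemma exp_neg_cost_le_weight {η t : ℝ} (h0 : 0 < η) (h1 : η ≤ 1 / 2) (ht : 1 ≤ t) {M N : ℕ}
    (hM : 0 < M) {C : ℕ → Finset (List (Fin k))} {G : ℕ → Set Ω}
    (hC : ∀ m, ∀ x ∈ G m, name T P' m x ∈ C m) (n : ℕ) (x : Ω) :
    Real.exp (-(∑ i ∈ Finset.range n, cost P P' η t M N G (T^[i] x) +
      (min n N : ℕ) * Real.log (2 * k))) ≤ weight (blockWeight η t M N C) (name T P n x) := by
  have hk : (1 : ℝ) ≤ k := by
    have := (P x).pos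
    exact_mod_cast this
  have hA : 0 ≤ Real.log (2 * k) := Real.log_nonneg (by linarith)
  have hlt : 0 ≤ Real.log t := Real.log_nonneg ht
  have hflip : ∀ x, 0 ≤ flipCost P P' η x := by
    intro x
    have hV : 0 ≤ -Real.log (1 - η) := by
      have := Real.log_nonpos (x := 1 - η) (by linarith) (by linarith)
      linarith
    have hU : 0 ≤ Real.log (k / η) := Real.log_nonneg (by
      rw [le_div_iff₀ h0]; linarith)
    exact add_nonneg hV (Set.indicator_nonneg (fun _ _ => hU) x)
  have hcost : ∀ x, Real.log t + flipCost P P' η x ≤ cost P P' η t M N G x := by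
    intro x
    exact le_add_of_nonneg_right (Set.indicator_nonneg (fun _ _ => hA) x)
  have hb := blockWeight_nonneg h0.le (by linarith) (by linarith) M N C (t := t) (η := η)
  induction n using Nat.strong_induction_on generalizing x with
  | _ n ih =>
    rcases Nat.eq_zero_or_pos n with rfl | hn
    · simp [name, weight_nil]
    by_cases hx : ∃ m, (M ≤ m ∧ m ≤ N ∧ x ∈ G m) ∧ m ≤ n
    · obtain ⟨m, ⟨hm1, hm2, hm3⟩, hmn⟩ := hx
      obtain ⟨c, rfl⟩ := Nat.exists_eq_add_of_le hmn
      rw [name_add]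
      have hne : name T P m x ≠ [] := by
        rw [← List.length_pos_iff, length_name]; omega
      refine le_trans ?_ (mul_weight_le hb hne _)
      have hbl : Real.exp (-∑ i ∈ Finset.range m, (Real.log t + flipCost P P' η (T^[i] x))) ≤
          blockWeight η t M N C (name T P m x) := by
        rw [blockWeight, length_name, if_pos (show M ≤ m ∧ m ≤ N from ⟨hm1, hm2⟩),
          Finset.sum_add_distrib, neg_add, Real.exp_add]
        refine le_add_of_nonneg_of_le (by positivity) ?_
        refine mul_le_mul (le_of_eq ?_) ?_ (Real.exp_nonneg _) (by positivity)
        · rw [Finset.sum_const, Finset.card_range, nsmul_eq_mul, ← mul_neg, ← Real.log_inv,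
            mul_comm, ← Real.rpow_natCast, Real.rpow_def_of_pos (by positivity)]
        · refine (exp_neg_sum_flipCost_le T P P' h0 h1 m x).trans ?_
          exact Finset.single_le_sum (f := fun u => noise η u (name T P m x))
            (fun u _ => noise_nonneg h0.le (by linarith) _ _) (hC m x hm3)
      refine le_trans ?_ (mul_le_mul hbl (ih c (by omega) (T^[m] x)) (Real.exp_nonneg _) (hb _))
      rw [← Real.exp_add, Real.exp_le_exp, Finset.sum_range_add]
      have e1 : ∑ i ∈ Finset.range m, (Real.log t + flipCost P P' η (T^[i] x)) ≤
          ∑ i ∈ Finset.range m, cost P P' η t M N G (T^[i] x) :=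
        Finset.sum_le_sum fun i _ => hcost _
      have e2 : ∑ i ∈ Finset.range c, cost P P' η t M N G (T^[i] (T^[m] x)) =
          ∑ i ∈ Finset.range c, cost P P' η t M N G (T^[m + i] x) :=
        Finset.sum_congr rfl fun i _ => by rw [← Function.iterate_add_apply, add_comm m i]
      have e3 : ((min c N : ℕ) : ℝ) * Real.log (2 * k) ≤
          ((min (m + c) N : ℕ) : ℝ) * Real.log (2 * k) := by
        gcongr
        exact Nat.le_add_left _ _
      rw [e2]
      linarith
    · obtain ⟨c, rfl⟩ : ∃ c, n = 1 + c := ⟨n - 1, by omega⟩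
      rw [name_add]
      refine le_trans ?_ (mul_weight_le hb (v := name T P 1 x) (by simp [name_one]) _)
      have hbl : Real.exp (-Real.log (2 * k)) ≤ blockWeight η t M N C (name T P 1 x) := by
        rw [blockWeight, length_name, if_pos rfl, ← Real.log_inv, Real.exp_log (by positivity)]
        rw [one_div]
        refine le_add_of_nonneg_right ?_
        split_ifs
        · exact mul_nonneg (by positivity)
            (Finset.sum_nonneg fun u _ => noise_nonneg h0.le (by linarith) _ _)
        · exact le_rfl
      refine le_trans ?_ (mul_le_mul hbl (ih c (by omega) (T^[1] x)) (Real.exp_nonneg _) (hb _))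
      rw [← Real.exp_add, Real.exp_le_exp, Finset.sum_range_add, Finset.sum_range_one]
      have e2 : ∑ i ∈ Finset.range c, cost P P' η t M N G (T^[i] (T^[1] x)) =
          ∑ i ∈ Finset.range c, cost P P' η t M N G (T^[1 + i] x) :=
        Finset.sum_congr rfl fun i _ => by rw [← Function.iterate_add_apply, add_comm 1 i]
      have e4 : Real.log (2 * k) + ((min c N : ℕ) : ℝ) * Real.log (2 * k) ≤
          cost P P' η t M N G (T^[0] x) + ((min (1 + c) N : ℕ) : ℝ) * Real.log (2 * k) := by
        have hflipx := hflip x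
        -- either no block starts at `x`, or the block at `x` is too long for what is left to read
        by_cases hbad : ∀ m, M ≤ m → m ≤ N → x ∉ G m
        · have : Real.log (2 * k) ≤ cost P P' η t M N G x := by
            rw [cost, Set.indicator_of_mem (by exact hbad)]
            linarith
          have e5 : ((min c N : ℕ) : ℝ) * Real.log (2 * k) ≤
              ((min (1 + c) N : ℕ) : ℝ) * Real.log (2 * k) := by
            gcongr
            exact Nat.le_add_left _ _
          simp only [Function.iterate_zero, id_eq]
          linarith
        · push Not at hbad
          obtain ⟨m, hm1, hm2, hm3⟩ := hbad
          have hlt2 : 1 + c < m := by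
            by_contra! hc
            exact hx ⟨m, ⟨hm1, hm2, hm3⟩, hc⟩
          have h5 : min c N = c := by omega
          have h6 : min (1 + c) N = 1 + c := by omega
          have h7 := hcost x
          rw [h5, h6]
          push_cast
          simp only [Function.iterate_zero, id_eq]
          linarith
      rw [e2]
      linarith

end Names

section Covering

variable {Ω : Type*} [MeasurableSpace Ω] {k : ℕ}

lemma measurable_names {T : Ω → Ω} (hT : Measurable T) {P : Ω → Fin k} (hP : Measurable P)
    (n : ℕ) : Measurable fun (x : Ω) (i : Fin n) => P (T^[i] x) :=
  measurable_pi_lambda _ fun i => hP.comp (hT.iterate i)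

lemma joinEntropy_eq_map (T : Ω → Ω) (μ : Measure Ω) (P : Ω → Fin k) (n : ℕ) :
    joinEntropy T μ P n = ∑ w : Fin n → Fin k,
      Real.negMulLog (μ.real ((fun (x : Ω) (i : Fin n) => P (T^[i] x)) ⁻¹' {w})) := by
  refine Finset.sum_congr rfl fun w _ => ?_
  congr 2
  ext x
  simp [funext_iff]

/-- The entropy of a partition is bounded by the mean cost of a code whose costs satisfy Kraft's
inequality. -/
lemma joinEntropy_le_integral {T : Ω → Ω} {μ : Measure Ω} [IsProbabilityMeasure μ]
    (hT : Measurable T) {P : Ω → Fin k} (hP : Measurable P) (n : ℕ) {q : (Fin n → Fin k) → ℝ}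
    (hq : ∀ w, 0 ≤ q w) (hq1 : ∑ w, q w ≤ 1) {c : Ω → ℝ} (hc : Integrable c μ)
    (hcq : ∀ x, Real.exp (-c x) ≤ q fun i => P (T^[i] x)) :
    joinEntropy T μ P n ≤ ∫ x, c x ∂μ := by
  set Φ : Ω → (Fin n → Fin k) := fun x i => P (T^[i] x) with hΦ
  have hΦm : Measurable Φ := measurable_names hT hP n
  have : IsProbabilityMeasure (μ.map Φ) := Measure.isProbabilityMeasure_map hΦm.aemeasurable
  have hmap : ∀ w, μ.real (Φ ⁻¹' {w}) = (μ.map Φ).real {w} := fun w => by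
    rw [map_measureReal_apply hΦm (measurableSet_singleton w)]
  rw [joinEntropy_eq_map]
  refine (sum_negMulLog_le (q := q) (fun _ => measureReal_nonneg) ?_ hq hq1 ?_).trans ?_
  · simp only [hΦ.symm, hmap]
    rw [sum_measureReal_singleton]
    simp
  · intro w hw
    have : (Φ ⁻¹' {w}).Nonempty := by
      by_contra h
      rw [Set.not_nonempty_iff_eq_empty] at h
      rw [h] at hw
      simp at hw
    obtain ⟨x, rfl⟩ := this
    exact (Real.exp_pos _).trans_le (hcq x)
  · have h1 : ∑ w, μ.real (Φ ⁻¹' {w}) * -Real.log (q w) = ∫ x, -Real.log (q (Φ x)) ∂μ := by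
      rw [← integral_map (f := fun w => -Real.log (q w)) hΦm.aemeasurable
        (measurable_of_finite _).aestronglyMeasurable, integral_fintype (Integrable.of_finite)]
      simp only [hmap, smul_eq_mul]
    rw [h1]
    have h2 : Integrable (fun x => -Real.log (q (Φ x))) μ :=
      (Integrable.of_finite (μ := μ.map Φ) (f := fun w => -Real.log (q w))).comp_measurable hΦm
    refine integral_mono h2 hc fun x => ?_
    have h3 := (Real.le_log_iff_exp_le ((Real.exp_pos _).trans_le (hcq x))).2 (hcq x)
    simp only
    linarith

/-- The covering argument: let the partition `P` be approximated by partitions `P'` for which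
almost every orbit starts with arbitrarily long `P'`-words taken from a set of words growing at
the rate `s`. Then the entropy of `P` is at most `log s`. -/
theorem partitionEntropy_le_log {T : Ω → Ω} {μ : Measure Ω} [IsProbabilityMeasure μ]
    (hT : MeasurePreserving T μ μ) {P : Ω → Fin k} (hP : Measurable P) {s : ℝ} (hs : 1 < s)
    (h : ∀ ε : ℝ, 0 < ε → ∃ P' : Ω → Fin k, Measurable P' ∧ μ.real {x | P x ≠ P' x} ≤ ε ∧
      ∃ (G : ℕ → Set Ω) (K : ℝ), (∀ m, MeasurableSet (G m)) ∧
        (∀ m, ((name T P' m '' G m).ncard : ℝ) ≤ K * s ^ m) ∧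
        ∀ᵐ x ∂μ, ∀ M, ∃ m, M ≤ m ∧ x ∈ G m) :
    partitionEntropy T μ P ≤ Real.log s := by
  obtain ⟨x0⟩ : Nonempty Ω := nonempty_of_isProbabilityMeasure μ
  have hk0 : 0 < k := (P x0).pos
  have hk : (1 : ℝ) ≤ k := by exact_mod_cast hk0
  have hs0 : 0 < s := by linarith
  have key : ∀ δ : ℝ, 0 < δ → partitionEntropy T μ P ≤ (Real.log s + δ : ℝ) := by
    intro δ hδ
    -- The excess `δ` is shared by five sources: the rate `t` of the blocks instead of `s`, the
    -- noise at letters where `P` and `P'` agree, the letters where they differ, the letters not in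
    -- a block, and the end of the word.
    set t := s * Real.exp (δ / 5) with ht
    have hexp : 1 < Real.exp (δ / 5) := Real.one_lt_exp_iff.2 (by linarith)
    have hst : s < t := lt_mul_of_one_lt_right hs0 hexp
    have ht0 : 0 < t := by linarith
    have hlogt : Real.log t = Real.log s + δ / 5 := by
      rw [ht, Real.log_mul hs0.ne' (Real.exp_pos _).ne', Real.log_exp]
    set η := min (1 / 2) (1 - Real.exp (-(δ / 5))) with hη
    have hη0 : 0 < η := lt_min (by norm_num) (by
      have : Real.exp (-(δ / 5)) < 1 := Real.exp_lt_one_iff.2 (by linarith)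
      linarith)
    have hη1 : η ≤ 1 / 2 := min_le_left _ _
    have hV : -Real.log (1 - η) ≤ δ / 5 := by
      have h1 : Real.exp (-(δ / 5)) ≤ 1 - η := by
        have := min_le_right (1 / 2) (1 - Real.exp (-(δ / 5)))
        linarith
      have := (Real.le_log_iff_exp_le (by linarith)).2 h1
      linarith
    set U := Real.log (k / η) with hU
    have hU0 : 0 ≤ U := Real.log_nonneg (by rw [le_div_iff₀ hη0]; linarith)
    set A := Real.log (2 * k) with hA
    have hA0 : 0 ≤ A := Real.log_nonneg (by linarith)
    obtain ⟨P', hP', herr, G, K, hGm, hGK, hGae⟩ := h (δ / 5 / (U + 1)) (by positivity)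
    have hK0 : 0 ≤ K := by
      have := hGK 0
      simp only [pow_zero, mul_one] at this
      exact (Nat.cast_nonneg _).trans this
    set ρ := s / t with hρ
    have hρ0 : 0 < ρ := by positivity
    have hρ1 : ρ < 1 := (div_lt_one ht0).2 hst
    -- the total weight of the blocks longer than `M` is small
    obtain ⟨M, hM0, hM⟩ : ∃ M : ℕ, 0 < M ∧ K * (ρ ^ M / (1 - ρ)) ≤ 1 / 2 := by
      have h1 : Tendsto (fun M : ℕ => K * (ρ ^ M / (1 - ρ))) atTop (𝓝 (K * (0 / (1 - ρ)))) :=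
        ((tendsto_pow_atTop_nhds_zero_of_lt_one hρ0.le hρ1).div_const _).const_mul K
      rw [zero_div, mul_zero] at h1
      obtain ⟨M, h2, h3⟩ := ((eventually_gt_atTop 0).and
        (h1.eventually (gt_mem_nhds (by norm_num : (0 : ℝ) < 1 / 2)))).exists
      exact ⟨M, h2, h3.le⟩
    -- a block of length in `[M, N]` exists with a large probability
    set bad : ℕ → Set Ω := fun N => {x | ∀ m, M ≤ m → m ≤ N → x ∉ G m} with hbad
    have hbadm : ∀ N, MeasurableSet (bad N) := by
      intro N
      have : bad N = ⋂ m, ⋂ (_ : M ≤ m), ⋂ (_ : m ≤ N), (G m)ᶜ := by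
        ext x; simp [hbad]
      rw [this]
      exact MeasurableSet.iInter fun m => MeasurableSet.iInter fun _ =>
        MeasurableSet.iInter fun _ => (hGm m).compl
    obtain ⟨N, hN⟩ : ∃ N : ℕ, A * μ.real (bad N) ≤ δ / 5 := by
      have h1 : Tendsto (fun N => μ (bad N)) atTop (𝓝 (μ (⋂ N, bad N))) :=
        tendsto_measure_iInter_atTop (fun N => (hbadm N).nullMeasurableSet)
          (fun N N' hNN x hx m h1 h2 => hx m h1 (h2.trans hNN)) ⟨0, measure_ne_top _ _⟩
      have h2 : μ (⋂ N, bad N) = 0 := by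
        refine measure_mono_null (fun x hx => ?_) (ae_iff.1 hGae)
        intro hc
        obtain ⟨m, hm, hxm⟩ := hc M
        exact (Set.mem_iInter.1 hx m) m hm le_rfl hxm
      rw [h2] at h1
      have h3 : Tendsto (fun N => A * μ.real (bad N)) atTop (𝓝 (A * 0)) :=
        ((ENNReal.tendsto_toReal ENNReal.zero_ne_top).comp h1).const_mul A
      rw [mul_zero] at h3
      obtain ⟨N, h4⟩ := (h3.eventually (gt_mem_nhds (by positivity : 0 < δ / 5))).exists
      exact ⟨N, h4.le⟩
    have hfin : ∀ m, (name T P' m '' G m).Finite := fun m =>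
      (List.finite_length_eq (Fin k) m).subset (by rintro _ ⟨x, -, rfl⟩; exact length_name _ _ _ _)
    set C : ℕ → Finset (List (Fin k)) := fun m => (hfin m).toFinset with hC
    have hCl : ∀ m, ∀ u ∈ C m, u.length = m := by
      intro m u hu
      obtain ⟨x, -, rfl⟩ := (hfin m).mem_toFinset.1 hu
      exact length_name _ _ _ _
    have hCK : ∀ m, ((C m).card : ℝ) ≤ K * s ^ m := fun m => by
      rw [← Set.ncard_eq_toFinset_card _ (hfin m)]
      exact hGK m
    have hCG : ∀ m, ∀ x ∈ G m, name T P' m x ∈ C m := fun m x hx =>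
      (hfin m).mem_toFinset.2 ⟨x, hx, rfl⟩
    have hb := blockWeight_nonneg hη0.le (by linarith) ht0.le M N C (k := k)
    -- Kraft: single letters have total weight at most `1 / 2`, and so have the blocks.
    have hb1 : ∀ n, ∑ m ∈ Finset.range n, listSum (m + 1) (blockWeight η t M N C) ≤ 1 := by
      intro n
      refine (Finset.sum_le_sum fun m _ => listSum_blockWeight_le hη0.le (by linarith) hs0 ht0 hk0
        M N hCl hCK (m + 1)).trans ?_
      rw [Finset.sum_add_distrib]
      have h1 : ∑ m ∈ Finset.range n, (if m + 1 = 1 then (1 / 2 : ℝ) else 0) ≤ 1 / 2 := by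
        simp only [Nat.add_eq_right]
        rw [Finset.sum_ite_eq']
        split_ifs <;> norm_num
      have hgeom : HasSum (fun j : ℕ => K * (ρ ^ M * ρ ^ j)) (K * (ρ ^ M / (1 - ρ))) := by
        have := ((hasSum_geometric_of_lt_one hρ0.le hρ1).mul_left (ρ ^ M)).mul_left K
        simpa [div_eq_mul_inv] using this
      have h2 : ∑ m ∈ Finset.range n, (if M ≤ m + 1 then K * ρ ^ (m + 1) else 0) ≤ 1 / 2 := by
        refine le_trans ?_ hM
        rw [← hgeom.tsum_eq]
        set h : ℕ → ℝ := fun j => if M ≤ j then K * ρ ^ j else 0 with hh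
        have hh0 : ∀ j, 0 ≤ h j := fun j => by simp only [hh]; split_ifs <;> positivity
        calc ∑ m ∈ Finset.range n, h (m + 1) ≤ ∑ j ∈ Finset.range (n + 1), h j := by
              rw [Finset.sum_range_succ']
              exact le_add_of_nonneg_right (hh0 0)
          _ ≤ ∑ j ∈ Finset.range (M + (n + 1)), h j :=
              Finset.sum_le_sum_of_subset_of_nonneg (Finset.range_mono (by omega))
                fun j _ _ => hh0 j
          _ = ∑ j ∈ Finset.range (n + 1), K * (ρ ^ M * ρ ^ j) := by
              rw [Finset.sum_range_add, Finset.sum_eq_zero, zero_add]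
              · refine Finset.sum_congr rfl fun j _ => ?_
                simp only [hh, if_pos (Nat.le_add_right M j), pow_add]
              · intro j hj
                have := Finset.mem_range.1 hj
                simp only [hh, if_neg (not_le.2 this)]
          _ ≤ _ := hgeom.summable.sum_le_tsum _ fun j _ => by positivity
      linarith
    have hW1 := fun n => listSum_weight_le hb hb1 n
    have hTi : ∀ i, MeasurePreserving T^[i] μ μ := fun i => hT.iterate i
    have hcm : Measurable (cost P P' η t M N G) := by
      unfold cost flipCost
      refine (measurable_const.add (measurable_const.add ?_)).add ?_
      · exact measurable_const.indicator (measurableSet_eq_fun hP hP').compl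
      · exact measurable_const.indicator (hbadm N)
    have hErrm : MeasurableSet {x | P x ≠ P' x} := (measurableSet_eq_fun hP hP').compl
    have hci : Integrable (cost P P' η t M N G) μ := by
      unfold cost flipCost
      exact ((integrable_const _).add ((integrable_const _).add
        ((integrable_const _).indicator hErrm))).add ((integrable_const _).indicator (hbadm N))
    have hcint : ∫ x, cost P P' η t M N G x ∂μ ≤ Real.log s + 4 * (δ / 5) := by
      have h1 : ∫ x, cost P P' η t M N G x ∂μ =
          Real.log t + (-Real.log (1 - η) + μ.real {x | P x ≠ P' x} * U) + μ.real (bad N) * A := by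
        unfold cost flipCost
        rw [integral_add ((integrable_const _).add ((integrable_const _).add
          ((integrable_const _).indicator hErrm))) ((integrable_const _).indicator (hbadm N)),
          integral_add (integrable_const _) ((integrable_const _).add
          ((integrable_const _).indicator hErrm)), integral_add (integrable_const _)
          ((integrable_const _).indicator hErrm), integral_indicator_const _ hErrm,
          integral_indicator_const _ (hbadm N)]
        simp [hU, hA]
      have h2 : μ.real {x | P x ≠ P' x} * U ≤ δ / 5 := by
        calc _ ≤ δ / 5 / (U + 1) * U := by gcongr
          _ ≤ δ / 5 / (U + 1) * (U + 1) := by gcongr; linarith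
          _ = δ / 5 := by field_simp
      rw [h1, hlogt]
      linarith
    have hjoin : ∀ n : ℕ, joinEntropy T μ P n ≤ n * (Real.log s + 4 * (δ / 5)) + N * A := by
      intro n
      have hint : ∀ i, Integrable (fun x => cost P P' η t M N G (T^[i] x)) μ := fun i =>
        (hTi i).integrable_comp_of_integrable hci
      refine (joinEntropy_le_integral hT.measurable hP n
        (q := fun w => weight (blockWeight η t M N C) (List.ofFn w))
        (fun w => weight_nonneg hb _) (by rw [← listSum_eq]; exact hW1 n)
        (c := fun x => ∑ i ∈ Finset.range n, cost P P' η t M N G (T^[i] x) +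
          (min n N : ℕ) * Real.log (2 * k))
        ((integrable_finsetSum _ fun i _ => hint i).add (integrable_const _))
        (fun x => ?_)).trans ?_
      · rw [← name_eq_ofFn]
        exact exp_neg_cost_le_weight T P P' hη0 hη1 (by linarith) hM0 hCG n x
      · rw [integral_add (integrable_finsetSum _ fun i _ => hint i) (integrable_const _),
          integral_finsetSum _ fun i _ => hint i]
        have h1 : ∀ i ∈ Finset.range n, ∫ x, cost P P' η t M N G (T^[i] x) ∂μ ≤
            Real.log s + 4 * (δ / 5) := by
          intro i _
          rw [← integral_map (f := cost P P' η t M N G) (hTi i).measurable.aemeasurable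
            hcm.aestronglyMeasurable, (hTi i).map_eq]
          exact hcint
        have h2 := Finset.sum_le_card_nsmul _ _ _ h1
        rw [Finset.card_range, nsmul_eq_mul] at h2
        refine add_le_add h2 ?_
        simp only [integral_const, probReal_univ, smul_eq_mul, one_mul]
        gcongr
        exact min_le_right _ _
    refine limsup_le_of_le (by isBoundedDefault) ?_
    have hlim : Tendsto (fun n : ℕ => (N * A) / (n : ℝ)) atTop (𝓝 0) :=
      tendsto_const_div_atTop_nhds_zero_nat _
    filter_upwards [hlim.eventually (gt_mem_nhds (by positivity : 0 < δ / 5)),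
      eventually_gt_atTop 0] with n hn1 hn0
    have hn : (0 : ℝ) < n := by exact_mod_cast hn0
    refine EReal.coe_le_coe_iff.2 ?_
    have h1 : joinEntropy T μ P n / n ≤ (Real.log s + 4 * (δ / 5)) + N * A / n := by
      rw [div_le_iff₀ hn, add_mul, div_mul_cancel₀ _ hn.ne']
      linarith [hjoin n]
    linarith
  refine EReal.le_of_forall_lt_iff_le.1 fun z hz => ?_
  have hz' : Real.log s < z := EReal.coe_lt_coe_iff.1 hz
  have := key (z - Real.log s) (by linarith)
  rwa [add_sub_cancel] at this

end Covering

/-! ### Entropy under embeddings and decompositions -/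

section Embedding

variable {Ω Ω' : Type*} [MeasurableSpace Ω] [MeasurableSpace Ω'] {T : Ω → Ω} {S : Ω' → Ω'}
  {φ : Ω → Ω'}

lemma partitionEntropy_map (hφ : MeasurableEmbedding φ) (hTS : ∀ x, φ (T x) = S (φ x))
    (μ : Measure Ω) {k : ℕ} (P : Ω' → Fin k) :
    partitionEntropy S (μ.map φ) P = partitionEntropy T μ (P ∘ φ) := by
  have hit : ∀ (i : ℕ) x, φ (T^[i] x) = S^[i] (φ x) := fun i x =>
    (Function.Semiconj.iterate_right hTS i) x
  have hj : ∀ n, joinEntropy S (μ.map φ) P n = joinEntropy T μ (P ∘ φ) n := by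
    intro n
    refine Finset.sum_congr rfl fun w _ => ?_
    congr 1
    rw [measureReal_def, measureReal_def, hφ.map_apply]
    congr 2
    ext x
    simp [hit]
  simp only [partitionEntropy, hj]

/-- An equivariant measurable embedding does not change the entropy of a measure. -/
lemma measureEntropy_map (hφ : MeasurableEmbedding φ) (hTS : ∀ x, φ (T x) = S (φ x))
    (μ : Measure Ω) [IsProbabilityMeasure μ] :
    measureEntropy S (μ.map φ) = measureEntropy T μ := by
  refine le_antisymm ?_ ?_
  · refine iSup_le fun k => iSup_le fun P => iSup_le fun hP => ?_
    rw [partitionEntropy_map hφ hTS]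
    exact le_iSup_of_le k (le_iSup_of_le (P ∘ φ) (le_iSup_of_le (hP.comp hφ.measurable) le_rfl))
  · refine iSup_le fun k => iSup_le fun P => iSup_le fun hP => ?_
    obtain ⟨x0⟩ : Nonempty Ω := nonempty_of_isProbabilityMeasure μ
    obtain ⟨P', hP', rfl⟩ := hφ.exists_measurable_extend hP fun _ => ⟨P x0⟩
    rw [← partitionEntropy_map hφ hTS]
    exact le_iSup_of_le k (le_iSup_of_le P' (le_iSup_of_le hP' le_rfl))

/-- A measure carried by the image of an equivariant embedding lifts. -/
lemma exists_lift (hφ : MeasurableEmbedding φ) (hTS : ∀ x, φ (T x) = S (φ x))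
    (hT : Measurable T) {ν : Measure Ω'} [IsProbabilityMeasure ν] (hS : MeasurePreserving S ν ν)
    (hν : ν (Set.range φ)ᶜ = 0) :
    ∃ μ : Measure Ω, IsProbabilityMeasure μ ∧ MeasurePreserving T μ μ ∧ μ.map φ = ν := by
  have hmap : (ν.comap φ).map φ = ν := by
    rw [hφ.map_comap]
    exact Measure.restrict_eq_self_of_ae_mem (by rwa [← mem_ae_iff] at hν)
  have hφS : φ ∘ T = S ∘ φ := funext hTS
  refine ⟨ν.comap φ, ?_, ⟨hT, ?_⟩, hmap⟩
  · constructor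
    have : (ν.comap φ).map φ Set.univ = 1 := by rw [hmap]; exact measure_univ
    rwa [hφ.map_apply, Set.preimage_univ] at this
  · have h1 : ((ν.comap φ).map T).map φ = (ν.comap φ).map φ := by
      rw [Measure.map_map hφ.measurable hT, hφS, ← Measure.map_map hS.measurable hφ.measurable,
        hmap, hS.map_eq]
    calc (ν.comap φ).map T = (((ν.comap φ).map T).map φ).comap φ := (hφ.comap_map _).symm
      _ = ((ν.comap φ).map φ).comap φ := by rw [h1]
      _ = ν.comap φ := hφ.comap_map _

end Embedding

section Decomposition

variable {Ω : Type*} [MeasurableSpace Ω] {T : Ω → Ω} {μ : Measure Ω}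

lemma negMulLog_add_le {x y : ℝ} (hx : 0 ≤ x) (hy : 0 ≤ y) :
    Real.negMulLog (x + y) ≤ Real.negMulLog x + Real.negMulLog y := by
  have h : ∀ {x y : ℝ}, 0 ≤ x → 0 ≤ y → x * Real.log x ≤ x * Real.log (x + y) := by
    intro x y hx hy
    rcases hx.eq_or_lt with rfl | hx
    · simp
    · exact mul_le_mul_of_nonneg_left (Real.log_le_log hx (by linarith)) hx.le
  have h1 := h hx hy
  have h2 := h hy hx
  rw [add_comm y x] at h2
  simp only [Real.negMulLog]
  linarith

lemma sum_names_eq_one [IsProbabilityMeasure μ] (hT : Measurable T) {k : ℕ} {P : Ω → Fin k}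
    (hP : Measurable P) (n : ℕ) :
    ∑ w : Fin n → Fin k, μ.real {x | ∀ i : Fin n, P (T^[(i : ℕ)] x) = w i} = 1 := by
  set Φ : Ω → (Fin n → Fin k) := fun x i => P (T^[i] x) with hΦ
  have hΦm : Measurable Φ := measurable_names hT hP n
  have : IsProbabilityMeasure (μ.map Φ) := Measure.isProbabilityMeasure_map hΦm.aemeasurable
  have hmap : ∀ w, μ.real {x | ∀ i : Fin n, P (T^[(i : ℕ)] x) = w i} = (μ.map Φ).real {w} := by
    intro w
    rw [map_measureReal_apply hΦm (measurableSet_singleton w)]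
    congr 1
    ext x
    simp [hΦ, funext_iff]
  simp only [hmap]
  rw [sum_measureReal_singleton]
  simp

/-- Entropy is concave up to a bounded error. -/
lemma joinEntropy_le_of_convex {μ₁ μ₂ : Measure Ω} [IsProbabilityMeasure μ₁]
    [IsProbabilityMeasure μ₂] {a b : ℝ} (ha : 0 ≤ a) (hb : 0 ≤ b)
    (hμ : ∀ B, MeasurableSet B → μ.real B = a * μ₁.real B + b * μ₂.real B)
    (hT : Measurable T) {k : ℕ} {P : Ω → Fin k} (hP : Measurable P) (n : ℕ) :
    joinEntropy T μ P n ≤ a * joinEntropy T μ₁ P n + b * joinEntropy T μ₂ P n +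
      (Real.negMulLog a + Real.negMulLog b) := by
  have hm : ∀ w : Fin n → Fin k, MeasurableSet {x | ∀ i : Fin n, P (T^[(i : ℕ)] x) = w i} := by
    intro w
    have : {x | ∀ i : Fin n, P (T^[(i : ℕ)] x) = w i} =
        (fun (x : Ω) (i : Fin n) => P (T^[i] x)) ⁻¹' {w} := by
      ext x; simp [funext_iff]
    rw [this]
    exact measurable_names hT hP n (measurableSet_singleton w)
  have h1 := sum_names_eq_one (μ := μ₁) hT hP n
  have h2 := sum_names_eq_one (μ := μ₂) hT hP n
  unfold joinEntropy
  calc _ ≤ ∑ w : Fin n → Fin k,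
        ((a * Real.negMulLog (μ₁.real {x | ∀ i : Fin n, P (T^[(i : ℕ)] x) = w i}) +
          b * Real.negMulLog (μ₂.real {x | ∀ i : Fin n, P (T^[(i : ℕ)] x) = w i})) +
        (μ₁.real {x | ∀ i : Fin n, P (T^[(i : ℕ)] x) = w i} * Real.negMulLog a +
          μ₂.real {x | ∀ i : Fin n, P (T^[(i : ℕ)] x) = w i} * Real.negMulLog b)) := by
        refine Finset.sum_le_sum fun w _ => ?_
        rw [hμ _ (hm w)]
        refine (negMulLog_add_le (by positivity) (by positivity)).trans ?_
        rw [Real.negMulLog_mul, Real.negMulLog_mul]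
        linarith
    _ = _ := by
        rw [Finset.sum_add_distrib, Finset.sum_add_distrib, Finset.sum_add_distrib,
          ← Finset.mul_sum, ← Finset.mul_sum, ← Finset.sum_mul, ← Finset.sum_mul, h1, h2, one_mul,
          one_mul]

/-- Entropy does not exceed the larger one of the two entropies for a convex combination of
invariant measures. -/
lemma measureEntropy_le_max {μ₁ μ₂ : Measure Ω} [IsProbabilityMeasure μ₁]
    [IsProbabilityMeasure μ₂] {a b : ℝ} (ha : 0 ≤ a) (hb : 0 ≤ b) (hab : a + b = 1)
    (hμ : ∀ B, MeasurableSet B → μ.real B = a * μ₁.real B + b * μ₂.real B)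
    (hT : Measurable T) :
    measureEntropy T μ ≤ max (measureEntropy T μ₁) (measureEntropy T μ₂) := by
  refine iSup_le fun k => iSup_le fun P => iSup_le fun hP => ?_
  have h1 : partitionEntropy T μ₁ P ≤ measureEntropy T μ₁ :=
    le_iSup_of_le k (le_iSup_of_le P (le_iSup_of_le hP le_rfl))
  have h2 : partitionEntropy T μ₂ P ≤ measureEntropy T μ₂ :=
    le_iSup_of_le k (le_iSup_of_le P (le_iSup_of_le hP le_rfl))
  refine le_trans ?_ (max_le_max h1 h2)
  refine EReal.le_of_forall_lt_iff_le.1 fun z hz => ?_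
  obtain ⟨c, hc1, hc2⟩ := EReal.lt_iff_exists_real_btwn.1 hz
  have hcz : c < z := EReal.coe_lt_coe_iff.1 hc2
  have e1 := eventually_lt_of_limsup_lt ((le_max_left _ _).trans_lt hc1)
  have e2 := eventually_lt_of_limsup_lt ((le_max_right _ _).trans_lt hc1)
  refine limsup_le_of_le (by isBoundedDefault) ?_
  have hlim : Tendsto (fun n : ℕ => (Real.negMulLog a + Real.negMulLog b) / (n : ℝ)) atTop (𝓝 0) :=
    tendsto_const_div_atTop_nhds_zero_nat _
  filter_upwards [e1, e2, hlim.eventually (gt_mem_nhds (sub_pos.2 hcz)), eventually_gt_atTop 0]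
    with n hn1 hn2 hn3 hn0
  have hn : (0 : ℝ) < n := by exact_mod_cast hn0
  have hn1' := EReal.coe_lt_coe_iff.1 hn1
  have hn2' := EReal.coe_lt_coe_iff.1 hn2
  refine EReal.coe_le_coe_iff.2 ?_
  have h3 := joinEntropy_le_of_convex ha hb hμ hT hP n
  calc joinEntropy T μ P n / n ≤ (a * joinEntropy T μ₁ P n + b * joinEntropy T μ₂ P n +
        (Real.negMulLog a + Real.negMulLog b)) / n := by gcongr
    _ = a * (joinEntropy T μ₁ P n / n) + b * (joinEntropy T μ₂ P n / n) +
        (Real.negMulLog a + Real.negMulLog b) / n := by ring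
    _ ≤ a * c + b * c + (z - c) := by gcongr
    _ = z := by rw [← add_mul, hab]; ring

/-- The entropy of an invariant measure is at most the larger one of the bounds for the invariant
measures carried by an invariant set and by its complement. -/
lemma measureEntropy_le_of_invariant [IsProbabilityMeasure μ] (hT : MeasurePreserving T μ μ)
    {B : Set Ω} (hB : MeasurableSet B) (hTB : T ⁻¹' B = B) {h : EReal}
    (h1 : ∀ ν : Measure Ω, IsProbabilityMeasure ν → MeasurePreserving T ν ν → ν Bᶜ = 0 →
      measureEntropy T ν ≤ h)
    (h2 : ∀ ν : Measure Ω, IsProbabilityMeasure ν → MeasurePreserving T ν ν → ν B = 0 →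
      measureEntropy T ν ≤ h) : measureEntropy T μ ≤ h := by
  by_cases hB0 : μ B = 0
  · exact h2 μ inferInstance hT hB0
  by_cases hB1 : μ Bᶜ = 0
  · exact h1 μ inferInstance hT hB1
  have hinv : ∀ C : Set Ω, MeasurableSet C → T ⁻¹' C = C →
      MeasurePreserving T (ProbabilityTheory.cond μ C) (ProbabilityTheory.cond μ C) := by
    intro C hC hTC
    have := hT.restrict_preimage hC
    rw [hTC] at this
    exact this.smul_measure _
  have p1 := ProbabilityTheory.cond_isProbabilityMeasure hB0
  have p2 := ProbabilityTheory.cond_isProbabilityMeasure hB1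
  have hcond : ∀ C : Set Ω, MeasurableSet C → μ C ≠ 0 → ∀ D, μ.real C *
      (ProbabilityTheory.cond μ C).real D = μ.real (C ∩ D) := by
    intro C hC hC0 D
    rw [measureReal_def (ProbabilityTheory.cond μ C), ProbabilityTheory.cond_apply hC,
      ENNReal.toReal_mul, ENNReal.toReal_inv, ← measureReal_def, ← measureReal_def, ← mul_assoc,
      mul_inv_cancel₀, one_mul]
    exact (ENNReal.toReal_pos hC0 (measure_ne_top _ _)).ne'
  refine (measureEntropy_le_max (μ₁ := ProbabilityTheory.cond μ B)
    (μ₂ := ProbabilityTheory.cond μ Bᶜ) (a := μ.real B) (b := μ.real Bᶜ) measureReal_nonneg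
    measureReal_nonneg ?_ (fun D hD => ?_) hT.measurable).trans (max_le ?_ ?_)
  · rw [measureReal_add_measureReal_compl hB]; simp
  · rw [hcond B hB hB0, hcond Bᶜ hB.compl hB1, Set.inter_comm B, Set.inter_comm Bᶜ,
      ← Set.sdiff_eq, measureReal_inter_add_sdiff hB]
  · refine h1 _ p1 (hinv B hB hTB) ?_
    rw [ProbabilityTheory.cond_apply hB]; simp
  · refine h2 _ p2 (hinv Bᶜ hB.compl (by rw [Set.preimage_compl, hTB])) ?_
    rw [ProbabilityTheory.cond_apply hB.compl]; simp

end Decomposition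

/-! ### Topology and measurability of loop shifts -/

section Topological

variable {f F : ℕ⟦X⟧}

instance (f : ℕ⟦X⟧) : TopologicalSpace (LoopEdge f) := ⊥

instance (f : ℕ⟦X⟧) : DiscreteTopology (LoopEdge f) := ⟨rfl⟩

/-- A loop edge is given by its length, its index and its position. -/
lemma loopEdge_injective (f : ℕ⟦X⟧) :
    Function.Injective fun e : LoopEdge f => ((⟨e.len, e.idx, e.pos⟩ :
      Σ n : ℕ, Fin (coeff n f) × Fin n)) := by
  rintro ⟨n, i, p⟩ ⟨n', i', p'⟩ h
  simp only [Sigma.mk.injEq] at h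
  obtain ⟨rfl, h⟩ := h
  obtain ⟨rfl, rfl⟩ := Prod.mk.inj (eq_of_heq h)
  rfl

instance (f : ℕ⟦X⟧) : Countable (LoopEdge f) := (loopEdge_injective f).countable

lemma isInducing_edges : IsInducing (edges : LoopShift f → ℤ → LoopEdge f) := ⟨rfl⟩

lemma edges_injective : Function.Injective (edges : LoopShift f → ℤ → LoopEdge f) :=
  Subtype.val_injective

lemma isClosedEmbedding_edges :
    IsClosedEmbedding (edges : LoopShift f → ℤ → LoopEdge f) := by
  refine ⟨⟨isInducing_edges, edges_injective⟩, ?_⟩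
  have : Set.range (edges : LoopShift f → ℤ → LoopEdge f) =
      ⋂ i : ℤ, {x | Step (x i) (x (i + 1))} := by
    ext x
    simp only [Set.mem_range, Set.mem_iInter, Set.mem_ofPred_eq]
    exact ⟨by rintro ⟨y, rfl⟩; exact step_edges y, fun h => ⟨⟨x, h⟩, rfl⟩⟩
  rw [this]
  refine isClosed_iInter fun i => ?_
  have hc : Continuous fun x : ℤ → LoopEdge f => (x i, x (i + 1)) := by fun_prop
  exact (isClosed_discrete {p : LoopEdge f × LoopEdge f | Step p.1 p.2}).preimage hc

instance (f : ℕ⟦X⟧) : PolishSpace (LoopEdge f) := inferInstance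

instance (f : ℕ⟦X⟧) : PolishSpace (LoopShift f) := isClosedEmbedding_edges.polishSpace

lemma continuous_edges_apply (i : ℤ) : Continuous fun x : LoopShift f => edges x i :=
  (continuous_apply i).comp isInducing_edges.continuous

lemma continuous_of_edges {Z : Type*} [TopologicalSpace Z] {φ : Z → LoopShift f}
    (h : ∀ i, Continuous fun z => edges (φ z) i) : Continuous φ :=
  isInducing_edges.continuous_iff.2 (continuous_pi h)

lemma edges_sigma (x : LoopShift f) (i : ℤ) : edges (sigma f x) i = edges x (i + 1) := rfl

lemma continuous_sigma (f : ℕ⟦X⟧) : Continuous (sigma f) :=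
  continuous_of_edges fun i => continuous_edges_apply (i + 1)

/-- The inverse of the shift. -/
def unshift (f : ℕ⟦X⟧) (x : LoopShift f) : LoopShift f :=
  ⟨fun i => edges x (i - 1), fun i => by
    have := step_edges x (i - 1)
    rw [sub_add_cancel] at this
    change Step (edges x (i - 1)) (edges x (i + 1 - 1))
    rwa [add_sub_cancel_right]⟩

lemma edges_unshift (x : LoopShift f) (i : ℤ) : edges (unshift f x) i = edges x (i - 1) := rfl

lemma unshift_sigma (x : LoopShift f) : unshift f (sigma f x) = x :=
  edges_injective (funext fun i => by rw [edges_unshift, edges_sigma, sub_add_cancel])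

lemma sigma_unshift (x : LoopShift f) : sigma f (unshift f x) = x :=
  edges_injective (funext fun i => by rw [edges_sigma, edges_unshift, add_sub_cancel_right])

lemma continuous_unshift (f : ℕ⟦X⟧) : Continuous (unshift f) :=
  continuous_of_edges fun i => continuous_edges_apply (i - 1)

lemma measurePreserving_unshift {ν : Measure (LoopShift f)}
    (hν : MeasurePreserving (sigma f) ν ν) : MeasurePreserving (unshift f) ν ν := by
  refine ⟨(continuous_unshift f).measurable, ?_⟩
  conv_lhs => rw [← hν.map_eq]
  rw [Measure.map_map (continuous_unshift f).measurable hν.measurable,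
    show unshift f ∘ sigma f = id from funext unshift_sigma, Measure.map_id]

lemma edges_sigma_iterate (x : LoopShift f) (n : ℕ) (i : ℤ) :
    edges ((sigma f)^[n] x) i = edges x (i + n) := by
  induction n generalizing x with
  | zero => simp
  | succ n ih => rw [Function.iterate_succ_apply, ih, edges_sigma]; congr 1; push_cast; ring

lemma edges_unshift_iterate (x : LoopShift f) (n : ℕ) (i : ℤ) :
    edges ((unshift f)^[n] x) i = edges x (i - n) := by
  induction n generalizing x with
  | zero => simp
  | succ n ih => rw [Function.iterate_succ_apply, ih, edges_unshift]; congr 1; push_cast; ring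

/-- Sets that depend on finitely many coordinates are open. -/
lemma isOpen_of_coords {t : Set (LoopShift f)} (s : Finset ℤ)
    (h : ∀ x ∈ t, ∀ x', (∀ i ∈ s, edges x' i = edges x i) → x' ∈ t) : IsOpen t := by
  rw [isOpen_iff_forall_mem_open]
  intro x hx
  refine ⟨⋂ i ∈ s, (fun x' => edges x' i) ⁻¹' {edges x i}, fun x' hx' => h x hx x' ?_, ?_, ?_⟩
  · simpa using hx'
  · exact isOpen_biInter_finset fun i _ => (isOpen_discrete _).preimage (continuous_edges_apply i)
  · simp

lemma word_congr_coords {x x' : LoopShift f} {i : ℤ} {n : ℕ}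
    (h : ∀ j ∈ Finset.Ico i (i + n), edges x' j = edges x j) :
    word (edges x') i n = word (edges x) i n :=
  word_congr fun t ht => h _ (by simp; omega)

lemma measurableSet_mem_mark (g : ℕ → List (LoopEdge f)) (k : ℕ) (i : ℤ) :
    MeasurableSet {x : LoopShift f | i ∈ mark (baseTimes x) g (edges x) k} := by
  induction k generalizing i with
  | zero =>
    refine (isOpen_of_coords {i} fun x hx x' hx' => ?_).measurableSet
    change ((edges x' i).pos : ℕ) = 0
    rw [hx' i (by simp)]
    exact hx
  | succ k ih =>
    have h1 : MeasurableSet {x : LoopShift f | word (edges x) i (g k).length = g k} :=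
      (isOpen_of_coords (Finset.Ico i (i + (g k).length)) fun x hx x' hx' =>
        (word_congr_coords hx').trans hx).measurableSet
    exact (ih i).inter (h1.inter (ih _)).compl

lemma measurableSet_mem_markers (g : ℕ → List (LoopEdge f)) (i : ℤ) :
    MeasurableSet {x : LoopShift f | i ∈ markers g x} := by
  have : {x : LoopShift f | i ∈ markers g x} =
      ⋂ k, {x | i ∈ mark (baseTimes x) g (edges x) k} := by
    ext x
    simp [markers, markInf]
  rw [this]
  exact MeasurableSet.iInter fun k => measurableSet_mem_mark g k i

/-- Markers are translated together with the walk. -/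
lemma mem_markers_of_translate {g : ℕ → List (LoopEdge f)} {x x' : LoopShift f} {c : ℤ}
    (h : ∀ i, edges x' i = edges x (i + c)) (i : ℤ) : i ∈ markers g x' ↔ i + c ∈ markers g x := by
  have hw : ∀ i n, word (edges x') i n = word (edges x) (i + c) n := fun i n =>
    word_congr fun t _ => by rw [h]; congr 1; ring
  have key : ∀ k i, i ∈ mark (baseTimes x') g (edges x') k ↔
      i + c ∈ mark (baseTimes x) g (edges x) k := by
    intro k
    induction k with
    | zero =>
      intro i
      change ((edges x' i).pos : ℕ) = 0 ↔ ((edges x (i + c)).pos : ℕ) = 0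
      rw [h]
    | succ k ih =>
      intro i
      simp only [mark, Set.mem_ofPred_eq, ih, hw]
      rw [add_right_comm]
  simp only [markers, markInf, Set.mem_iInter, key]

/-- Almost surely, the undeleted markers form a set which is empty or unbounded on both sides. -/
lemma ae_markers_unbounded (g : ℕ → List (LoopEdge f)) {ν : Measure (LoopShift f)}
    [IsProbabilityMeasure ν] (hν : MeasurePreserving (sigma f) ν ν) :
    ∀ᵐ x ∂ν, ∀ i ∈ markers g x, (∀ a, ∃ j ∈ markers g x, a < j) ∧
      ∀ a, ∃ j ∈ markers g x, j ≤ a := by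
  rw [ae_all_iff]
  intro i
  have h1 := hν.conservative.ae_mem_imp_frequently_image_mem
    (measurableSet_mem_markers g i).nullMeasurableSet
  have h2 := (measurePreserving_unshift hν).conservative.ae_mem_imp_frequently_image_mem
    (measurableSet_mem_markers g i).nullMeasurableSet
  filter_upwards [h1, h2] with x h3 h4 hi
  refine ⟨fun a => ?_, fun a => ?_⟩
  · obtain ⟨n, hn, hn'⟩ := (frequently_atTop.1 (h3 hi)) ((a - i).toNat + 1)
    refine ⟨i + n, (mem_markers_of_translate (edges_sigma_iterate x n) i).1 hn', by omega⟩
  · obtain ⟨n, hn, hn'⟩ := (frequently_atTop.1 (h4 hi)) (i - a).toNat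
    refine ⟨i + -n, (mem_markers_of_translate (fun j => ?_) i).1 hn', by omega⟩
    rw [edges_unshift_iterate, sub_eq_add_neg]

end Topological

section CodeMeasurable

variable {f F : ℕ⟦X⟧} {g : ℕ → List (LoopEdge f)}
  (e : ∀ m, Fin (coeff m F) ≃ {w // w ∈ Prim (stageInf (closedWalks f) g) ∧ w.length = m})

lemma loopCode_sigma (x : LoopShift F) : loopCode e (sigma F x) = sigma f (loopCode e x) :=
  edges_injective (funext fun _ => rfl)

lemma measurableEmbedding_loopCode (hg : ∀ k, g k ∈ Prim (stage (closedWalks f) g k)) :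
    MeasurableEmbedding (loopCode e) := by
  have hc : Continuous (loopCode e) := continuous_of_edges fun i =>
    (continuous_of_discreteTopology (f := code e)).comp (continuous_edges_apply i)
  exact hc.measurableEmbedding (loopCode_injective e hg)

lemma sigma_preimage_range : sigma f ⁻¹' Set.range (loopCode e) = Set.range (loopCode e) := by
  ext y
  constructor
  · rintro ⟨x, hx⟩
    refine ⟨unshift F x, ?_⟩
    have h : sigma f (loopCode e (unshift F x)) = sigma f y := by
      rw [← loopCode_sigma, sigma_unshift, hx]
    rw [← unshift_sigma (loopCode e (unshift F x)), h, unshift_sigma]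
  · rintro ⟨x, rfl⟩
    exact ⟨sigma F x, loopCode_sigma e x⟩

lemma ae_markers_eq_empty (hg : ∀ k, g k ∈ Prim (stage (closedWalks f) g k))
    {ν : Measure (LoopShift f)} [IsProbabilityMeasure ν] (hν : MeasurePreserving (sigma f) ν ν)
    (h0 : ν (Set.range (loopCode e)) = 0) : ∀ᵐ x ∂ν, markers g x = ∅ := by
  filter_upwards [ae_markers_unbounded g hν, measure_eq_zero_iff_ae_notMem.1 h0] with x h1 h2
  by_contra hne
  obtain ⟨i, hi⟩ := Set.nonempty_iff_ne_empty.2 hne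
  exact h2 (mem_range_loopCode e hg x (h1 i hi).1 (h1 i hi).2)

end CodeMeasurable

/-! ### The entropy of the walks that are missed by the code -/

section ChainCount

variable {α : Type*} {g : ℕ → List α} {r : ℕ → ℕ}

lemma chainWords_zero (j : ℕ) : {w | IsChainWord g 0 w ∧ w.length = j} ⊆ {[]} := by
  rintro w ⟨hw, -⟩
  generalize hK : 0 = K at hw
  cases hw with
  | nil => rfl
  | mono h => omega
  | append h => omega

lemma chainWords_succ (hgr : ∀ k, (g k).length = r k) (K j : ℕ) :
    {w | IsChainWord g (K + 1) w ∧ w.length = j} ⊆ {w | IsChainWord g K w ∧ w.length = j} ∪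
      (if r K ≤ j then (fun w => w ++ g K) '' {w | IsChainWord g (K + 1) w ∧
        w.length = j - r K} else ∅) := by
  rintro w ⟨hw, hl⟩
  cases hw with
  | mono h => exact Or.inl ⟨h, hl⟩
  | append h =>
    rw [List.length_append, hgr] at hl
    right
    rw [if_pos (by omega)]
    exact ⟨_, ⟨h, by omega⟩, rfl⟩

lemma finite_chainWords (hr0 : ∀ k, 0 < r k) (hgr : ∀ k, (g k).length = r k) (K j : ℕ) :
    {w | IsChainWord g K w ∧ w.length = j}.Finite := by
  induction K generalizing j with
  | zero => exact (Set.finite_singleton _).subset (chainWords_zero j)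
  | succ K ih =>
    induction j using Nat.strong_induction_on with
    | _ j ihj =>
      refine ((ih j).union ?_).subset (chainWords_succ hgr K j)
      have := hr0 K
      split_ifs with h
      · exact (ihj _ (by omega)).image _
      · exact Set.finite_empty

lemma ncard_chainWords_le {s : ℝ} (hs : 1 < s) (hr0 : ∀ k, 0 < r k)
    (hgr : ∀ k, (g k).length = r k) (K j : ℕ) :
    ({w | IsChainWord g K w ∧ w.length = j}.ncard : ℝ) ≤ prodVal r s K * s ^ j := by
  have hfin := finite_chainWords hr0 hgr
  induction K generalizing j with
  | zero =>
    have h1 := Set.ncard_le_ncard (chainWords_zero (g := g) j) (Set.finite_singleton _)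
    rw [Set.ncard_singleton] at h1
    have h2 : (1 : ℝ) ≤ s ^ j := one_le_pow₀ hs.le
    simp only [prodVal, Finset.range_zero, Finset.prod_empty, one_mul]
    exact (by exact_mod_cast h1 : (_ : ℝ) ≤ 1).trans h2
  | succ K ih =>
    rw [prodVal_succ]
    refine le_of_geom_recursion (a := fun j => ({w | IsChainWord g K w ∧ w.length = j}.ncard : ℝ))
      (b := fun j => ({w | IsChainWord g (K + 1) w ∧ w.length = j}.ncard : ℝ)) hs (hr0 K)
      (prodVal_nonneg hs hr0 K) ih (fun j => ?_) j
    have hfin2 : (if r K ≤ j then (fun w => w ++ g K) '' {w | IsChainWord g (K + 1) w ∧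
        w.length = j - r K} else ∅).Finite := by
      split_ifs
      · exact (hfin _ _).image _
      · exact Set.finite_empty
    have h1 := (Set.ncard_le_ncard (chainWords_succ hgr K j) ((hfin K j).union hfin2)).trans
      (Set.ncard_union_le _ _)
    have h2 : (if r K ≤ j then (fun w => w ++ g K) '' {w | IsChainWord g (K + 1) w ∧
        w.length = j - r K} else ∅).ncard ≤
        if r K ≤ j then {w | IsChainWord g (K + 1) w ∧ w.length = j - r K}.ncard else 0 := by
      split_ifs
      · exact Set.ncard_image_le (hfin _ _)
      · simp
    exact_mod_cast h1.trans (Nat.add_le_add_left h2 _)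

/-- The words `g k₁ ++ ⋯ ++ g kₜ` with `k₁ ≤ ⋯ ≤ kₜ` grow at a rate at most `s`. -/
lemma chainWords_bound {s C : ℝ} (hs : 1 < s) (hr : Monotone r) (hr0 : ∀ k, 0 < r k)
    (hlim : Tendsto r atTop atTop) (hgr : ∀ k, (g k).length = r k)
    (hC : ∀ k, prodVal r s k ≤ C) (j : ℕ) :
    {w | (∃ K, IsChainWord g K w) ∧ w.length = j}.Finite ∧
      ({w | (∃ K, IsChainWord g K w) ∧ w.length = j}.ncard : ℝ) ≤ C * s ^ j := by
  obtain ⟨K, hK⟩ := (hlim.eventually_gt_atTop j).exists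
  have hred : ∀ k (w : List α), IsChainWord g k w → w.length ≤ j → IsChainWord g K w := by
    intro k w hw
    induction hw with
    | nil => exact fun _ => isChainWord_of_le (Nat.zero_le K) IsChainWord.nil
    | mono _ ih => exact ih
    | @append k w hw ih =>
      intro hl
      rw [List.length_append, hgr] at hl
      have hkK : k < K := by
        by_contra! hc
        have := hr hc
        omega
      exact isChainWord_of_le (k := K) (K := k + 1) hkK hw.append
  have heq : {w | (∃ K, IsChainWord g K w) ∧ w.length = j} =
      {w | IsChainWord g K w ∧ w.length = j} := by
    ext w
    exact ⟨fun ⟨⟨k, hk⟩, hl⟩ => ⟨hred k w hk hl.le, hl⟩, fun ⟨h, hl⟩ => ⟨⟨K, h⟩, hl⟩⟩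
  rw [heq]
  refine ⟨finite_chainWords hr0 hgr K j, (ncard_chainWords_le hs hr0 hgr K j).trans ?_⟩
  gcongr
  exact hC K

/-- The same bound for the words of length at most `m`. -/
lemma chainWords_le_bound {s C : ℝ} (hs : 1 < s) (hr : Monotone r) (hr0 : ∀ k, 0 < r k)
    (hlim : Tendsto r atTop atTop) (hgr : ∀ k, (g k).length = r k) (hC0 : 0 ≤ C)
    (hC : ∀ k, prodVal r s k ≤ C) (m : ℕ) :
    {w | (∃ K, IsChainWord g K w) ∧ w.length ≤ m}.Finite ∧
      ({w | (∃ K, IsChainWord g K w) ∧ w.length ≤ m}.ncard : ℝ) ≤ C * (s / (s - 1)) * s ^ m := by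
  have hs1 : 0 < s - 1 := by linarith
  induction m with
  | zero =>
    obtain ⟨h1, h2⟩ := chainWords_bound hs hr hr0 hlim hgr hC 0
    simp only [Nat.le_zero]
    refine ⟨h1, h2.trans ?_⟩
    have : 1 ≤ s / (s - 1) := by rw [le_div_iff₀ hs1]; linarith
    gcongr
    exact le_mul_of_one_le_right hC0 this
  | succ m ih =>
    obtain ⟨h1, h2⟩ := chainWords_bound hs hr hr0 hlim hgr hC (m + 1)
    have heq : {w | (∃ K, IsChainWord g K w) ∧ w.length ≤ m + 1} =
        {w | (∃ K, IsChainWord g K w) ∧ w.length ≤ m} ∪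
          {w | (∃ K, IsChainWord g K w) ∧ w.length = m + 1} := by
      ext w
      simp only [Set.mem_ofPred_eq, Set.mem_union, ← and_or_left]
      rw [show w.length ≤ m + 1 ↔ w.length ≤ m ∨ w.length = m + 1 by omega]
    rw [heq]
    refine ⟨ih.1.union h1, ?_⟩
    have h3 : ((({w | (∃ K, IsChainWord g K w) ∧ w.length ≤ m} ∪
        {w | (∃ K, IsChainWord g K w) ∧ w.length = m + 1}).ncard : ℕ) : ℝ) ≤ _ :=
      Nat.cast_le.2 (Set.ncard_union_le _ _)
    rw [Nat.cast_add] at h3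
    refine h3.trans ((add_le_add ih.2 h2).trans (le_of_eq ?_))
    field_simp
    ring

end ChainCount

section Windows

variable {f : ℕ⟦X⟧}

/-- The edges of the loops of length at most `a`, with one symbol for all the others. -/
abbrev Truncated (f : ℕ⟦X⟧) (a : ℕ) : Type := Option {e : LoopEdge f // e.len ≤ a}

instance (f : ℕ⟦X⟧) (a : ℕ) : Finite {e : LoopEdge f // e.len ≤ a} := by
  let ψ : {e : LoopEdge f // e.len ≤ a} →
      Σ n : Fin (a + 1), Fin (coeff (n : ℕ) f) × Fin n :=
    fun e => ⟨⟨e.1.len, Nat.lt_succ_of_le e.2⟩, e.1.idx, e.1.pos⟩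
  refine Finite.of_injective ψ ?_
  rintro ⟨⟨n, i, p⟩, h⟩ ⟨⟨n', i', p'⟩, h'⟩ he
  simp only [ψ, Sigma.mk.injEq, Fin.mk.injEq] at he
  obtain ⟨rfl, he⟩ := he
  obtain ⟨rfl, rfl⟩ := Prod.mk.inj (eq_of_heq he)
  rfl

open Classical in
/-- The truncation of the alphabet. -/
def trunc (a : ℕ) (e : LoopEdge f) : Truncated f a := if h : e.len ≤ a then some ⟨e, h⟩ else none

lemma trunc_eq_iff {a : ℕ} {e e' : LoopEdge f} :
    trunc a e = trunc a e' ↔ e = e' ∨ a < e.len ∧ a < e'.len := by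
  unfold trunc
  by_cases h : e.len ≤ a
  · by_cases h' : e'.len ≤ a
    · rw [dif_pos h, dif_pos h']
      simp only [Option.some.injEq, Subtype.mk.injEq]
      constructor
      · exact Or.inl
      · rintro (h1 | h1)
        · exact h1
        · omega
    · rw [dif_pos h, dif_neg h']
      simp only [reduceCtorEq, false_iff, not_or]
      exact ⟨by rintro rfl; exact h' h, by omega⟩
  · by_cases h' : e'.len ≤ a
    · rw [dif_neg h, dif_pos h']
      simp only [reduceCtorEq, false_iff, not_or]
      exact ⟨by rintro rfl; exact h h', by omega⟩
    · rw [dif_neg h, dif_neg h']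
      simp only [true_iff]
      right
      omega

/-- The walks look the same on `[-a, a]` after truncation. -/
def SameWindow (a : ℕ) (x x' : LoopShift f) : Prop :=
  ∀ i ∈ Finset.Icc (-(a : ℤ)) a, trunc a (edges x' i) = trunc a (edges x i)

lemma SameWindow.mono {a b : ℕ} (hab : a ≤ b) {x x' : LoopShift f} (h : SameWindow b x x') :
    SameWindow a x x' := by
  intro i hi
  rw [Finset.mem_Icc] at hi
  rcases trunc_eq_iff.1 (h i (Finset.mem_Icc.2 (by omega))) with h1 | h1
  · rw [h1]
  · exact trunc_eq_iff.2 (Or.inr (by omega))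

/-- The algebra of the sets which are given by a finite window of truncated coordinates. -/
def windowAlgebra (f : ℕ⟦X⟧) : Set (Set (LoopShift f)) :=
  {t | ∃ a, ∀ x x', SameWindow a x x' → (x ∈ t ↔ x' ∈ t)}

lemma isSetAlgebra_windowAlgebra (f : ℕ⟦X⟧) : IsSetAlgebra (windowAlgebra f) where
  empty_mem := ⟨0, fun _ _ _ => Iff.rfl⟩
  compl_mem := by
    rintro t ⟨a, ha⟩
    exact ⟨a, fun x x' h => not_congr (ha x x' h)⟩
  union_mem := by
    rintro t t' ⟨a, ha⟩ ⟨b, hb⟩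
    exact ⟨max a b, fun x x' h => or_congr (ha x x' (h.mono (le_max_left _ _)))
      (hb x x' (h.mono (le_max_right _ _)))⟩

lemma isOpen_of_window {t : Set (LoopShift f)} {a : ℕ}
    (h : ∀ x x', SameWindow a x x' → (x ∈ t ↔ x' ∈ t)) : IsOpen t :=
  isOpen_of_coords (Finset.Icc (-(a : ℤ)) a) fun x hx x' hx' =>
    (h x x' fun i hi => by rw [hx' i hi]).1 hx

lemma borel_eq_generateFrom (f : ℕ⟦X⟧) :
    (inferInstance : MeasurableSpace (LoopShift f)) =
      MeasurableSpace.generateFrom (windowAlgebra f) := by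
  refine le_antisymm ?_ (MeasurableSpace.generateFrom_le fun t ⟨a, ha⟩ =>
    (isOpen_of_window ha).measurableSet)
  let _ : MeasurableSpace (LoopEdge f) := borel _
  have : BorelSpace (LoopEdge f) := ⟨rfl⟩
  have h1 : (inferInstance : MeasurableSpace (LoopShift f)) =
      MeasurableSpace.comap edges (inferInstance : MeasurableSpace (ℤ → LoopEdge f)) :=
    (borel_comap (f := (edges : LoopShift f → ℤ → LoopEdge f))).trans
      (congrArg _ (BorelSpace.measurable_eq (α := ℤ → LoopEdge f)).symm)
  rw [h1, ← measurable_iff_comap_le]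
  let _ : MeasurableSpace (LoopShift f) := MeasurableSpace.generateFrom (windowAlgebra f)
  refine measurable_pi_lambda _ fun i => measurable_to_countable' fun e => ?_
  refine MeasurableSpace.measurableSet_generateFrom ⟨max i.natAbs e.len, fun x x' h => ?_⟩
  have h2 := h i (Finset.mem_Icc.2 (by omega))
  simp only [Set.mem_preimage, Set.mem_singleton_iff]
  rcases trunc_eq_iff.1 h2 with h3 | h3
  · rw [h3]
  · constructor
    · rintro rfl; omega
    · rintro rfl; omega

open Classical in
/-- Every finite partition is approximated by partitions given by finite windows. -/
lemma exists_window_partition {ν : Measure (LoopShift f)} [IsProbabilityMeasure ν] {k : ℕ}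
    {P : LoopShift f → Fin k} (hP : Measurable P) {ε : ℝ} (hε : 0 < ε) :
    ∃ (P' : LoopShift f → Fin k) (a : ℕ), Measurable P' ∧ ν.real {x | P x ≠ P' x} ≤ ε ∧
      ∀ x x', SameWindow a x x' → P' x = P' x' := by
  obtain ⟨x0⟩ : Nonempty (LoopShift f) := nonempty_of_isProbabilityMeasure ν
  have hk : 0 < k := (P x0).pos
  have : Nonempty (Fin k) := ⟨P x0⟩
  have hk' : (0 : ℝ) < k := by exact_mod_cast hk
  -- The window sets form an algebra which generates the Borel sets, so they are dense in measure.
  have hd := Measure.MeasureDense.of_generateFrom_isSetAlgebra_finite (μ := ν)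
    (isSetAlgebra_windowAlgebra f) (borel_eq_generateFrom f)
  have happ : ∀ j : Fin k, ∃ t ∈ windowAlgebra f,
      ν (symmDiff (P ⁻¹' {j}) t) < ENNReal.ofReal (ε / k) := fun j =>
    hd.approx _ (hP (measurableSet_singleton j)) (measure_ne_top _ _) _ (by positivity)
  choose t ht htε using happ
  choose a ha using ht
  set b := Finset.univ.sup a with hb
  have hb' : ∀ x x', SameWindow b x x' → ∀ j, (x ∈ t j ↔ x' ∈ t j) := fun x x' h j =>
    ha j x x' (h.mono (Finset.le_sup (Finset.mem_univ j)))
  -- The piece of `x` is a `j` with `x ∈ t j`; where there is none, its value does not matter, as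
  -- such points are in one of the symmetric differences.
  set P' : LoopShift f → Fin k := fun x => Classical.epsilon fun j => x ∈ t j with hP'
  have hw : ∀ x x', SameWindow b x x' → P' x = P' x' := by
    intro x x' h
    have : (fun j => x ∈ t j) = fun j => x' ∈ t j := funext fun j => propext (hb' x x' h j)
    simp only [hP', this]
  refine ⟨P', b, ?_, ?_, hw⟩
  · refine measurable_to_countable' fun j =>
      (isOpen_of_window (a := b) fun x x' h => ?_).measurableSet
    simp only [Set.mem_preimage, Set.mem_singleton_iff, hw x x' h]
  · have hsub : {x | P x ≠ P' x} ⊆ ⋃ j ∈ (Finset.univ : Finset (Fin k)),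
        symmDiff (P ⁻¹' {j}) (t j) := by
      intro x hx
      by_contra hc
      simp only [Finset.mem_univ, Set.iUnion_true, Set.mem_iUnion, not_exists,
        Set.mem_symmDiff, not_or, not_and, not_not, Set.mem_preimage, Set.mem_singleton_iff] at hc
      have h1 : x ∈ t (P x) := (hc (P x)).1 rfl
      have h2 : x ∈ t (P' x) := Classical.epsilon_spec (p := fun j => x ∈ t j) ⟨P x, h1⟩
      exact hx ((hc (P' x)).2 h2)
    calc ν.real {x | P x ≠ P' x} ≤ ν.real (⋃ j ∈ (Finset.univ : Finset (Fin k)),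
          symmDiff (P ⁻¹' {j}) (t j)) := measureReal_mono hsub (measure_ne_top _ _)
      _ ≤ ∑ j, ν.real (symmDiff (P ⁻¹' {j}) (t j)) := measureReal_biUnion_finset_le _ _
      _ ≤ ∑ _j : Fin k, ε / k := Finset.sum_le_sum fun j _ =>
          ENNReal.toReal_le_of_le_ofReal (by positivity) (htε j).le
      _ = ε := by simp; field_simp

end Windows

section MissedWalks

variable {f F : ℕ⟦X⟧} {g : ℕ → List (LoopEdge f)} {r : ℕ → ℕ}

/-- The number of steps to the next base time. -/
def tailLen (e : LoopEdge f) : ℕ := if (e.pos : ℕ) = 0 then 0 else e.len - e.pos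

lemma tailLen_mem_baseTimes (x : LoopShift f) : (tailLen (edges x 0) : ℤ) ∈ baseTimes x := by
  unfold tailLen
  split_ifs with h
  · exact h
  · have := exists_baseTimes_ge x 0
    rwa [zero_add] at this

lemma idx_val_eq {e e' : LoopEdge f} (h : e = e') : (e.idx : ℕ) = e'.idx := by rw [h]

lemma pos_val_eq {e e' : LoopEdge f} (h : e = e') : (e.pos : ℕ) = e'.pos := by rw [h]

/-- Up to the next base time, the truncated walk is determined by its first symbol. -/
lemma trunc_eq_of_lt_tailLen {a : ℕ} {x x' : LoopShift f}
    (h : trunc a (edges x' 0) = trunc a (edges x 0)) {i : ℕ} (hi : i < tailLen (edges x 0))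
    (hi' : i < tailLen (edges x' 0)) : trunc a (edges x' i) = trunc a (edges x i) := by
  have key : ∀ {x : LoopShift f}, i < tailLen (edges x 0) → ∃ hp,
      edges x i = ⟨(edges x 0).len, (edges x 0).idx, ⟨(edges x 0).pos + i, hp⟩⟩ := by
    intro x hi
    unfold tailLen at hi
    split_ifs at hi with h0
    · omega
    · obtain ⟨h1, h2⟩ := edges_sub_pos x 0 0 (edges x 0).pos (by simp)
      have hb : (0 : ℤ) - (edges x 0).pos ∈ baseTimes x := (sub_pos_mem_baseTimes x 0).1
      have hlt : ((edges x 0).pos : ℕ) + i < (edges x (0 - (edges x 0).pos)).len := by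
        rw [h2]; simp only; omega
      have h3 := edges_add x hb _ hlt
      have h4 : (0 : ℤ) - (edges x 0).pos + (((edges x 0).pos + i : ℕ) : ℤ) = i := by
        push_cast; ring
      rw [h4] at h3
      refine ⟨by omega, h3.trans (LoopEdge.ext' ?_ ?_ rfl)⟩
      · simp only [h2]
      · exact (idx_val_eq h2 :)
  obtain ⟨hp, h1⟩ := key hi
  obtain ⟨hp', h1'⟩ := key hi'
  rcases trunc_eq_iff.1 h with h2 | h2
  · rw [h1, h1']
    congr 1
    exact LoopEdge.ext' (by simp only [h2]) (idx_val_eq h2 :) (congrArg (· + i) (pos_val_eq h2))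
  · exact trunc_eq_iff.2 (Or.inr ⟨by rw [h1']; exact h2.1, by rw [h1]; exact h2.2⟩)

/-- The walks that start with the end of a loop, followed by a word `g k₁ ++ ⋯ ++ g kₜ` with
`k₁ ≤ ⋯ ≤ kₜ`, of total length `m`. -/
def chainStart (g : ℕ → List (LoopEdge f)) (m : ℕ) : Set (LoopShift f) :=
  {x | tailLen (edges x 0) ≤ m ∧ ∃ K, IsChainWord g K
    (word (edges x) (tailLen (edges x 0)) (m - tailLen (edges x 0)))}

lemma measurableSet_chainStart (g : ℕ → List (LoopEdge f)) (m : ℕ) :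
    MeasurableSet (chainStart g m) := by
  refine (isOpen_of_coords (Finset.Icc 0 (m : ℤ)) fun x hx x' hx' => ?_).measurableSet
  have h0 : edges x' 0 = edges x 0 := hx' 0 (by simp)
  obtain ⟨h1, K, h2⟩ := hx
  refine ⟨by rwa [h0], K, ?_⟩
  rw [h0, word_congr_coords (x := x)]
  · exact h2
  · intro j hj
    rw [Finset.mem_Ico] at hj
    exact hx' j (Finset.mem_Icc.2 (by omega))

lemma exists_mem_chainStart (hg0 : ∀ k, g k ≠ []) {x : LoopShift f} (hx : markers g x = ∅)
    (M : ℕ) : ∃ m, M ≤ m ∧ x ∈ chainStart g m := by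
  obtain ⟨n, K, h1, h2⟩ := exists_chain hg0 hx (tailLen_mem_baseTimes x) M
  exact ⟨tailLen (edges x 0) + n, by omega, by omega, K, by rwa [Nat.add_sub_cancel_left]⟩

lemma ncard_image_le_of_factors {α β γ : Type*} {G : Set α} {n : α → β} {D : α → γ} {S : Set γ}
    (h : ∀ x ∈ G, ∀ x' ∈ G, D x = D x' → n x = n x') (hS : S.Finite) (hD : ∀ x ∈ G, D x ∈ S) :
    (n '' G).ncard ≤ S.ncard := by
  rcases G.eq_empty_or_nonempty with rfl | ⟨x0, hx0⟩
  · simp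
  have : Nonempty α := ⟨x0⟩
  have hm : ∀ y ∈ n '' G, Function.invFunOn n G y ∈ G := fun y hy => Function.invFunOn_mem hy
  have he : ∀ y ∈ n '' G, n (Function.invFunOn n G y) = y := fun y hy => Function.invFunOn_eq hy
  refine Set.ncard_le_ncard_of_injOn (fun y => D (Function.invFunOn n G y))
    (fun y hy => hD _ (hm y hy)) (fun y hy y' hy' hyy => ?_) hS
  rw [← he y hy, ← he y' hy']
  exact h _ (hm y hy) _ (hm y' hy') hyy

lemma eq_of_word_eq {α : Type*} {y y' : ℤ → α} {i : ℤ} {n : ℕ} (h : word y i n = word y' i n)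
    {j : ℤ} (h1 : i ≤ j) (h2 : j < i + n) : y j = y' j := by
  have h3 : (j - i).toNat < n := by omega
  have := List.getElem_of_eq h (i := (j - i).toNat) (by simpa)
  rw [getElem_word, getElem_word] at this
  rwa [show i + ((j - i).toNat : ℤ) = j by omega] at this

/-- The number of the words which a window partition reads from the walks in `chainStart g m`
grows at a rate at most `s`. -/
lemma exists_ncard_names_le {s C : ℝ} (hs : 1 < s) (hr : Monotone r) (hr0 : ∀ k, 0 < r k)
    (hlim : Tendsto r atTop atTop) (hgr : ∀ k, (g k).length = r k) (hC0 : 0 ≤ C)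
    (hC : ∀ k, prodVal r s k ≤ C) {k a : ℕ} {P : LoopShift f → Fin k}
    (hP : ∀ x x', SameWindow a x x' → P x = P x') :
    ∃ K : ℝ, ∀ m, ((name (sigma f) P m '' chainStart g m).ncard : ℝ) ≤ K * s ^ m := by
  set L : Set (List (Truncated f a)) := {u | u.length = a} with hL
  have hLfin : L.Finite := List.finite_length_eq _ a
  set U : Set (List (Truncated f a) × Truncated f a × List (Truncated f a)) :=
    L ×ˢ (Set.univ ×ˢ L) with hU
  have hUfin : U.Finite := hLfin.prod (Set.finite_univ.prod hLfin)
  refine ⟨U.ncard * (C * (s / (s - 1))), fun m => ?_⟩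
  obtain ⟨hfin, hcard⟩ := chainWords_le_bound (g := g) hs hr hr0 hlim hgr hC0 hC m
  set V : Set (List (LoopEdge f)) := {w | (∃ K, IsChainWord g K w) ∧ w.length ≤ m} with hV
  set D : LoopShift f → (List (Truncated f a) × Truncated f a × List (Truncated f a)) ×
      List (LoopEdge f) := fun x =>
    ((word (fun i => trunc a (edges x i)) (-a) a, trunc a (edges x 0),
      word (fun i => trunc a (edges x i)) m a),
      word (edges x) (tailLen (edges x 0)) (m - tailLen (edges x 0))) with hD
  have hle : (name (sigma f) P m '' chainStart g m).ncard ≤ (U ×ˢ V).ncard := by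
    refine ncard_image_le_of_factors (D := D) ?_ (hUfin.prod hfin) ?_
    · intro x hx x' hx' hxx
      simp only [hD, Prod.mk.injEq] at hxx
      obtain ⟨⟨h1, h2, h3⟩, h4⟩ := hxx
      have ht : tailLen (edges x 0) = tailLen (edges x' 0) := by
        have h5 := congrArg List.length h4
        simp only [length_word] at h5
        have := hx.1
        have := hx'.1
        omega
      have key : ∀ i : ℤ, -a ≤ i → i < m + a → trunc a (edges x' i) = trunc a (edges x i) := by
        intro i hi1 hi2
        rcases lt_or_ge i 0 with hi | hi
        · exact (eq_of_word_eq h1 hi1 (by omega)).symm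
        rcases le_or_gt (m : ℤ) i with hm | hm
        · exact (eq_of_word_eq h3 hm hi2).symm
        lift i to ℕ using hi
        rcases lt_or_ge i (tailLen (edges x 0)) with hlt | hge
        · exact trunc_eq_of_lt_tailLen h2.symm hlt (ht ▸ hlt)
        · rw [← ht] at h4
          rw [eq_of_word_eq h4 (j := i) (by omega) (by omega)]
      refine List.ext_getElem (by simp) fun j hj1 hj2 => ?_
      rw [length_name] at hj1
      simp only [name, List.getElem_map, List.getElem_range]
      refine hP _ _ fun i hi => ?_
      rw [Finset.mem_Icc] at hi
      rw [edges_sigma_iterate, edges_sigma_iterate]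
      exact key _ (by omega) (by omega)
    · intro x hx
      have hlen : ∀ i, word (fun i => trunc a (edges x i)) i a ∈ L := fun i => length_word _ _ _
      refine ⟨⟨hlen _, Set.mem_univ _, hlen _⟩, hx.2, ?_⟩
      simp only [hD, length_word]
      omega
  calc ((name (sigma f) P m '' chainStart g m).ncard : ℝ) ≤ ((U ×ˢ V).ncard : ℕ) := by
        exact_mod_cast hle
    _ = U.ncard * (V.ncard : ℝ) := by rw [Set.ncard_prod, Nat.cast_mul]
    _ ≤ U.ncard * (C * (s / (s - 1)) * s ^ m) := by gcongr
    _ = _ := by ring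

/-- The invariant measures for which almost all markers get deleted have entropy at most
`log s`, for each `s` larger than the growth rate of the multiplicities. -/
lemma measureEntropy_le_log {s : ℝ} (hs : 1 < s) (hr : Monotone r) (hr0 : ∀ k, 0 < r k)
    (hlim : Tendsto r atTop atTop) (hfin : ∀ n, {k | r k = n}.Finite)
    (hgs : growth (mult r) < ENNReal.ofReal s) (hgr : ∀ k, (g k).length = r k)
    {ν : Measure (LoopShift f)} [IsProbabilityMeasure ν] (hν : MeasurePreserving (sigma f) ν ν)
    (h0 : ∀ᵐ x ∂ν, markers g x = ∅) : measureEntropy (sigma f) ν ≤ Real.log s := by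
  obtain ⟨C, hC1, hC⟩ := exists_prodVal_le hs hr0 hfin hgs
  have hg0 : ∀ k, g k ≠ [] := fun k => by
    rw [← List.length_pos_iff, hgr]; exact hr0 k
  refine iSup_le fun k => iSup_le fun P => iSup_le fun hP => ?_
  refine partitionEntropy_le_log hν hP hs fun ε hε => ?_
  obtain ⟨P', a, hP', herr, hw⟩ := exists_window_partition (ν := ν) hP hε
  obtain ⟨K, hK⟩ := exists_ncard_names_le (g := g) hs hr hr0 hlim hgr (by linarith) hC hw
  refine ⟨P', hP', herr, chainStart g, K, measurableSet_chainStart g, hK, ?_⟩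
  filter_upwards [h0] with x hx M
  exact exists_mem_chainStart hg0 hx M

end MissedWalks

/-! ### Entropy of the loop shift of the limit series -/

section Conclusion

variable {f F : ℕ⟦X⟧} {r : ℕ → ℕ} {g : ℕ → List (LoopEdge f)}

lemma log_lt_log_of_ofReal_lt {s : ℝ} {l : ℝ≥0∞} (hs : 1 < s) (hsl : ENNReal.ofReal s < l) :
    (Real.log s : EReal) < ENNReal.log l := by
  rw [← ENNReal.log_ofReal_of_pos (by linarith)]
  exact ENNReal.log_lt_log hsl

/-- The loop shifts of `f` and `F` have the same entropy, as the invariant measures of `σ_f` split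
into a part on the image of the code and a part without markers, of entropy less than `log l`. -/
lemma entropy_eq
    (e : ∀ m, Fin (coeff m F) ≃ {w // w ∈ Prim (stageInf (closedWalks f) g) ∧ w.length = m})
    (hr : Monotone r) (hr0 : ∀ k, 0 < r k) (hlim : Tendsto r atTop atTop)
    (hfin : ∀ n, {k | r k = n}.Finite) (hg : ∀ k, g k ∈ Prim (stage (closedWalks f) g k))
    (hgr : ∀ k, (g k).length = r k) {l : ℝ≥0∞} (h1 : 1 < l)
    (hl : entropy (sigma f) = ENNReal.log l) (hgl : growth (mult r) < l) :
    entropy (sigma F) = ENNReal.log l := by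
  have hφ := measurableEmbedding_loopCode e hg
  have hcomm := loopCode_sigma e
  refine le_antisymm ?_ ?_
  · rw [← hl]
    refine iSup_le fun μ => iSup_le fun hμ => iSup_le fun hT => ?_
    have hμ' : IsProbabilityMeasure (μ.map (loopCode e)) :=
      Measure.isProbabilityMeasure_map hφ.measurable.aemeasurable
    have hT' : MeasurePreserving (sigma f) (μ.map (loopCode e)) (μ.map (loopCode e)) := by
      refine ⟨(continuous_sigma f).measurable, ?_⟩
      rw [Measure.map_map (continuous_sigma f).measurable hφ.measurable,
        show sigma f ∘ loopCode e = loopCode e ∘ sigma F from funext fun x => (hcomm x).symm,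
        ← Measure.map_map hφ.measurable hT.measurable, hT.map_eq]
    rw [← measureEntropy_map hφ hcomm μ]
    exact le_iSup_of_le _ (le_iSup_of_le hμ' (le_iSup_of_le hT' le_rfl))
  · obtain ⟨s, hs, hgs, hsl⟩ := exists_real_between hgl h1
    have hmax : ENNReal.log l ≤ max (entropy (sigma F)) (Real.log s) := by
      rw [← hl]
      refine iSup_le fun ν => iSup_le fun hν => iSup_le fun hT => ?_
      refine measureEntropy_le_of_invariant hT hφ.measurableSet_range (sigma_preimage_range e)
        ?_ ?_
      · intro ν hν hT h0
        obtain ⟨μ, hμ, hμT, rfl⟩ :=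
          exists_lift hφ hcomm (continuous_sigma F).measurable hT h0
        rw [measureEntropy_map hφ hcomm μ]
        exact le_max_of_le_left (le_iSup_of_le _ (le_iSup_of_le hμ (le_iSup_of_le hμT le_rfl)))
      · intro ν hν hT h0
        exact le_max_of_le_right (measureEntropy_le_log hs hr hr0 hlim hfin hgs hgr hT
          (ae_markers_eq_empty e hg hT h0))
    exact (le_max_iff.1 hmax).resolve_right (log_lt_log_of_ofReal_lt hs hsl).not_ge

lemma isSPR_iff {l : ℝ≥0∞} (h1 : 1 < l) (hl : entropy (sigma f) = ENNReal.log l) :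
    IsSPR f ↔ l < ⊤ ∧ growth (fun n => coeff n f) < l := by
  constructor
  · rintro ⟨l', h2, -, h3, h4⟩
    obtain rfl : l = l' := ENNReal.log_injective (hl.symm.trans h2)
    exact ⟨ENNReal.log_lt_top_iff.1 h3, h4⟩
  · rintro ⟨h2, h3⟩
    exact ⟨l, hl, ENNReal.zero_lt_log_iff.2 h1, ENNReal.log_lt_top_iff.2 h2, h3⟩

/-- The exceptional sets are the empty set and the complement of the image of the code. -/
lemma isEntropyConjugacy_loopCode
    (e : ∀ m, Fin (coeff m F) ≃ {w // w ∈ Prim (stageInf (closedWalks f) g) ∧ w.length = m})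
    (hr : Monotone r) (hr0 : ∀ k, 0 < r k)
    (hlim : Tendsto r atTop atTop) (hfin : ∀ n, {k | r k = n}.Finite)
    (hg : ∀ k, g k ∈ Prim (stage (closedWalks f) g k)) (hgr : ∀ k, (g k).length = r k)
    {l : ℝ≥0∞} (h1 : 1 < l) (hl : entropy (sigma f) = ENNReal.log l)
    (hgl : growth (mult r) < l) : IsEntropyConjugacy (sigma F) (sigma f) (loopCode e) := by
  have hφ := measurableEmbedding_loopCode e hg
  have hF := entropy_eq e hr hr0 hlim hfin hg hgr h1 hl hgl
  have hpos : 0 < ENNReal.log l := ENNReal.zero_lt_log_iff.2 h1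
  refine ⟨∅, (Set.range (loopCode e))ᶜ, ⟨MeasurableSet.empty, 0, by rwa [hF], ?_⟩,
    ⟨hφ.measurableSet_range.compl, ?_⟩, by simp, fun x _ => (loopCode_sigma e x).symm, ?_⟩
  · intro μ _ _ _
    exact measure_empty
  · obtain ⟨s, hs, hgs, hsl⟩ := exists_real_between hgl h1
    refine ⟨Real.log s, by rw [hl]; exact log_lt_log_of_ofReal_lt hs hsl, ?_⟩
    intro ν hν herg hlt
    have hR := hφ.measurableSet_range
    rcases herg.toPreErgodic.prob_eq_zero_or_one hR (sigma_preimage_range e) with h0 | h0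
    · exact absurd (measureEntropy_le_log hs hr hr0 hlim hfin hgs hgr herg.toMeasurePreserving
        (ae_markers_eq_empty e hg herg.toMeasurePreserving h0)) hlt.not_ge
    · exact (prob_compl_eq_zero_iff hR).2 h0
  · have hγ : MeasurableEmbedding (fun x : ((∅ : Set (LoopShift F))ᶜ : Set (LoopShift F)) =>
        loopCode e x) :=
      hφ.comp (MeasurableEmbedding.subtype_coe MeasurableSet.empty.compl)
    have hrange : Set.range (fun x : ((∅ : Set (LoopShift F))ᶜ : Set (LoopShift F)) =>
        loopCode e x) = (Set.range (loopCode e))ᶜᶜ := by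
      ext y; simp
    exact ⟨hγ.equivRange.trans
      { toEquiv := Equiv.setCongr hrange
        measurable_toFun := measurable_subtype_coe.subtype_mk
        measurable_invFun := measurable_subtype_coe.subtype_mk }, fun x =>
      congrArg Subtype.val (hγ.equivRange_apply x)⟩

end Conclusion

end LoopsLemma

end

open LoopsLemma in
theorem lemma5p2 (f : ℕ⟦X⟧) (r : ℕ → ℕ) (l : ℝ≥0∞)
    (hf : constantCoeff f = 0)
    (hmix : IsMixing (sigma f))
    (hpos : 0 < entropy (sigma f))
    (hl : entropy (sigma f) = ENNReal.log l)
    (hr : Monotone r) (hr0 : ∀ k, 0 < r k)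
    (hposit : ∀ k, 1 ≤ coeff (r k) (deleted f r k)) :
    -- the construction makes sense
    (∀ k, (1 - deleted f r (k + 1)) * (1 - X ^ r k) = 1 - deleted f r k) ∧
    (∀ k, constantCoeff (deleted f r k) = 0 ∧ ∀ n, 0 ≤ coeff n (deleted f r k)) ∧
    Tendsto r atTop atTop ∧
    (∀ n, {k | r k = n}.Finite) ∧
    -- the limit series `F` exists
    ∃ F : ℕ⟦X⟧, constantCoeff F = 0 ∧
      (∀ n, ∀ᶠ k in atTop, coeff n (deleted f r k) = ((coeff n F : ℕ) : ℤ)) ∧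
      -- the one-block code, and its injectivity
      (∃ φ : LoopShift F → LoopShift f, IsOneBlockCode φ ∧ Function.Injective φ) ∧
      -- the series `f^{(n)}` is `deleted f r (K n)`
      (∃ K : ℕ → ℕ, (∀ n j, r j < n ↔ j < K n) ∧
        ∀ n, 1 ≤ n →
          (1 - deleted f r (K (n + 1))) * (1 - X ^ n) ^ mult r n = 1 - deleted f r (K n)) ∧
      -- the infinite product, taken over all `n ≥ 1`
      (∃ P : ℤ⟦X⟧, HasProd (fun n : ℕ => (1 - X ^ (n + 1) : ℤ⟦X⟧) ^ mult r (n + 1)) P ∧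
        constantCoeff P = 1 ∧ (1 - toInt F) * P = 1 - toInt f) ∧
      -- entropy
      (growth (mult r) < l → entropy (sigma F) = ENNReal.log l) ∧
      -- strong positive recurrence
      (growth (mult r) < l → (IsSPR f ↔ IsSPR F)) ∧
      -- magic word
      ((∀ n, mult r n ≤ coeff n f) → mult r (r 0) < coeff (r 0) f →
        ∃ φ : LoopShift F → LoopShift f,
          IsOneBlockCode φ ∧ Function.Injective φ ∧ HasMagicWord φ) ∧
      -- magic word and entropy-conjugacy
      ((∀ n, mult r n ≤ coeff n f) → mult r (r 0) < coeff (r 0) f → growth (mult r) < l →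
        ∃ φ : LoopShift F → LoopShift f,
          IsOneBlockCode φ ∧ Function.Injective φ ∧ HasMagicWord φ ∧
          IsEntropyConjugacy (sigma F) (sigma f) φ) := by
  have h1 : 1 < l := by rwa [hl, ENNReal.zero_lt_log_iff] at hpos
  have hlim := tendsto_lengths hf hr hr0 hposit
  have hfin := finite_lengths_eq hlim
  obtain ⟨F, hF⟩ := exists_limit hr0 hr hlim hposit
  have hcode : ∀ g : ℕ → List (LoopEdge f),
      (∀ k, g k ∈ Prim (stage (closedWalks f) g k) ∧ (g k).length = r k) →
      Nonempty (∀ m, Fin (coeff m F) ≃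
        {w // w ∈ Prim (stageInf (closedWalks f) g) ∧ w.length = m}) := fun g hg =>
    ⟨fun m => (exists_equiv hf hr0 hr hlim hF (fun k => (hg k).1) (fun k => (hg k).2) m).some⟩
  obtain ⟨g, hg⟩ := exists_elims hf hr0 hposit
  obtain ⟨e⟩ := hcode g hg
  have hent : growth (mult r) < l → entropy (sigma F) = ENNReal.log l :=
    entropy_eq e hr hr0 hlim hfin (fun k => (hg k).1) (fun k => (hg k).2) h1 hl
  have hone : ∀ {g : ℕ → List (LoopEdge f)} (e : ∀ m, Fin (coeff m F) ≃
      {w // w ∈ Prim (stageInf (closedWalks f) g) ∧ w.length = m}),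
      IsOneBlockCode (loopCode e) := fun e => isOneBlockCode_codeMap e _
  refine ⟨one_sub_deleted_succ_mul hr0, fun k => ⟨?_, coeff_deleted_nonneg hr0 hposit k⟩, hlim,
    hfin, F, ?_, fun n => ?_, ⟨loopCode e, hone e, loopCode_injective e fun k => (hg k).1⟩,
    ⟨numLt r, lt_iff_lt_numLt hr hlim, fun n _ => one_sub_deleted_numLt hr hr0 hlim n⟩,
    exists_hasProd hr hr0 hlim hF, hent, fun hgl => ?_, fun hle hlt => ?_, fun hle hlt hgl => ?_⟩
  · rw [← coeff_zero_eq_constantCoeff_apply]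
    exact coeff_zero_deleted hf hr0 k
  · rw [← coeff_zero_eq_constantCoeff_apply]
    have := hF 0 0 (hr0 0)
    rw [coeff_zero_deleted hf hr0] at this
    exact_mod_cast this.symm
  · filter_upwards [hlim.eventually_gt_atTop n] with k hk using hF n k hk
  · rw [isSPR_iff h1 hl, isSPR_iff h1 (hent hgl), growth_lt_iff h1 hr0 hlim hfin hF hgl]
  · obtain ⟨g, i, hg, hgp, hne⟩ := exists_elims_loopPath hf hfin hle hlt
    obtain ⟨e⟩ := hcode g hg
    exact ⟨loopCode e, hone e, loopCode_injective e fun k => (hg k).1,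
      hasMagicWord_loopCode e (fun k => (hg k).1) hgp (hr0 0) hne⟩
  · obtain ⟨g, i, hg, hgp, hne⟩ := exists_elims_loopPath hf hfin hle hlt
    obtain ⟨e⟩ := hcode g hg
    exact ⟨loopCode e, hone e, loopCode_injective e fun k => (hg k).1,
      hasMagicWord_loopCode e (fun k => (hg k).1) hgp (hr0 0) hne,
      isEntropyConjugacy_loopCode e hr hr0 hlim hfin (fun k => (hg k).1) (fun k => (hg k).2)
        h1 hl hgl⟩
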